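/- Let $r,s\in\mathbb N$ and $d\ge 2$, let $F_1,\dots,F_r\in\mathbb Z[X_1,\dots,X_s]$ be forms of degree $d$, and write $$F_i(\mathbf x)=\sum_{1\le j_1,\dots,j_d\le s}c^{(i)}_{j_1,\dots,j_d}x_{j_1}\cdots x_{j_d}\qquad(1\le i\le r)$$ with rational coefficients $c^{(i)}_{j_1,\dots,j_d}$ that are symmetric in $j_1,\dots,j_d$. For $\boldsymbol\alpha\in\mathbb R^r$, $\mathbf x^{(1)},\dots,\mathbf x^{(d-1)}\in\mathbb Z^s$ and $1\le j\le s$ put $$\Phi_j(\boldsymbol\alpha;\mathbf x^{(1)},\dots,\mathbf x^{(d-1)})=\sum_{i=1}^r\alpha_i\, d!\sum_{1\le j_1,\dots,j_{d-1}\le s}c^{(i)}_{j,j_1,\dots,j_{d-1}}x^{(1)}_{j_1}\cdots x^{(d-1)}_{j_{d-1}}.$$ Let $\mathcal B\subset\mathbb R^s$ be a box with sides parallel to the coordinate axes (a product of bounded intervals), and put $$S(\boldsymbol\alpha)=\sum_{\mathbf x\in\mathbb Z^s\cap P\mathcal B}e(\alpha_1F_1(\mathbf x)+\dots+\alpha_rF_r(\mathbf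 x)),\qquad e(t)=e^{2\pi i t}.$$ Let $\mathcal B'\subset\mathbb R^s$ be another such box, containing the origin in its interior (for example $[-1,1]^s$, or $\mathcal B$ itself if $\mathbf 0$ is an interior point of $\mathcal B$), and for $\mathbf a\in\mathbb Z^r$ and $H>0$ let $$M(\mathbf a;H)=\#\{(\mathbf x^{(1)},\dots,\mathbf x^{(d-1)})\in(\mathbb Z^s\cap H\mathcal B')^{d-1}:\ \Phi_j(\mathbf a;\mathbf x^{(1)},\dots,\mathbf x^{(d-1)})=0\ (1\le j\le s)\}.$$ Then for every $\varepsilon>0$ there are constants $C,c>0$, depending only on $s,r,d,F_1,\dots,F_r,\mathcal B,\mathcal B'$ and $\varepsilon$, such that for all real $0<\theta\le1$, $k>0$, $P\ge1$ and all $\boldsymbol\alpha\in\mathbb R^r$ at least one of the following holds: (i) $|S(\boldsymbol\alpha)|\le C\,P^{s-k}$; (ii) there are integers $a_1,\dots,a_r,q$ with $\gcd(a_1,\dots,a_r,q)=1$, $1\le q\le C\,P^{r(d-1)\theta}$ and $|q\alpha_i-a_i|\le C\,P^{-d+r(d-1)\theta}$ for $1\le i\le r$; (iii) there are integers $a_1,\dots,a_r$,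 not all zero, such that $$M(a_1,\dots,a_r;P^\theta)\ \ge\ c\,(P^\theta)^{(d-1)s-2^{d-1}k/\theta-\varepsilon}.$$ -/

import Mathlib

/-- The symmetric coefficient `c_{j_1, …, j_n}` of a form `F` of degree `n`: the coefficient of the
monomial `X_{j_1} ⋯ X_{j_n}` in `F`, divided by the multinomial coefficient
`n! / (m_1! ⋯ m_s!)` that counts the distinct rearrangements of `(j_1, …, j_n)`. -/
noncomputable def symCoeff {s n : ℕ} (F : MvPolynomial (Fin s) ℤ) (J : Fin n → Fin s) : ℚ :=
  ((F.coeff (∑ t, Finsupp.single (J t) 1) : ℤ) : ℚ) *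
    (∏ l : Fin s, (((∑ t, Finsupp.single (J t) 1 : Fin s →₀ ℕ) l).factorial : ℚ)) /
      (n.factorial : ℚ)

/-- The symmetric coefficients do not depend on the order of the indices. -/
theorem symCoeff_comp_perm {s n : ℕ} (F : MvPolynomial (Fin s) ℤ) (J : Fin n → Fin s)
    (σ : Equiv.Perm (Fin n)) : symCoeff F (J ∘ σ) = symCoeff F J := by
  have h : (∑ t, Finsupp.single ((J ∘ σ) t) 1 : Fin s →₀ ℕ) = ∑ t, Finsupp.single (J t) 1 :=
    Equiv.sum_comp σ (fun t => (Finsupp.single (J t) 1 : Fin s →₀ ℕ))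
  simp only [symCoeff, h]

/-- A form is the sum of its symmetric coefficients times the corresponding monomials. -/
theorem eq_sum_symCoeff {s n : ℕ} (F : MvPolynomial (Fin s) ℤ) (hF : F.IsHomogeneous n) :
    MvPolynomial.map (Int.castRingHom ℚ) F =
      ∑ J : Fin n → Fin s, MvPolynomial.C (symCoeff F J) * ∏ t, MvPolynomial.X (J t) := by
  classical
  have hmon : ∀ J : Fin n → Fin s, (∏ t, MvPolynomial.X (J t) : MvPolynomial (Fin s) ℚ) =
      MvPolynomial.monomial (∑ t, Finsupp.single (J t) 1) 1 := by
    intro J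
    rw [MvPolynomial.monomial_sum_one]
    rfl
  ext m
  by_cases hm : m.degree = n
  swap
  · have h1 : F.coeff m = 0 := by
      by_contra h
      exact hm (by rw [Finsupp.degree_eq_weight_one]; exact hF h)
    rw [MvPolynomial.coeff_map, h1, MvPolynomial.coeff_sum, map_zero]
    symm
    apply Finset.sum_eq_zero
    intro J _
    rw [hmon, MvPolynomial.coeff_C_mul, MvPolynomial.coeff_monomial, if_neg, mul_zero]
    rintro rfl
    exact hm (by simp [map_sum, Finsupp.degree_single])
  have hsum : ∑ l, m l = n := by rw [← hm, Finsupp.degree_eq_sum]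
  have hcount : (∑ J : Fin n → Fin s,
      if (∑ t, Finsupp.single (J t) 1 : Fin s →₀ ℕ) = m then (1 : ℚ) else 0) =
      Nat.multinomial Finset.univ m := by
    have h1 : (∑ l : Fin s, (MvPolynomial.X l : MvPolynomial (Fin s) ℚ)) ^ n =
        ∑ J : Fin n → Fin s, ∏ t, MvPolynomial.X (J t) := by
      have := Finset.prod_univ_sum (fun _ : Fin n => (Finset.univ : Finset (Fin s)))
        (fun _ l => (MvPolynomial.X l : MvPolynomial (Fin s) ℚ))
      simpa [Fintype.piFinset_univ] using this
    have h2 := congrArg (MvPolynomial.coeff m) h1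
    rw [Finset.sum_pow_eq_sum_piAntidiag, MvPolynomial.coeff_sum, MvPolynomial.coeff_sum] at h2
    simp only [hmon, MvPolynomial.coeff_monomial] at h2
    rw [← h2, Finset.sum_eq_single (m : Fin s → ℕ)]
    · have : (∏ l, MvPolynomial.X l ^ m l : MvPolynomial (Fin s) ℚ) =
          MvPolynomial.monomial m 1 := by
        rw [MvPolynomial.monomial_eq, Finsupp.prod_fintype _ _ (by simp)]
        simp
      rw [this, ← map_natCast (MvPolynomial.C (σ := Fin s) (R := ℚ)), MvPolynomial.coeff_C_mul]
      simp
    · intro k _ hk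
      have : (∏ l, MvPolynomial.X l ^ k l : MvPolynomial (Fin s) ℚ) =
          MvPolynomial.monomial (Finsupp.equivFunOnFinite.symm k) 1 := by
        rw [MvPolynomial.monomial_eq, Finsupp.prod_fintype _ _ (by simp)]
        simp
      rw [this, ← map_natCast (MvPolynomial.C (σ := Fin s) (R := ℚ)), MvPolynomial.coeff_C_mul,
        MvPolynomial.coeff_monomial, if_neg, mul_zero]
      rintro rfl
      exact hk rfl
    · intro h
      exact absurd (by simp [Finset.mem_piAntidiag, hsum]) h
  have hspec : (∏ l, ((m l).factorial : ℚ)) * Nat.multinomial Finset.univ m = n.factorial := by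
    have := Nat.multinomial_spec Finset.univ m
    rw [hsum] at this
    exact_mod_cast this
  have hn : (n.factorial : ℚ) ≠ 0 := by positivity
  rw [MvPolynomial.coeff_map, MvPolynomial.coeff_sum]
  have : ∀ J : Fin n → Fin s, MvPolynomial.coeff m
      (MvPolynomial.C (symCoeff F J) * ∏ t, MvPolynomial.X (J t)) =
      ((F.coeff m : ℤ) : ℚ) * (∏ l, ((m l).factorial : ℚ)) / n.factorial *
        (if (∑ t, Finsupp.single (J t) 1 : Fin s →₀ ℕ) = m then (1 : ℚ) else 0) := by
    intro J
    rw [hmon, MvPolynomial.coeff_C_mul, MvPolynomial.coeff_monomial]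
    split_ifs with h
    · rw [symCoeff, h]
    · simp
  rw [Finset.sum_congr rfl (fun J _ => this J), ← Finset.mul_sum, hcount]
  field_simp
  rw [mul_assoc, hspec]
  simp

/-- `Ψ_j(x^{(1)}, …, x^{(d-1)}) =
d! ∑_{j_1, …, j_{d-1}} c_{j, j_1, …, j_{d-1}} x^{(1)}_{j_1} ⋯ x^{(d-1)}_{j_{d-1}}`
for a form `F` of degree `d ≥ 1`. -/
noncomputable def polarForm {s : ℕ} (d : ℕ) (F : MvPolynomial (Fin s) ℤ) (j : Fin s)
    (x : Fin (d - 1) → Fin s → ℤ) : ℚ :=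
  (d.factorial : ℚ) * ∑ J : Fin (d - 1) → Fin s,
    symCoeff F (Fin.cons j J : Fin (d - 1 + 1) → Fin s) * ∏ t, (x t (J t) : ℚ)

/-- `Φ_j(α; x^{(1)}, …, x^{(d-1)}) = ∑_i α_i Ψ_j^{(i)}(x^{(1)}, …, x^{(d-1)})`. -/
noncomputable def pencilForm {s r : ℕ} (d : ℕ) (F : Fin r → MvPolynomial (Fin s) ℤ) (α : Fin r → ℝ)
    (j : Fin s) (x : Fin (d - 1) → Fin s → ℤ) : ℝ :=
  ∑ i, α i * (polarForm d (F i) j x : ℝ)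

/-- A box with sides parallel to the coordinate axes: a product of bounded intervals, each of
which may be open, closed or half-open. -/
def IsBox {s : ℕ} (B : Set (Fin s → ℝ)) : Prop :=
  ∃ I : Fin s → Set ℝ,
    (∀ l, (I l).OrdConnected ∧ Bornology.IsBounded (I l)) ∧ B = Set.univ.pi I

/-- The integer points of the dilate `H B = {H b : b ∈ B}`. -/
def latticePoints {s : ℕ} (B : Set (Fin s → ℝ)) (H : ℝ) : Set (Fin s → ℤ) :=
  {x | ∃ b ∈ B, ∀ l, (x l : ℝ) = H * b l}

/-- A dilated box has finitely many integer points, so the sum and the cardinality below are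
genuine. -/
theorem latticePoints_finite {s : ℕ} {B : Set (Fin s → ℝ)} (hB : IsBox B) (H : ℝ) :
    (latticePoints B H).Finite := by
  obtain ⟨I, hI, rfl⟩ := hB
  have hb : ∀ l, ∃ R : ℝ, ∀ y ∈ I l, |y| ≤ R := fun l => by
    obtain ⟨R, hR⟩ := (hI l).2.exists_norm_le
    exact ⟨R, fun y hy => by simpa using hR y hy⟩
  choose R hR using hb
  refine (Set.finite_Icc (fun l => -⌈|H| * R l⌉) (fun l => ⌈|H| * R l⌉)).subset ?_
  rintro x ⟨b, hbI, hx⟩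
  have key : ∀ l, |(x l : ℝ)| ≤ (⌈|H| * R l⌉ : ℤ) := fun l => by
    rw [hx l, abs_mul]
    exact (mul_le_mul_of_nonneg_left (hR l _ (hbI l (Set.mem_univ l))) (abs_nonneg H)).trans
      (Int.le_ceil _)
  refine ⟨fun l => ?_, fun l => ?_⟩
  · have := (abs_le.mp (key l)).1
    exact_mod_cast this
  · have := (abs_le.mp (key l)).2
    exact_mod_cast this

/-- `S(α) = ∑_{x ∈ P B} e(α_1 F_1(x) + ⋯ + α_r F_r(x))`, where `e(t) = exp(2 π i t)`. -/
noncomputable def expSum {s r : ℕ} (F : Fin r → MvPolynomial (Fin s) ℤ) (B : Set (Fin s → ℝ))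
    (P : ℝ) (α : Fin r → ℝ) : ℂ :=
  ∑ᶠ x ∈ latticePoints B P,
    Complex.exp (2 * Real.pi * Complex.I *
      ((∑ i, α i * ((MvPolynomial.eval x (F i) : ℤ) : ℝ) : ℝ) : ℂ))

/-- `M(a; H)`: the number of tuples `(x^{(1)}, …, x^{(d-1)})` of integer points of `H B` with
`Φ_j(a; x^{(1)}, …, x^{(d-1)}) = 0` for all `j`. -/
noncomputable def zeroCount {s r : ℕ} (d : ℕ) (F : Fin r → MvPolynomial (Fin s) ℤ)
    (B : Set (Fin s → ℝ)) (a : Fin r → ℤ) (H : ℝ) : ℕ :=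
  Set.ncard {x : Fin (d - 1) → Fin s → ℤ |
    (∀ t, x t ∈ latticePoints B H) ∧ ∀ j, pencilForm d F (fun i => (a i : ℝ)) j x = 0}

/-!
Suppose `|S(α)| > P^{s-k}`. Weyl differencing turns this into many tuples `x` of `d - 1` integer
vectors of size about `P` at which all forms `Φ_j(α; x)` are within `1/P` of an integer. Since each
`Φ_j` is linear in each vector, with a matrix that is symmetric in `j` and the coordinate, the
vectors can be shrunk one after another to size `P^θ`, after which the `Φ_j(α; x)` are within
`P^{-d+(d-1)θ}` of an integer. The value `Φ_j(α; x)` is a linear form in `α` with small integer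
coefficients. If `r` of the coefficient vectors that occur are independent, Cramer's rule gives the
rational approximation to `α` (`exists_approx_of_det_ne_zero`); otherwise all of them are orthogonal
to one integer vector `a ≠ 0`, and the tuples are counted by `M(a; P^θ)`.

The constants do not depend on `θ`, which may be as small as `1 / log P`, so a power of `log P`, as
it is lost in the usual form of Weyl's inequality, is not negligible against `(P^θ)^ε`. A loss of
`P^{kη}` for a small constant `η` is harmless: if `k` exceeds a constant multiple of `θ`, then the
exponent in the third alternative is negative and the zero tuple suffices, and otherwise this loss
is a small power of `P^θ`. Therefore the box is first
smoothed on the scale `L ≈ P^{1-k}` (`exists_le_norm_sum_trapezoid`). Two summations by parts show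
that the exponential sums left after differencing decay like `(P/L)^η (P‖Φ_j‖)^{-1-η}`
(`TameWeight.norm_sum_unitExp_le`), and this is summable over the cells of the torus
(`sum_prod_decay_le`).

The shrinking of one vector is Davenport's lemma (`exists_ncard_approxPairs_shrink`), which is
commonly deduced from Minkowski's second theorem and the duality of successive minima. Here it
follows from two elementary facts about the number `N(t)` of points in a cube of side `t` of the
lattice `{(H⁻¹ h, δ⁻¹ (A h - m))}`, where `A` is symmetric. Firstly, `N(a) N(b) ≪ N(az) N(b/z)` for
`a ≤ b` and `z ≤ 1`: a pair `(u, v)` is sent to `(u - c, v + ⌈b/(az)⌉ c)`, where `c` is a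
representative of the cell of side `az` that contains `u`; the image determines this cell up to
boundedly many choices (`ncard_cubePreimage_mul_le`). Secondly, the symmetry of `A` relates the
points at scale `t` to those at the dual scale, by a second moment of exponential sums
(`exists_ncard_approxPairs_le_dual`).
-/

/-! ### Lattice points in cubes -/

/-- The elements of an additive group `G` whose image under `ψ : G → ℝ^ι` lies in the cube
`[-t, t]^ι`. -/
def cubePreimage {G ι : Type*} [AddCommGroup G] (ψ : G →+ (ι → ℝ)) (t : ℝ) : Set G :=
  {g | ∀ i, |ψ g i| ≤ t}

theorem abs_sub_le_of_floor_div_eq {x y t : ℝ} (ht : 0 < t) (h : ⌊x / t⌋ = ⌊y / t⌋) :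
    |x - y| ≤ t := by
  have h1 := Int.abs_sub_lt_one_of_floor_eq_floor h
  rw [← sub_div, abs_div, abs_of_pos ht, div_lt_one ht] at h1
  exact h1.le

theorem abs_floor_sub_floor_le {x y : ℝ} (h : |x - y| ≤ 2) : |⌊x⌋ - ⌊y⌋| ≤ 2 := by
  have h1 := Int.floor_le x
  have h2 := Int.lt_floor_add_one x
  have h3 := Int.floor_le y
  have h4 := Int.lt_floor_add_one y
  rw [abs_le] at h ⊢
  constructor
  · have : (-3 : ℝ) < ((⌊x⌋ - ⌊y⌋ : ℤ) : ℝ) := by push_cast; linarith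
    have : (-3 : ℤ) < ⌊x⌋ - ⌊y⌋ := by exact_mod_cast this
    omega
  · have : ((⌊x⌋ - ⌊y⌋ : ℤ) : ℝ) < 3 := by push_cast; linarith
    have : ⌊x⌋ - ⌊y⌋ < 3 := by exact_mod_cast this
    omega

/-- The doubled cube is covered by `5 ^ n` cells, and the differences within a cell lie in the
original cube. -/
theorem ncard_cubePreimage_two_mul_le {G ι : Type*} [AddCommGroup G] [Fintype ι]
    (ψ : G →+ (ι → ℝ)) (hfin : ∀ t, (cubePreimage ψ t).Finite) {t : ℝ} (ht : 0 < t) :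
    (cubePreimage ψ (2 * t)).ncard ≤ 5 ^ Fintype.card ι * (cubePreimage ψ t).ncard := by
  classical
  rw [Set.ncard_eq_toFinset_card _ (hfin (2 * t)), Set.ncard_eq_toFinset_card _ (hfin t),
    mul_comm (5 ^ _)]
  have hcard : (Fintype.piFinset fun _ : ι => Finset.Icc (-2 : ℤ) 2).card =
      5 ^ Fintype.card ι := by
    simp
  rw [← hcard]
  refine Finset.card_le_mul_card_image_of_maps_to (f := fun g i => ⌊ψ g i / t⌋) ?_ _ ?_
  · intro g hg
    rw [Set.Finite.mem_toFinset] at hg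
    rw [Fintype.mem_piFinset]
    intro i
    have h1 : |ψ g i / t| ≤ 2 := by
      rw [abs_div, abs_of_pos ht, div_le_iff₀ ht]
      exact hg i
    rw [Finset.mem_Icc, ← abs_le]
    simpa using abs_floor_sub_floor_le (y := 0) (by simpa using h1)
  · intro b _
    rcases Finset.eq_empty_or_nonempty
      ({g ∈ (hfin (2 * t)).toFinset | (fun i => ⌊ψ g i / t⌋) = b}) with he | ⟨g₀, hg₀⟩
    · rw [he]; simp
    · refine Finset.card_le_card_of_injOn (fun g => g - g₀) ?_ (fun x _ y _ h => by simpa using h)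
      intro g hg
      simp only [Finset.coe_filter, Finset.mem_filter, Set.mem_ofPred_eq] at hg hg₀
      simp only [Set.Finite.coe_toFinset]
      intro i
      rw [map_sub, Pi.sub_apply]
      exact abs_sub_le_of_floor_div_eq ht ((congrFun hg.2 i).trans (congrFun hg₀.2 i).symm)

/-- The number of points of a discrete group in a cube is approximately log-convex as a function of
the side: shrinking the smaller of two cubes and enlarging the larger one by the same factor does
not decrease the product of the two counts by more than a constant. -/
theorem ncard_cubePreimage_mul_le {G ι : Type*} [AddCommGroup G] [Fintype ι]
    (ψ : G →+ (ι → ℝ)) (hfin : ∀ t, (cubePreimage ψ t).Finite) {a b z : ℝ} (ha : 0 < a)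
    (hb : 0 < b) (hab : a ≤ 4 * b) (hz : 0 < z) (hz1 : z ≤ 1) :
    (cubePreimage ψ a).ncard * (cubePreimage ψ b).ncard ≤
      5 ^ Fintype.card ι * ((cubePreimage ψ (a * z)).ncard *
        (cubePreimage ψ (6 * b / z)).ncard) := by
  classical
  have haz : 0 < a * z := mul_pos ha hz
  -- a representative in the cube of side `a` for each nonempty cell of side `a * z`
  have hrep : ∀ κ : ι → ℤ, ∃ c : G, (∃ g ∈ cubePreimage ψ a, (fun i => ⌊ψ g i / (a * z)⌋) = κ) →
      c ∈ cubePreimage ψ a ∧ (fun i => ⌊ψ c i / (a * z)⌋) = κ := by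
    intro κ
    by_cases h : ∃ g ∈ cubePreimage ψ a, (fun i => ⌊ψ g i / (a * z)⌋) = κ
    · obtain ⟨g, hg⟩ := h
      exact ⟨g, fun _ => hg⟩
    · exact ⟨0, fun h' => absurd h' h⟩
  choose rep hrep using hrep
  let cell : G → ι → ℤ := fun g i => ⌊ψ g i / (a * z)⌋
  have hcell : ∀ g ∈ cubePreimage ψ a,
      rep (cell g) ∈ cubePreimage ψ a ∧ cell (rep (cell g)) = cell g := fun g hg =>
    hrep (cell g) ⟨g, hg, rfl⟩
  let M : ℕ := ⌈b / (a * z)⌉₊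
  have hM1 : b / (a * z) ≤ M := Nat.le_ceil _
  have hM2 : (M : ℝ) < b / (a * z) + 1 := Nat.ceil_lt_add_one (by positivity)
  have hM0 : (0 : ℝ) < M := lt_of_lt_of_le (by positivity) hM1
  simp only [Set.ncard_eq_toFinset_card _ (hfin _)]
  rw [← Finset.card_product, ← Finset.card_product]
  refine Finset.card_le_mul_card_image_of_maps_to
    (f := fun p : G × G => (p.1 - rep (cell p.1), p.2 + M • rep (cell p.1))) ?_ _ ?_
  · rintro ⟨u, v⟩ huv
    simp only [Finset.mem_product, Set.Finite.mem_toFinset] at huv ⊢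
    obtain ⟨hu, hv⟩ := huv
    obtain ⟨hc, hc'⟩ := hcell u hu
    constructor
    · intro i
      rw [map_sub, Pi.sub_apply]
      exact abs_sub_le_of_floor_div_eq haz (congrFun hc'.symm i)
    · intro i
      rw [map_add, map_nsmul, Pi.add_apply, Pi.smul_apply, nsmul_eq_mul]
      calc |ψ v i + M * ψ (rep (cell u)) i| ≤ |ψ v i| + M * |ψ (rep (cell u)) i| := by
            refine (abs_add_le _ _).trans ?_
            rw [abs_mul, abs_of_pos hM0]
        _ ≤ b + (b / (a * z) + 1) * a := by
            gcongr
            · exact hv i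
            · exact hc i
        _ = b + b / z + a := by field_simp; ring
        _ ≤ b / z + b / z + 4 * (b / z) := by
            have : b ≤ b / z := by rw [le_div_iff₀ hz]; nlinarith
            linarith
        _ = 6 * b / z := by ring
  -- the cells of the elements `u` of a fibre differ by at most `2` in each coordinate
  · rintro ⟨p, q⟩ _
    set fib := {x ∈ (hfin a).toFinset ×ˢ (hfin b).toFinset |
      (x.1 - rep (cell x.1), x.2 + M • rep (cell x.1)) = (p, q)} with hfib
    rcases Finset.eq_empty_or_nonempty fib with he | ⟨⟨u₀, v₀⟩, h₀⟩
    · rw [he]; simp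
    have hmem : ∀ x ∈ fib, x.1 ∈ cubePreimage ψ a ∧ x.2 ∈ cubePreimage ψ b ∧
        x.1 - rep (cell x.1) = p ∧ x.2 + M • rep (cell x.1) = q := by
      intro x hx
      simpa [hfib, and_assoc] using hx
    obtain ⟨hu₀, hv₀, hp₀, hq₀⟩ := hmem _ h₀
    have hcard : (Fintype.piFinset fun i : ι =>
        Finset.Icc (cell u₀ i - 2) (cell u₀ i + 2)).card = 5 ^ Fintype.card ι := by
      have : ∀ x : ℤ, (x + 2 + 1 - (x - 2)).toNat = 5 := fun x => by
        have : x + 2 + 1 - (x - 2) = 5 := by ring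
        rw [this]; rfl
      simp [this]
    rw [← hcard]
    refine Finset.card_le_card_of_injOn (fun x => cell x.1) ?_ ?_
    · rintro ⟨u, v⟩ hx
      obtain ⟨hu, hv, hp, hq⟩ := hmem _ hx
      simp only at hu hv hp hq hp₀ hq₀ hu₀ hv₀
      rw [Finset.mem_coe, Fintype.mem_piFinset]
      intro i
      have h1 : v + M • rep (cell u) = v₀ + M • rep (cell u₀) := hq.trans hq₀.symm
      have h2 : ψ v i + M * ψ (rep (cell u)) i = ψ v₀ i + M * ψ (rep (cell u₀)) i := by
        have := congrFun (congrArg ψ h1) i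
        simpa [nsmul_eq_mul] using this
      have h3 : M * |ψ (rep (cell u)) i - ψ (rep (cell u₀)) i| ≤ 2 * b := by
        rw [← abs_of_pos hM0, ← abs_mul]
        have : (M : ℝ) * (ψ (rep (cell u)) i - ψ (rep (cell u₀)) i) = ψ v₀ i - ψ v i := by
          linarith
        rw [this]
        have h4 := abs_sub (ψ v₀ i) (ψ v i)
        have := hv i
        have := hv₀ i
        linarith
      have h5 : |ψ (rep (cell u)) i / (a * z) - ψ (rep (cell u₀)) i / (a * z)| ≤ 2 := by
        rw [← sub_div, abs_div, abs_of_pos haz, div_le_iff₀ haz]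
        have h6 : b ≤ M * (a * z) := by rwa [div_le_iff₀ haz] at hM1
        by_contra hlt
        push Not at hlt
        nlinarith
      have h7 := abs_floor_sub_floor_le h5
      have e1 : ⌊ψ (rep (cell u)) i / (a * z)⌋ = cell u i := congrFun (hcell u hu).2 i
      have e2 : ⌊ψ (rep (cell u₀)) i / (a * z)⌋ = cell u₀ i := congrFun (hcell u₀ hu₀).2 i
      rw [e1, e2, abs_le] at h7
      rw [Finset.mem_Icc]
      constructor <;> linarith [h7.1, h7.2]
    · rintro ⟨u, v⟩ hx ⟨u', v'⟩ hx' hc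
      obtain ⟨-, -, hp, hq⟩ := hmem _ hx
      obtain ⟨-, -, hp', hq'⟩ := hmem _ hx'
      simp only at hp hq hp' hq' hc
      rw [hc] at hp hq
      rw [Prod.mk.injEq]
      exact ⟨sub_left_injective (hp.trans hp'.symm), add_left_injective _ (hq.trans hq'.symm)⟩

/-! ### Smooth weights on the integers and their exponential sums -/

/-- The additive character `e(t) = exp(2πit)`. -/
noncomputable def unitExp (t : ℝ) : ℂ := Complex.exp (2 * Real.pi * Complex.I * (t : ℂ))

theorem unitExp_add (t u : ℝ) : unitExp (t + u) = unitExp t * unitExp u := by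
  rw [unitExp, unitExp, unitExp, ← Complex.exp_add]; push_cast; ring_nf

theorem unitExp_zero : unitExp 0 = 1 := by simp [unitExp]

theorem norm_unitExp (t : ℝ) : ‖unitExp t‖ = 1 := by
  have : (2 * Real.pi * Complex.I * (t : ℂ)) = ((2 * Real.pi * t : ℝ) : ℂ) * Complex.I := by
    push_cast; ring
  rw [unitExp, this, Complex.norm_exp_ofReal_mul_I]

theorem unitExp_int (n : ℤ) : unitExp n = 1 := by
  rw [unitExp, Complex.exp_eq_one_iff]
  exact ⟨n, by push_cast; ring⟩

theorem conj_unitExp (t : ℝ) : (starRingEnd ℂ) (unitExp t) = unitExp (-t) := by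
  rw [unitExp, unitExp, ← Complex.exp_conj]
  congr 1
  simp only [map_mul, Complex.conj_ofReal, Complex.conj_I, Complex.ofReal_neg, map_ofNat]
  ring

theorem unitExp_sum {ι : Type*} (S : Finset ι) (f : ι → ℝ) :
    unitExp (∑ i ∈ S, f i) = ∏ i ∈ S, unitExp (f i) := by
  classical
  induction S using Finset.induction_on with
  | empty => simp [unitExp_zero]
  | insert a S ha ih => rw [Finset.sum_insert ha, Finset.prod_insert ha, unitExp_add, ih]

theorem unitExp_fract (t : ℝ) : unitExp (Int.fract t) = unitExp t := by
  conv_rhs => rw [← Int.floor_add_fract t, unitExp_add, unitExp_int, one_mul]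

theorem four_mul_min_le_norm_unitExp_sub_one (β : ℝ) :
    4 * min (Int.fract β) (1 - Int.fract β) ≤ ‖unitExp β - 1‖ := by
  rw [← unitExp_fract]
  set φ := Int.fract β
  have h0 : 0 ≤ φ := Int.fract_nonneg β
  have h1 : φ < 1 := Int.fract_lt_one β
  have h2 : ‖unitExp φ - 1‖ = 2 * |Real.sin (Real.pi * φ)| := by
    have : (2 * Real.pi * Complex.I * (φ : ℂ)) = Complex.I * ((2 * Real.pi * φ : ℝ) : ℂ) := by
      push_cast; ring
    rw [unitExp, this, Complex.norm_exp_I_mul_ofReal_sub_one, Real.norm_eq_abs, abs_mul]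
    congr 2
    · norm_num
    · ring_nf
  have hpi := Real.pi_pos
  have key : ∀ ψ : ℝ, 0 ≤ ψ → ψ ≤ 1 / 2 → 2 * ψ ≤ Real.sin (Real.pi * ψ) := by
    intro ψ h h'
    have := Real.mul_le_sin (x := Real.pi * ψ) (by positivity) (by nlinarith)
    refine le_trans (le_of_eq ?_) this
    field_simp
  rw [h2]
  rcases le_total φ (1 / 2) with h | h
  · rw [min_eq_left (by linarith)]
    linarith [key φ h0 h, le_abs_self (Real.sin (Real.pi * φ))]
  · rw [min_eq_right (by linarith)]
    have h3 := key (1 - φ) (by linarith) (by linarith)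
    have h4 : Real.sin (Real.pi * (1 - φ)) = Real.sin (Real.pi * φ) := by
      rw [show Real.pi * (1 - φ) = Real.pi - Real.pi * φ by ring, Real.sin_pi_sub]
    linarith [le_abs_self (Real.sin (Real.pi * φ))]

/-- The index of the cell `[c/T, (c+1)/T)` of the circle that contains `β`. -/
noncomputable def cellIndex (T : ℕ) (β : ℝ) : ℕ := ⌊T * Int.fract β⌋₊

/-- The number of cells of length `1/T` between the cell of index `c` and the cell containing
an integer. -/
def cellDist (T c : ℕ) : ℕ := min c (T - 1 - c)

theorem cellIndex_lt {T : ℕ} (hT : 0 < T) (β : ℝ) : cellIndex T β < T := by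
  rw [cellIndex, Nat.floor_lt' hT.ne']
  have : (0 : ℝ) < T := by exact_mod_cast hT
  nlinarith [Int.fract_lt_one β]

theorem cellDist_le_norm_unitExp_sub_one {T : ℕ} (hT : 0 < T) (β : ℝ) :
    4 * (cellDist T (cellIndex T β) : ℝ) / T ≤ ‖unitExp β - 1‖ := by
  refine le_trans ?_ (four_mul_min_le_norm_unitExp_sub_one β)
  have hT' : (0 : ℝ) < T := by exact_mod_cast hT
  have hc := cellIndex_lt hT β
  have h1 : (cellIndex T β : ℝ) ≤ T * Int.fract β :=
    Nat.floor_le (mul_nonneg hT'.le (Int.fract_nonneg β))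
  have h2 : T * Int.fract β < cellIndex T β + 1 := Nat.lt_floor_add_one _
  rw [mul_div_assoc]
  refine mul_le_mul_of_nonneg_left (le_min ?_ ?_) (by norm_num)
  · rw [div_le_iff₀ hT']
    have : (cellDist T (cellIndex T β) : ℝ) ≤ cellIndex T β := by
      exact_mod_cast min_le_left _ _
    linarith
  · rw [div_le_iff₀ hT']
    have : (cellDist T (cellIndex T β) : ℝ) ≤ ((T - 1 - cellIndex T β : ℕ) : ℝ) := by
      exact_mod_cast min_le_right _ _
    have h3 : ((T - 1 - cellIndex T β : ℕ) : ℝ) = T - 1 - cellIndex T β := by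
      rw [Nat.cast_sub (by omega), Nat.cast_sub (by omega)]; simp
    linarith

/-- The decay `max(1, r)^{-1-η}` of a smoothed exponential sum at distance `r`. -/
noncomputable def decay (η : ℝ) (r : ℕ) : ℝ := (max 1 (r : ℝ)) ^ (-1 - η)

theorem decay_nonneg (η : ℝ) (r : ℕ) : 0 ≤ decay η r := by unfold decay; positivity

theorem summable_decay {η : ℝ} (hη : 0 < η) : Summable (decay η) := by
  have h : Summable fun r : ℕ => (r : ℝ) ^ (-1 - η) := by
    rw [Real.summable_nat_rpow]; linarith
  rw [← summable_nat_add_iff 1] at h ⊢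
  refine h.congr fun r => ?_
  rw [decay, max_eq_right]
  push_cast
  linarith [Nat.cast_nonneg (α := ℝ) r]

/-- The total decay over the cells of the circle is bounded independently of their number. -/
theorem sum_decay_cellDist_le {η : ℝ} (hη : 0 < η) (T : ℕ) :
    ∑ c ∈ Finset.range T, decay η (cellDist T c) ≤ 2 * ∑' r, decay η r := by
  have h : ∀ c ∈ Finset.range T,
      decay η (cellDist T c) ≤ decay η c + decay η (T - 1 - c) := by
    intro c _
    rcases min_choice c (T - 1 - c) with h | h
    · rw [cellDist, h]; linarith [decay_nonneg η (T - 1 - c)]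
    · rw [cellDist, h]; linarith [decay_nonneg η c]
  refine (Finset.sum_le_sum h).trans ?_
  rw [Finset.sum_add_distrib, Finset.sum_range_reflect (decay η) T, two_mul]
  have := (summable_decay hη).sum_le_tsum (Finset.range T) (fun r _ => decay_nonneg η r)
  linarith

/-- A weight on `ℤ` that varies on the scale `L`, in the sense of bounds for its first two
differences. The bounds on sums are asked for all finite sets, so that the notion is invariant under
translation; the parameter `a` makes it stable under products. -/
structure TameWeight (a L : ℝ) (w : ℤ → ℝ) : Prop where
  abs_le_one : ∀ x, |w x| ≤ 1
  abs_diff_le : ∀ x, |w (x + 1) - w x| ≤ a / L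
  sum_abs_diff_le : ∀ S : Finset ℤ, ∑ x ∈ S, |w (x + 1) - w x| ≤ 2 * a
  sum_abs_diff_diff_le : ∀ S : Finset ℤ,
    ∑ x ∈ S, |w (x + 2) - 2 * w (x + 1) + w x| ≤ 4 * a ^ 2 / L

theorem sum_comp_add_int (S : Finset ℤ) (h : ℤ) (g : ℤ → ℝ) :
    ∑ x ∈ S, g (x + h) = ∑ x ∈ S.map (addRightEmbedding h), g x := by
  rw [Finset.sum_map]; rfl

theorem TameWeight.comp_add {a L : ℝ} {w : ℤ → ℝ} (hw : TameWeight a L w) (h : ℤ) :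
    TameWeight a L fun x => w (x + h) where
  abs_le_one x := hw.abs_le_one _
  abs_diff_le x := by
    have := hw.abs_diff_le (x + h)
    rwa [add_right_comm] at this
  sum_abs_diff_le S := by
    have := hw.sum_abs_diff_le (S.map (addRightEmbedding h))
    rw [← sum_comp_add_int S h fun x => |w (x + 1) - w x|] at this
    simpa only [add_right_comm] using this
  sum_abs_diff_diff_le S := by
    have := hw.sum_abs_diff_diff_le (S.map (addRightEmbedding h))
    rw [← sum_comp_add_int S h fun x => |w (x + 2) - 2 * w (x + 1) + w x|] at this
    simpa only [add_right_comm] using this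

theorem TameWeight.mul {a b L : ℝ} {v w : ℤ → ℝ} (ha : 0 ≤ a) (hb : 0 ≤ b) (hL : 0 < L)
    (hv : TameWeight a L v) (hw : TameWeight b L w) : TameWeight (a + b) L fun x => v x * w x := by
  have hd : ∀ x, |v (x + 1) * w (x + 1) - v x * w x| ≤
      |v (x + 1) - v x| + |w (x + 1) - w x| := by
    intro x
    rw [show v (x + 1) * w (x + 1) - v x * w x =
      (v (x + 1) - v x) * w (x + 1) + v x * (w (x + 1) - w x) by ring]
    refine (abs_add_le _ _).trans ?_
    rw [abs_mul, abs_mul]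
    exact add_le_add (mul_le_of_le_one_right (abs_nonneg _) (hw.abs_le_one _))
      (mul_le_of_le_one_left (abs_nonneg _) (hv.abs_le_one _))
  refine ⟨fun x => ?_, fun x => ?_, fun S => ?_, fun S => ?_⟩
  · rw [abs_mul]
    exact mul_le_one₀ (hv.abs_le_one x) (abs_nonneg _) (hw.abs_le_one x)
  · rw [add_div]
    exact (hd x).trans (add_le_add (hv.abs_diff_le x) (hw.abs_diff_le x))
  · refine (Finset.sum_le_sum fun x _ => hd x).trans ?_
    rw [Finset.sum_add_distrib]
    linarith [hv.sum_abs_diff_le S, hw.sum_abs_diff_le S]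
  · have hdd : ∀ x, |v (x + 2) * w (x + 2) - 2 * (v (x + 1) * w (x + 1)) + v x * w x| ≤
        |v (x + 2) - 2 * v (x + 1) + v x| + 2 * (a / L) * |w (x + 1 + 1) - w (x + 1)| +
          |w (x + 2) - 2 * w (x + 1) + w x| := by
      intro x
      rw [show x + 1 + 1 = x + 2 by ring,
        show v (x + 2) * w (x + 2) - 2 * (v (x + 1) * w (x + 1)) + v x * w x =
        (v (x + 2) - 2 * v (x + 1) + v x) * w (x + 2) +
        2 * (v (x + 1) - v x) * (w (x + 2) - w (x + 1)) +
        v x * (w (x + 2) - 2 * w (x + 1) + w x) by ring]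
      refine (abs_add_le _ _).trans (add_le_add ((abs_add_le _ _).trans (add_le_add ?_ ?_)) ?_)
      · rw [abs_mul]
        exact mul_le_of_le_one_right (abs_nonneg _) (hw.abs_le_one _)
      · rw [abs_mul, abs_mul, abs_two]
        gcongr
        exact hv.abs_diff_le x
      · rw [abs_mul]
        exact mul_le_of_le_one_left (abs_nonneg _) (hv.abs_le_one _)
    refine (Finset.sum_le_sum fun x _ => hdd x).trans ?_
    rw [Finset.sum_add_distrib, Finset.sum_add_distrib, ← Finset.mul_sum]
    have h1 := hv.sum_abs_diff_diff_le S
    have h2 := hw.sum_abs_diff_diff_le S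
    have h3 := (hw.comp_add 1).sum_abs_diff_le S
    have h4 : 2 * (a / L) * ∑ x ∈ S, |w (x + 1 + 1) - w (x + 1)| ≤ 2 * (a / L) * (2 * b) := by
      gcongr
    have h5 : 4 * a ^ 2 / L + 2 * (a / L) * (2 * b) + 4 * b ^ 2 / L ≤ 4 * (a + b) ^ 2 / L := by
      rw [show 4 * a ^ 2 / L + 2 * (a / L) * (2 * b) + 4 * b ^ 2 / L =
        (4 * a ^ 2 + 4 * a * b + 4 * b ^ 2) / L by ring]
      gcongr
      nlinarith [mul_nonneg ha hb]
    linarith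

/-- Summation by parts for a weight supported on `[-N, N]`. -/
theorem sum_diff_mul_unitExp (N : ℤ) (v : ℤ → ℝ)
    (hv : ∀ x, x ∉ Finset.Icc (-N) N → v x = 0) (β : ℝ) :
    ∑ x ∈ Finset.Icc (-(N + 1)) (N + 1), ((v (x + 1) - v x : ℝ) : ℂ) * unitExp (x * β) =
      (unitExp (-β) - 1) * ∑ x ∈ Finset.Icc (-N) N, (v x : ℂ) * unitExp (x * β) := by
  have h1 : ∑ x ∈ Finset.Icc (-(N + 1)) (N + 1), (v x : ℂ) * unitExp (x * β) =
      ∑ x ∈ Finset.Icc (-N) N, (v x : ℂ) * unitExp (x * β) := by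
    symm
    refine Finset.sum_subset (Finset.Icc_subset_Icc (by linarith) (by linarith)) ?_
    intro x _ hx
    rw [hv x hx]; simp
  have h2 : ∑ x ∈ Finset.Icc (-(N + 1)) (N + 1), (v (x + 1) : ℂ) * unitExp (x * β) =
      unitExp (-β) * ∑ x ∈ Finset.Icc (-N) N, (v x : ℂ) * unitExp (x * β) := by
    have h3 : ∀ x : ℤ, (v (x + 1) : ℂ) * unitExp (x * β) =
        (fun y : ℤ => unitExp (-β) * ((v y : ℂ) * unitExp (y * β))) (addRightEmbedding 1 x) := by
      intro x
      simp only [addRightEmbedding_apply]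
      rw [mul_left_comm, ← unitExp_add]
      push_cast
      ring_nf
    rw [Finset.sum_congr rfl fun x _ => h3 x, ← Finset.sum_map _ _ (fun y : ℤ =>
      unitExp (-β) * ((v y : ℂ) * unitExp (y * β))), Finset.map_add_right_Icc, Finset.mul_sum]
    symm
    refine Finset.sum_subset (Finset.Icc_subset_Icc (by linarith) (by linarith)) ?_
    intro x _ hx
    rw [hv x hx]; simp
  simp only [Complex.ofReal_sub, sub_mul, Finset.sum_sub_distrib, h1, h2]
  ring

theorem rpow_one_sub_mul_rpow {A D x : ℝ} (hA : 0 < A) (hD : 0 < D) (hx : 0 < x) (η : ℝ) :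
    (A * x) ^ (1 - η) * (A * D * x ^ 2) ^ η = A * D ^ η * x ^ (1 + η) := by
  rw [Real.mul_rpow hA.le hx.le, Real.mul_rpow (by positivity) (by positivity),
    Real.mul_rpow hA.le hD.le, ← Real.rpow_natCast x 2, ← Real.rpow_mul hx.le,
    show A ^ (1 - η) * x ^ (1 - η) * (A ^ η * D ^ η * x ^ (((2 : ℕ) : ℝ) * η)) =
      (A ^ (1 - η) * A ^ η) * D ^ η * (x ^ (1 - η) * x ^ (((2 : ℕ) : ℝ) * η)) by ring,
    ← Real.rpow_add hA, ← Real.rpow_add hx, sub_add_cancel, Real.rpow_one]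
  congr 2
  push_cast
  ring

/-- Two summations by parts, interpolated: an exponential sum with a weight varying on the scale `L`
on an interval of length about `T` has size at most `T (T/L)^η (T‖β‖)^{-1-η}`. The exponent `-1-η`
makes this summable over cells of the circle, at the cost of a small power of `T/L` only. -/
theorem TameWeight.norm_sum_unitExp_le {a L η : ℝ} {v : ℤ → ℝ} (hv : TameWeight a L v)
    (ha : 1 ≤ a) {T : ℕ} (hT : 0 < T) (hL : 0 < L) (hLT : L ≤ T) (hη : 0 < η) (hη1 : η ≤ 1)
    (hsupp : ∀ x, x ∉ Finset.Icc (-(T : ℤ)) T → v x = 0) (β : ℝ) :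
    ‖∑ x ∈ Finset.Icc (-(T : ℤ)) T, (v x : ℂ) * unitExp (x * β)‖ ≤
      3 * a ^ 2 * T * (T / L) ^ η * decay η (cellDist T (cellIndex T β)) := by
  set V := ∑ x ∈ Finset.Icc (-(T : ℤ)) T, (v x : ℂ) * unitExp (x * β) with hV
  have hT' : (0 : ℝ) < T := by exact_mod_cast hT
  have hT1 : (1 : ℝ) ≤ T := by exact_mod_cast hT
  have hD : 1 ≤ (T : ℝ) / L := by rwa [one_le_div hL]
  have hDη : 1 ≤ ((T : ℝ) / L) ^ η := Real.one_le_rpow hD hη.le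
  have ha2 : 1 ≤ a ^ 2 := one_le_pow₀ ha
  set r := cellDist T (cellIndex T β)
  have hnorm : ‖unitExp (-β) - 1‖ = ‖unitExp β - 1‖ := by
    rw [← conj_unitExp, ← Complex.norm_conj (unitExp β - 1)]
    simp
  have hρ : 4 * (r : ℝ) / T ≤ ‖unitExp (-β) - 1‖ := by
    rw [hnorm]; exact cellDist_le_norm_unitExp_sub_one hT β
  have htriv : ‖V‖ ≤ 3 * T := by
    calc ‖V‖ ≤ ∑ x ∈ Finset.Icc (-(T : ℤ)) T, (1 : ℝ) := by
          refine (norm_sum_le _ _).trans (Finset.sum_le_sum fun x _ => ?_)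
          rw [norm_mul, norm_unitExp, mul_one, Complex.norm_real]
          exact hv.abs_le_one x
      _ = 2 * T + 1 := by
          rw [Finset.sum_const, Int.card_Icc, nsmul_eq_mul, mul_one]
          have : ((T : ℤ) + 1 - -(T : ℤ)).toNat = 2 * T + 1 := by omega
          rw [this]; push_cast; ring
      _ ≤ 3 * T := by linarith
  have e1 := sum_diff_mul_unitExp T v hsupp β
  have e2 := sum_diff_mul_unitExp (T + 1) (fun x => v (x + 1) - v x) (by
    intro x hx
    rw [Finset.mem_Icc] at hx
    rw [hsupp x (by rw [Finset.mem_Icc]; omega), hsupp (x + 1) (by rw [Finset.mem_Icc]; omega),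
      sub_zero]) β
  rw [e1, ← hV, ← mul_assoc, ← pow_two] at e2
  rw [← hV] at e1
  have b1 : ‖unitExp (-β) - 1‖ * ‖V‖ ≤ 2 * a := by
    rw [← norm_mul, ← e1]
    refine (norm_sum_le _ _).trans ?_
    simp only [norm_mul, norm_unitExp, mul_one, Complex.norm_real, Real.norm_eq_abs]
    exact hv.sum_abs_diff_le _
  have b2 : ‖unitExp (-β) - 1‖ ^ 2 * ‖V‖ ≤ 4 * a ^ 2 / L := by
    rw [← norm_pow, ← norm_mul, ← e2]
    refine (norm_sum_le _ _).trans ?_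
    simp only [norm_mul, norm_unitExp, mul_one, Complex.norm_real, Real.norm_eq_abs]
    refine le_trans (le_of_eq ?_) (hv.sum_abs_diff_diff_le
      (Finset.Icc (-((T : ℤ) + 1 + 1)) (T + 1 + 1)))
    refine Finset.sum_congr rfl fun x _ => ?_
    rw [show x + 1 + 1 = x + 2 by ring]
    ring_nf
  rcases Nat.eq_zero_or_pos r with hr | hr
  · have hd : decay η r = 1 := by rw [hr]; simp [decay]
    rw [hd, mul_one]
    calc ‖V‖ ≤ 3 * 1 * T * 1 := by linarith
      _ ≤ _ := by gcongr
  · have hr' : (0 : ℝ) < r := by exact_mod_cast hr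
    have hr1 : (1 : ℝ) ≤ r := by exact_mod_cast hr
    have hd : decay η r = (r : ℝ) ^ (-1 - η) := by rw [decay, max_eq_right hr1]
    have c1 : ‖V‖ ≤ a ^ 2 * T * (r : ℝ)⁻¹ := by
      have : 4 * (r : ℝ) / T * ‖V‖ ≤ 2 * a :=
        (mul_le_mul_of_nonneg_right hρ (norm_nonneg _)).trans b1
      have h1 : ‖V‖ * (4 * r) ≤ 2 * a * T := by
        rw [div_mul_eq_mul_div, div_le_iff₀ hT'] at this; linarith
      rw [← div_eq_mul_inv, le_div_iff₀ hr']
      have h2 : a * T ≤ a ^ 2 * T := by gcongr; nlinarith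
      have h3 : 0 ≤ ‖V‖ * r := by positivity
      have h4 : 0 ≤ a * T := by positivity
      linarith
    have c2 : ‖V‖ ≤ a ^ 2 * T * (T / L) * ((r : ℝ)⁻¹) ^ 2 := by
      have : (4 * (r : ℝ) / T) ^ 2 * ‖V‖ ≤ 4 * a ^ 2 / L := by
        refine le_trans ?_ b2
        gcongr
      have h1 : ‖V‖ ≤ 4 * a ^ 2 / L / (4 * (r : ℝ) / T) ^ 2 := by
        rw [le_div_iff₀ (by positivity)]; linarith
      refine h1.trans ?_
      rw [show 4 * a ^ 2 / L / (4 * (r : ℝ) / T) ^ 2 =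
        (1 / 4) * (a ^ 2 * T * (T / L) * ((r : ℝ)⁻¹) ^ 2) by field_simp]
      have : 0 ≤ a ^ 2 * T * (T / L) * ((r : ℝ)⁻¹) ^ 2 := by positivity
      linarith
    have hA : 0 < a ^ 2 * T := by positivity
    have c3 : ‖V‖ ≤ a ^ 2 * T * (T / L) ^ η * decay η r := by
      rcases (norm_nonneg V).eq_or_lt with h0 | h0
      · rw [← h0]
        have := decay_nonneg η r
        positivity
      calc ‖V‖ = ‖V‖ ^ (1 - η) * ‖V‖ ^ η := by
            rw [← Real.rpow_add h0, sub_add_cancel, Real.rpow_one]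
        _ ≤ (a ^ 2 * T * (r : ℝ)⁻¹) ^ (1 - η) * (a ^ 2 * T * (T / L) * ((r : ℝ)⁻¹) ^ 2) ^ η := by
            gcongr
        _ = a ^ 2 * T * (T / L) ^ η * decay η r := by
            rw [rpow_one_sub_mul_rpow hA (by positivity) (by positivity), hd,
              Real.inv_rpow hr'.le, ← Real.rpow_neg hr'.le]
            ring_nf
    have : 0 ≤ a ^ 2 * T * (T / L) ^ η * decay η r := by
      have := decay_nonneg η r
      positivity
    linarith

/-! ### Trapezoidal weights -/

/-- The indicator function of the integers in `[p, q]`. -/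
def intervalInd (p q x : ℤ) : ℝ := if p ≤ x ∧ x ≤ q then 1 else 0

theorem intervalInd_nonneg (p q x : ℤ) : 0 ≤ intervalInd p q x := by
  unfold intervalInd; split_ifs <;> norm_num

theorem intervalInd_le_one (p q x : ℤ) : intervalInd p q x ≤ 1 := by
  unfold intervalInd; split_ifs <;> norm_num

theorem sum_abs_diff_intervalInd_le (p q : ℤ) (S : Finset ℤ) :
    ∑ x ∈ S, |intervalInd p q (x + 1) - intervalInd p q x| ≤ 2 := by
  have h : ∀ x ∈ S, |intervalInd p q (x + 1) - intervalInd p q x| ≤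
      (if x = p - 1 then 1 else 0) + (if x = q then 1 else 0) := by
    intro x _
    unfold intervalInd
    split_ifs <;> first | omega | norm_num
  refine (Finset.sum_le_sum h).trans ?_
  rw [Finset.sum_add_distrib, Finset.sum_ite_eq', Finset.sum_ite_eq']
  split_ifs <;> norm_num

theorem sum_abs_diff_intervalInd_shift_le (p q c : ℤ) (S : Finset ℤ) :
    ∑ x ∈ S, |intervalInd p q (x + c + 1) - intervalInd p q (x + c)| ≤ 2 := by
  rw [sum_comp_add_int S c fun x => |intervalInd p q (x + 1) - intervalInd p q x|]
  exact sum_abs_diff_intervalInd_le p q _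

/-- The average of the indicator functions of `L` consecutive translates of the integer interval
`[p, q]`: a trapezoid with slopes `1/L`. -/
noncomputable def trapezoid (p q : ℤ) (L : ℕ) (x : ℤ) : ℝ :=
  (∑ y ∈ Finset.range L, intervalInd p q (x - y)) / L

theorem trapezoid_nonneg (p q : ℤ) (L : ℕ) (x : ℤ) : 0 ≤ trapezoid p q L x :=
  div_nonneg (Finset.sum_nonneg fun _ _ => intervalInd_nonneg _ _ _) (Nat.cast_nonneg _)

theorem trapezoid_le_one (p q : ℤ) (L : ℕ) (x : ℤ) : trapezoid p q L x ≤ 1 := by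
  refine div_le_one_of_le₀ ?_ (Nat.cast_nonneg _)
  refine (Finset.sum_le_sum fun (y : ℕ) _ => intervalInd_le_one p q (x - y)).trans ?_
  simp

theorem trapezoid_add_one_sub (p q : ℤ) (L : ℕ) (x : ℤ) :
    trapezoid p q L (x + 1) - trapezoid p q L x =
      (intervalInd p q (x + 1) - intervalInd p q (x - L + 1)) / L := by
  rw [trapezoid, trapezoid, ← sub_div, ← Finset.sum_sub_distrib]
  congr 1
  have h := Finset.sum_range_sub' (fun y : ℕ => intervalInd p q (x - y + 1)) L
  rw [Nat.cast_zero, sub_zero] at h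
  rw [← h]
  refine Finset.sum_congr rfl fun y _ => ?_
  congr 2 <;> push_cast <;> ring

theorem tameWeight_trapezoid (p q : ℤ) {L : ℕ} (hL : 0 < L) :
    TameWeight 1 L (trapezoid p q L) := by
  have hL' : (0 : ℝ) < L := by exact_mod_cast hL
  refine ⟨fun x => ?_, fun x => ?_, fun S => ?_, fun S => ?_⟩
  · rw [abs_of_nonneg (trapezoid_nonneg p q L x)]
    exact trapezoid_le_one p q L x
  · rw [trapezoid_add_one_sub, abs_div, abs_of_pos hL']
    gcongr
    rw [abs_le]
    constructor <;> linarith [intervalInd_nonneg p q (x + 1), intervalInd_le_one p q (x + 1),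
      intervalInd_nonneg p q (x - L + 1), intervalInd_le_one p q (x - L + 1)]
  · have h : ∀ x ∈ S, |trapezoid p q L (x + 1) - trapezoid p q L x| ≤
        (∑ y ∈ Finset.range L,
          |intervalInd p q (x + -(y : ℤ) + 1) - intervalInd p q (x + -(y : ℤ))|) / L := by
      intro x _
      rw [trapezoid, trapezoid, ← sub_div, ← Finset.sum_sub_distrib, abs_div, abs_of_pos hL']
      gcongr
      refine (Finset.abs_sum_le_sum_abs _ _).trans (le_of_eq ?_)
      refine Finset.sum_congr rfl fun y _ => ?_
      congr 3
      ring
    refine (Finset.sum_le_sum h).trans ?_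
    rw [← Finset.sum_div, Finset.sum_comm, div_le_iff₀ hL']
    refine (Finset.sum_le_sum fun (y : ℕ) _ =>
      sum_abs_diff_intervalInd_shift_le p q (-(y : ℤ)) S).trans ?_
    simp [mul_comm]
  · have h : ∀ x ∈ S, |trapezoid p q L (x + 2) - 2 * trapezoid p q L (x + 1) + trapezoid p q L x| ≤
        (|intervalInd p q (x + 1 + 1) - intervalInd p q (x + 1)| +
          |intervalInd p q (x + (1 - L) + 1) - intervalInd p q (x + (1 - L))|) / L := by
      intro x _
      have h1 := trapezoid_add_one_sub p q L x
      have h2 := trapezoid_add_one_sub p q L (x + 1)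
      rw [show x + 1 + 1 = x + 2 by ring] at h2
      rw [show trapezoid p q L (x + 2) - 2 * trapezoid p q L (x + 1) + trapezoid p q L x =
        (trapezoid p q L (x + 2) - trapezoid p q L (x + 1)) -
        (trapezoid p q L (x + 1) - trapezoid p q L x) by ring, h1, h2, ← sub_div, abs_div,
        abs_of_pos hL']
      gcongr
      rw [show x + (1 - (L : ℤ)) + 1 = x + 1 - L + 1 by ring,
        show x + (1 - (L : ℤ)) = x - L + 1 by ring, show x + 1 + 1 = x + 2 by ring]
      rw [show ∀ a b c d : ℝ, a - b - (c - d) = (a - c) - (b - d) from fun _ _ _ _ => by ring]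
      exact abs_sub _ _
    refine (Finset.sum_le_sum h).trans ?_
    rw [← Finset.sum_div, Finset.sum_add_distrib]
    have h1 := sum_abs_diff_intervalInd_shift_le p q 1 S
    have h2 := sum_abs_diff_intervalInd_shift_le p q (1 - L) S
    gcongr
    linarith

theorem trapezoid_eq_zero {p q : ℤ} {L : ℕ} {x : ℤ} (h : x < p ∨ q + L ≤ x) :
    trapezoid p q L x = 0 := by
  rw [trapezoid, Finset.sum_eq_zero, zero_div]
  intro y hy
  rw [Finset.mem_range] at hy
  rw [intervalInd, if_neg]
  omega

theorem trapezoid_eq_one {p q : ℤ} {L : ℕ} (hL : 0 < L) {x : ℤ} (h : p + L ≤ x) (h' : x ≤ q) :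
    trapezoid p q L x = 1 := by
  have hL' : (0 : ℝ) < L := by exact_mod_cast hL
  rw [trapezoid, Finset.sum_congr rfl (g := fun _ => (1 : ℝ))]
  · simp [hL'.ne']
  · intro y hy
    rw [Finset.mem_range] at hy
    rw [intervalInd, if_pos]
    omega

theorem sum_abs_intervalInd_sub_shift_le (p q : ℤ) (y : ℕ) (S : Finset ℤ) :
    ∑ x ∈ S, |intervalInd p q x - intervalInd p q (x - y)| ≤ 2 * y := by
  induction y with
  | zero => simp
  | succ y ih =>
    have h := sum_abs_diff_intervalInd_shift_le p q (-(y + 1 : ℕ)) S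
    have h1 : ∀ x ∈ S, |intervalInd p q x - intervalInd p q (x - (y + 1 : ℕ))| ≤
        |intervalInd p q x - intervalInd p q (x - y)| +
          |intervalInd p q (x + -(y + 1 : ℕ) + 1) - intervalInd p q (x + -(y + 1 : ℕ))| := by
      intro x _
      rw [show x + -((y + 1 : ℕ) : ℤ) + 1 = x - y by push_cast; ring, ← sub_eq_add_neg]
      exact abs_sub_le _ _ _
    refine (Finset.sum_le_sum h1).trans ?_
    rw [Finset.sum_add_distrib]
    push_cast at h ⊢
    linarith

theorem sum_abs_intervalInd_sub_trapezoid_le (p q : ℤ) {L : ℕ} (hL : 0 < L) (S : Finset ℤ) :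
    ∑ x ∈ S, |intervalInd p q x - trapezoid p q L x| ≤ 2 * (L - 1 : ℕ) := by
  have hL' : (0 : ℝ) < L := by exact_mod_cast hL
  have h : ∀ x ∈ S, |intervalInd p q x - trapezoid p q L x| ≤
      (∑ y ∈ Finset.range L, |intervalInd p q x - intervalInd p q (x - y)|) / L := by
    intro x _
    have : intervalInd p q x - trapezoid p q L x =
        (∑ y ∈ Finset.range L, (intervalInd p q x - intervalInd p q (x - y))) / L := by
      rw [Finset.sum_sub_distrib, sub_div, trapezoid]
      simp [hL'.ne']
    rw [this, abs_div, abs_of_pos hL']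
    gcongr
    exact Finset.abs_sum_le_sum_abs _ _
  refine (Finset.sum_le_sum h).trans ?_
  rw [← Finset.sum_div, Finset.sum_comm, div_le_iff₀ hL']
  calc ∑ y ∈ Finset.range L, ∑ x ∈ S, |intervalInd p q x - intervalInd p q (x - y)|
      ≤ ∑ y ∈ Finset.range L, (2 * (L - 1 : ℕ) : ℝ) := by
        refine Finset.sum_le_sum fun y hy => (sum_abs_intervalInd_sub_shift_le p q y S).trans ?_
        rw [Finset.mem_range] at hy
        have : y ≤ L - 1 := by omega
        gcongr
    _ = 2 * (L - 1 : ℕ) * L := by simp [mul_comm]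

/-! ### Distribution modulo one and duality -/

/-- The real number `β` lies within `δ` of an integer. -/
def NearInt (δ β : ℝ) : Prop := ∃ m : ℤ, |β - m| ≤ δ

/-- The integer points of the cube `[-K, K]^s`. -/
noncomputable def intBox (s K : ℕ) : Finset (Fin s → ℤ) :=
  Fintype.piFinset fun _ => Finset.Icc (-(K : ℤ)) K

theorem mem_intBox {s K : ℕ} {x : Fin s → ℤ} : x ∈ intBox s K ↔ ∀ l, |x l| ≤ K := by
  simp [intBox, Fintype.mem_piFinset, abs_le]

theorem nearInt_sub_of_cellIndex_eq {T : ℕ} (hT : 0 < T) {β γ : ℝ}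
    (h : cellIndex T β = cellIndex T γ) : NearInt (1 / T) (β - γ) := by
  have hT' : (0 : ℝ) < T := by exact_mod_cast hT
  refine ⟨⌊β⌋ - ⌊γ⌋, ?_⟩
  have h1 : β - γ - ((⌊β⌋ - ⌊γ⌋ : ℤ) : ℝ) = Int.fract β - Int.fract γ := by
    rw [← Int.self_sub_floor, ← Int.self_sub_floor]; push_cast; ring
  rw [h1, le_div_iff₀ hT', ← abs_of_pos hT', ← abs_mul, abs_le]
  have a1 := Nat.floor_le (mul_nonneg hT'.le (Int.fract_nonneg β))
  have a2 := Nat.lt_floor_add_one (T * Int.fract β)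
  have b1 := Nat.floor_le (mul_nonneg hT'.le (Int.fract_nonneg γ))
  have b2 := Nat.lt_floor_add_one (T * Int.fract γ)
  have h2 : ((⌊T * Int.fract β⌋₊ : ℕ) : ℝ) = (⌊T * Int.fract γ⌋₊ : ℕ) := by
    exact_mod_cast h
  constructor <;> linarith

/-- Each cell of the torus `(ℝ/ℤ)^s` contains at most as many of the points `A k` as there are
differences of the indices `k` with `A k` near `0`. -/
theorem sum_prod_decay_le {G : Type*} [AddCommGroup G] {s : ℕ} (A : G →+ (Fin s → ℝ))
    (b : Fin s → ℝ) (S R : Finset G) (hSR : ∀ x ∈ S, ∀ y ∈ S, x - y ∈ R) {T : ℕ} (hT : 0 < T)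
    {η : ℝ} (hη : 0 < η) :
    ∑ k ∈ S, ∏ j, decay η (cellDist T (cellIndex T (A k j + b j))) ≤
      (2 * ∑' r, decay η r) ^ s * (Set.ncard {k | k ∈ R ∧ ∀ j, NearInt (1 / T) (A k j)} : ℝ) := by
  classical
  have hfin : {k | k ∈ R ∧ ∀ j, NearInt (1 / T) (A k j)}.Finite :=
    R.finite_toSet.subset fun k hk => hk.1
  set N := Set.ncard {k | k ∈ R ∧ ∀ j, NearInt (1 / T) (A k j)} with hN
  let cell : G → Fin s → ℕ := fun k j => cellIndex T (A k j + b j)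
  let C : Finset (Fin s → ℕ) := Fintype.piFinset fun _ => Finset.range T
  have hmaps : ∀ k ∈ S, cell k ∈ C := by
    intro k _
    rw [Fintype.mem_piFinset]
    exact fun j => Finset.mem_range.2 (cellIndex_lt hT _)
  have hfib : ∀ c : Fin s → ℕ, (S.filter fun k => cell k = c).card ≤ N := by
    intro c
    rcases Finset.eq_empty_or_nonempty (S.filter fun k => cell k = c) with he | ⟨k₀, hk₀⟩
    · rw [he]; simp
    · rw [hN, Set.ncard_eq_toFinset_card _ hfin]
      refine Finset.card_le_card_of_injOn (fun k => k - k₀) ?_ (fun x _ y _ h => by simpa using h)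
      intro k hk
      rw [Finset.mem_coe, Finset.mem_filter] at hk
      rw [Finset.mem_filter] at hk₀
      rw [Set.Finite.coe_toFinset]
      refine ⟨hSR k hk.1 k₀ hk₀.1, fun j => ?_⟩
      have := nearInt_sub_of_cellIndex_eq hT ((congrFun hk.2 j).trans (congrFun hk₀.2 j).symm)
      rwa [add_sub_add_right_eq_sub, ← Pi.sub_apply, ← map_sub] at this
  rw [← Finset.sum_fiberwise_of_maps_to hmaps]
  calc ∑ c ∈ C, ∑ k ∈ S with cell k = c, ∏ j, decay η (cellDist T (cellIndex T (A k j + b j)))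
      = ∑ c ∈ C, ((S.filter fun k => cell k = c).card : ℝ) * ∏ j, decay η (cellDist T (c j)) := by
        refine Finset.sum_congr rfl fun c _ => ?_
        rw [← nsmul_eq_mul]
        refine Finset.sum_eq_card_nsmul fun k hk => ?_
        rw [Finset.mem_filter] at hk
        refine Finset.prod_congr rfl fun j _ => ?_
        rw [← congrFun hk.2 j]
    _ ≤ ∑ c ∈ C, (N : ℝ) * ∏ j, decay η (cellDist T (c j)) := by
        refine Finset.sum_le_sum fun c _ => ?_
        refine mul_le_mul_of_nonneg_right (by exact_mod_cast hfib c) ?_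
        exact Finset.prod_nonneg fun j _ => decay_nonneg _ _
    _ = (∏ _j : Fin s, ∑ c ∈ Finset.range T, decay η (cellDist T c)) * N := by
        rw [← Finset.mul_sum, Finset.prod_univ_sum, mul_comm]
    _ ≤ _ := by
        rw [Finset.prod_const, Finset.card_univ, Fintype.card_fin]
        gcongr
        · exact Finset.sum_nonneg fun _ _ => decay_nonneg _ _
        · exact sum_decay_cellDist_le hη T

/-- The additive map `ℤ^s → ℝ^s` given by a real matrix. -/
def latticeMap {s : ℕ} (A : Matrix (Fin s) (Fin s) ℝ) : (Fin s → ℤ) →+ (Fin s → ℝ) where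
  toFun h j := ∑ l, A j l * h l
  map_zero' := by ext; simp
  map_add' x y := by ext; simp [mul_add, Finset.sum_add_distrib]

theorem latticeMap_apply {s : ℕ} (A : Matrix (Fin s) (Fin s) ℝ) (h : Fin s → ℤ) (j : Fin s) :
    latticeMap A h j = ∑ l, A j l * h l := rfl

theorem sum_piFinset_prod_mul_unitExp {s : ℕ} (S : Fin s → Finset ℤ) (v : Fin s → ℤ → ℝ)
    (β : Fin s → ℝ) :
    ∑ x ∈ Fintype.piFinset S, ((∏ l, v l (x l) : ℝ) : ℂ) * unitExp (∑ l, x l * β l) =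
      ∏ l, ∑ x ∈ S l, (v l x : ℂ) * unitExp (x * β l) := by
  rw [Finset.prod_univ_sum]
  refine Finset.sum_congr rfl fun x _ => ?_
  rw [unitExp_sum, Finset.prod_mul_distrib]
  push_cast
  rfl

theorem unitExp_add_int (t : ℝ) (n : ℤ) : unitExp (t + n) = unitExp t := by
  rw [unitExp_add, unitExp_int, mul_one]

theorem norm_unitExp_sub_one_le (t : ℝ) : ‖unitExp t - 1‖ ≤ 2 * Real.pi * |t| := by
  have : (2 * Real.pi * Complex.I * (t : ℂ)) = Complex.I * ((2 * Real.pi * t : ℝ) : ℂ) := by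
    push_cast; ring
  rw [unitExp, this]
  refine Real.norm_exp_I_mul_ofReal_sub_one_le.trans (le_of_eq ?_)
  rw [Real.norm_eq_abs, abs_mul, abs_of_pos (by positivity)]

/-- If `β` is within `1/(16K)` of an integer, then all terms of the geometric sum of length `K`
point in nearly the same direction. -/
theorem half_le_norm_sum_unitExp {K : ℕ} (hK : 0 < K) {β : ℝ} (hβ : NearInt (1 / (16 * K)) β) :
    (K : ℝ) / 2 ≤ ‖∑ k ∈ Finset.Ico (0 : ℤ) K, (1 : ℂ) * unitExp (k * β)‖ := by
  have hK' : (0 : ℝ) < K := by exact_mod_cast hK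
  obtain ⟨m, hm⟩ := hβ
  have hcard : ((Finset.Ico (0 : ℤ) K).card : ℝ) = K := by simp
  have h1 : ∀ k ∈ Finset.Ico (0 : ℤ) K, ‖unitExp (k * β) - 1‖ ≤ 1 / 2 := by
    intro k hk
    rw [Finset.mem_Ico] at hk
    have h2 : unitExp (k * β) = unitExp (k * (β - m)) := by
      rw [← unitExp_add_int (k * (β - m)) (k * m)]
      congr 1; push_cast; ring
    rw [h2]
    refine (norm_unitExp_sub_one_le _).trans ?_
    rw [abs_mul]
    have hk0 : |(k : ℝ)| ≤ K := by
      rw [abs_le]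
      have : (0 : ℝ) ≤ k := by exact_mod_cast hk.1
      have : (k : ℝ) ≤ K := by exact_mod_cast hk.2.le
      constructor <;> linarith
    have h3 : |(k : ℝ)| * |β - m| ≤ K * (1 / (16 * K)) := by gcongr
    have h4 : (K : ℝ) * (1 / (16 * K)) = 1 / 16 := by field_simp
    have := Real.pi_lt_four
    have := Real.pi_pos
    nlinarith
  have h5 : ∑ k ∈ Finset.Ico (0 : ℤ) K, (1 : ℂ) * unitExp (k * β) =
      (K : ℂ) + ∑ k ∈ Finset.Ico (0 : ℤ) K, (unitExp (k * β) - 1) := by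
    rw [Finset.sum_sub_distrib]; simp
  have h6 : ‖∑ k ∈ Finset.Ico (0 : ℤ) K, (unitExp (k * β) - 1)‖ ≤ K * (1 / 2) := by
    rw [← hcard, ← nsmul_eq_mul]
    exact norm_sum_le_of_le _ h1 |>.trans (by simp)
  have h7 := norm_sub_le_norm_add (K : ℂ) (∑ k ∈ Finset.Ico (0 : ℤ) K, (unitExp (k * β) - 1))
  rw [h5]
  rw [Complex.norm_natCast] at h7
  linarith

theorem normSq_sum_eq {ι : Type*} (S : Finset ι) (f : ι → ℝ) :
    ((‖∑ k ∈ S, unitExp (f k)‖ ^ 2 : ℝ) : ℂ) =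
      ∑ k' ∈ S, ∑ k ∈ S, unitExp (f k - f k') := by
  rw [Complex.ofReal_pow, ← Complex.mul_conj', map_sum, Finset.sum_mul_sum, Finset.sum_comm]
  refine Finset.sum_congr rfl fun k' _ => Finset.sum_congr rfl fun k _ => ?_
  rw [conj_unitExp, ← unitExp_add, sub_eq_add_neg]

/-- Duality, for integral sides: a symmetric matrix `A` is its own transpose, so the exponential sum
over `h` and `k` with phase `k · A h` can be summed over either variable first. -/
theorem ncard_nearInt_le_dual {s : ℕ} (A : Matrix (Fin s) (Fin s) ℝ) (hA : ∀ i j, A i j = A j i)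
    {T K : ℕ} (hT : 0 < T) (hK : 0 < K) :
    (Set.ncard {h | h ∈ intBox s T ∧ ∀ j, NearInt (1 / (16 * K)) (latticeMap A h j)} : ℝ) ≤
      (96 * ∑' r, decay 1 r) ^ s * ((T : ℝ) / K) ^ s *
      (Set.ncard {k | k ∈ intBox s K ∧
        ∀ j, NearInt (1 / (2 * T : ℕ)) (latticeMap A k j)} : ℝ) := by
  classical
  have hT' : (0 : ℝ) < T := by exact_mod_cast hT
  have hK' : (0 : ℝ) < K := by exact_mod_cast hK
  set N := Set.ncard {k | k ∈ intBox s K ∧ ∀ j, NearInt (1 / (2 * T : ℕ)) (latticeMap A k j)}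
  set Q : Finset (Fin s → ℤ) := Fintype.piFinset fun _ => Finset.Ico (0 : ℤ) K with hQ
  have hQcard : (Q.card : ℝ) = (K : ℝ) ^ s := by simp [hQ]
  -- this trapezoid equals `1` on `[-T, T]` and is supported on `[-2T, 2T]`
  let w : ℤ → ℝ := trapezoid (-(2 * T)) T T
  have hw0 : ∀ x, 0 ≤ w x := trapezoid_nonneg _ _ _
  let phase : (Fin s → ℤ) → (Fin s → ℤ) → ℝ := fun h k => ∑ j, k j * latticeMap A h j
  -- the symmetry of `A`
  have hphase : ∀ h k, phase h k = ∑ l, h l * latticeMap A k l := by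
    intro h k
    simp only [phase, latticeMap_apply, Finset.mul_sum]
    rw [Finset.sum_comm]
    refine Finset.sum_congr rfl fun l _ => Finset.sum_congr rfl fun j _ => ?_
    rw [hA]; ring
  -- a weighted second moment, to which each `h` with `A h` near an integer point contributes
  -- almost the maximal amount
  set E : ℝ := ∑ h ∈ intBox s (2 * T), (∏ l, w (h l)) * ‖∑ k ∈ Q, unitExp (phase h k)‖ ^ 2 with hE
  have hlow : (Set.ncard {h | h ∈ intBox s T ∧
      ∀ j, NearInt (1 / (16 * K)) (latticeMap A h j)} : ℝ) * (((K : ℝ) / 2) ^ s) ^ 2 ≤ E := by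
    have hfin : {h | h ∈ intBox s T ∧ ∀ j, NearInt (1 / (16 * K)) (latticeMap A h j)}.Finite :=
      (intBox s T).finite_toSet.subset fun k hk => hk.1
    rw [Set.ncard_eq_toFinset_card _ hfin, ← nsmul_eq_mul, ← Finset.sum_const, hE]
    refine (Finset.sum_le_sum (g := fun h => (∏ l, w (h l)) *
      ‖∑ k ∈ Q, unitExp (phase h k)‖ ^ 2) fun h hh => ?_).trans
      (Finset.sum_le_sum_of_subset_of_nonneg (fun h hh => ?_) fun h _ _ => ?_)
    · rw [Set.Finite.mem_toFinset] at hh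
      obtain ⟨hb, hn⟩ := hh
      rw [mem_intBox] at hb
      have : ∏ l, w (h l) = 1 := by
        refine Finset.prod_eq_one fun l _ => trapezoid_eq_one hT ?_ ?_
        · linarith [(abs_le.1 (hb l)).1]
        · exact (abs_le.1 (hb l)).2
      rw [this, one_mul]
      have h1 := sum_piFinset_prod_mul_unitExp (fun _ : Fin s => Finset.Ico (0 : ℤ) K)
        (fun _ _ => 1) (latticeMap A h)
      simp only [Finset.prod_const_one, Complex.ofReal_one, one_mul] at h1
      have h2 : ‖∑ k ∈ Q, unitExp (phase h k)‖ =
          ∏ l, ‖∑ x ∈ Finset.Ico (0 : ℤ) K, (1 : ℂ) * unitExp (x * latticeMap A h l)‖ := by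
        rw [hQ, h1, norm_prod]
        simp
      rw [h2]
      gcongr
      calc ((K : ℝ) / 2) ^ s = ∏ _l : Fin s, ((K : ℝ) / 2) := by
            rw [Finset.prod_const, Finset.card_univ, Fintype.card_fin]
        _ ≤ _ := Finset.prod_le_prod (fun _ _ => by positivity)
          fun l _ => half_le_norm_sum_unitExp hK (hn l)
    · rw [Set.Finite.mem_toFinset] at hh
      rw [mem_intBox]
      intro l
      have := mem_intBox.1 hh.1 l
      push_cast
      linarith [abs_nonneg (h l)]
    · exact mul_nonneg (Finset.prod_nonneg fun l _ => hw0 _) (by positivity)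
  have hup : E ≤ (K : ℝ) ^ s * ((12 * T) ^ s * ((2 * ∑' r, decay 1 r) ^ s * N)) := by
    have e1 : (E : ℂ) = ∑ k' ∈ Q, ∑ k ∈ Q, ∏ l, ∑ x ∈ Finset.Icc (-((2 * T : ℕ) : ℤ)) (2 * T : ℕ),
        (w x : ℂ) * unitExp (x * (latticeMap A k l + -latticeMap A k' l)) := by
      rw [hE, Complex.ofReal_sum]
      simp only [Complex.ofReal_mul (∏ l, w _), normSq_sum_eq, Finset.mul_sum]
      rw [Finset.sum_comm]
      refine Finset.sum_congr rfl fun k' _ => ?_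
      rw [Finset.sum_comm]
      refine Finset.sum_congr rfl fun k _ => ?_
      rw [← sum_piFinset_prod_mul_unitExp]
      refine Finset.sum_congr rfl fun h _ => ?_
      congr 2
      rw [hphase, hphase, ← Finset.sum_sub_distrib]
      refine Finset.sum_congr rfl fun l _ => ?_
      ring
    have hE0 : E = ‖(E : ℂ)‖ := by
      rw [Complex.norm_real, Real.norm_of_nonneg]
      exact Finset.sum_nonneg fun h _ =>
        mul_nonneg (Finset.prod_nonneg fun l _ => hw0 _) (by positivity)
    have hone : ∀ β : ℝ, ‖∑ x ∈ Finset.Icc (-((2 * T : ℕ) : ℤ)) (2 * T : ℕ),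
        (w x : ℂ) * unitExp (x * β)‖ ≤
          12 * T * decay 1 (cellDist (2 * T) (cellIndex (2 * T) β)) := by
      intro β
      have := (tameWeight_trapezoid (-(2 * T)) T hT).norm_sum_unitExp_le le_rfl (T := 2 * T)
        (by omega) hT' (by push_cast; linarith) one_pos le_rfl (by
          intro x hx
          rw [Finset.mem_Icc] at hx
          refine trapezoid_eq_zero ?_
          push_cast at hx
          omega) β
      refine this.trans (le_of_eq ?_)
      rw [Real.rpow_one]
      push_cast
      field_simp
      ring
    rw [hE0, e1, ← hQcard, ← nsmul_eq_mul, ← Finset.sum_const]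
    refine norm_sum_le_of_le _ fun k' _ => ?_
    calc ‖∑ k ∈ Q, ∏ l, ∑ x ∈ Finset.Icc (-((2 * T : ℕ) : ℤ)) (2 * T : ℕ),
            (w x : ℂ) * unitExp (x * (latticeMap A k l + -latticeMap A k' l))‖
        ≤ ∑ k ∈ Q, ∏ l, (12 * T * decay 1 (cellDist (2 * T)
            (cellIndex (2 * T) (latticeMap A k l + -latticeMap A k' l)))) := by
          refine norm_sum_le_of_le _ fun k _ => ?_
          rw [norm_prod]
          exact Finset.prod_le_prod (fun _ _ => norm_nonneg _) fun l _ => hone _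
      _ = (12 * T) ^ s * ∑ k ∈ Q, ∏ l, decay 1 (cellDist (2 * T)
            (cellIndex (2 * T) (latticeMap A k l + -latticeMap A k' l))) := by
          rw [Finset.mul_sum]
          refine Finset.sum_congr rfl fun k _ => ?_
          rw [Finset.prod_mul_distrib]
          simp
      _ ≤ _ := by
          gcongr
          refine sum_prod_decay_le (latticeMap A) (fun l => -latticeMap A k' l) Q (intBox s K) ?_
            (by omega) one_pos
          intro x hx y hy
          rw [hQ, Fintype.mem_piFinset] at hx hy
          rw [mem_intBox]
          intro l
          have h1 := Finset.mem_Ico.1 (hx l)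
          have h2 := Finset.mem_Ico.1 (hy l)
          rw [Pi.sub_apply, abs_le]
          constructor <;> linarith [h1.1, h1.2, h2.1, h2.2]
  have h := hlow.trans hup
  rw [← le_div_iff₀ (by positivity)] at h
  refine h.trans (le_of_eq ?_)
  rw [div_pow (T : ℝ), div_pow (K : ℝ) 2, mul_pow, mul_pow, mul_pow,
    show (96 : ℝ) = 12 * 2 * 4 by norm_num, mul_pow, mul_pow, show (4 : ℝ) = 2 ^ 2 by norm_num,
    ← pow_mul 2 2 s, mul_comm 2 s, pow_mul 2 s 2]
  field_simp

/-! ### Davenport's shrinking lemma -/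

/-- The pairs `(h, m)` of integer vectors with `|h| ≤ H` and `|A h - m| ≤ δ`, in the maximum norm.
-/
def approxPairs {s : ℕ} (A : Matrix (Fin s) (Fin s) ℝ) (H δ : ℝ) :
    Set ((Fin s → ℤ) × (Fin s → ℤ)) :=
  {p | (∀ l, |(p.1 l : ℝ)| ≤ H) ∧ ∀ j, |latticeMap A p.1 j - p.2 j| ≤ δ}

theorem finite_intVec_abs_le {s : ℕ} (H : ℝ) :
    {x : Fin s → ℤ | ∀ l, |(x l : ℝ)| ≤ H}.Finite := by
  refine (Set.finite_Icc (fun _ => -⌈H⌉) (fun _ => ⌈H⌉)).subset fun x hx => ?_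
  have h1 : ∀ l, |x l| ≤ ⌈H⌉ := fun l => by
    have := (hx l).trans (Int.le_ceil H)
    exact_mod_cast this
  exact ⟨fun l => (abs_le.1 (h1 l)).1, fun l => (abs_le.1 (h1 l)).2⟩

theorem finite_approxPairs {s : ℕ} (A : Matrix (Fin s) (Fin s) ℝ) (H δ : ℝ) :
    (approxPairs A H δ).Finite := by
  have h1 := finite_intVec_abs_le (s := s) H
  obtain ⟨R, hR⟩ : ∃ R : ℝ, ∀ h ∈ {x : Fin s → ℤ | ∀ l, |(x l : ℝ)| ≤ H}, ∀ j,
      |latticeMap A h j| ≤ R := by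
    obtain ⟨R, hR⟩ := (h1.image fun h => ‖latticeMap A h‖).bddAbove
    exact ⟨R, fun h hh j => (norm_le_pi_norm (latticeMap A h) j).trans
      (hR (Set.mem_image_of_mem _ hh))⟩
  refine (h1.prod (finite_intVec_abs_le (s := s) (R + δ))).subset ?_
  rintro ⟨h, m⟩ ⟨hh, hm⟩
  refine ⟨hh, fun j => ?_⟩
  have e1 := hR h hh j
  have e2 := hm j
  rw [abs_le] at e1 e2 ⊢
  simp only at e2
  constructor <;> linarith [e1.1, e1.2, e2.1, e2.2]

theorem approxPairs_mono {s : ℕ} (A : Matrix (Fin s) (Fin s) ℝ) {H H' δ δ' : ℝ} (h : H ≤ H')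
    (h' : δ ≤ δ') : approxPairs A H δ ⊆ approxPairs A H' δ' :=
  fun _ hp => ⟨fun l => (hp.1 l).trans h, fun j => (hp.2 j).trans h'⟩

theorem ncard_approxPairs_mono {s : ℕ} (A : Matrix (Fin s) (Fin s) ℝ) {H H' δ δ' : ℝ} (h : H ≤ H')
    (h' : δ ≤ δ') : (approxPairs A H δ).ncard ≤ (approxPairs A H' δ').ncard :=
  Set.ncard_le_ncard (approxPairs_mono A h h') (finite_approxPairs A H' δ')

/-- The embedding `(h, m) ↦ (H⁻¹ h, δ⁻¹ (A h - m))`, which turns the sets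
`approxPairs A (t H) (t δ)` into the preimages of cubes. -/
noncomputable def approxMap {s : ℕ} (A : Matrix (Fin s) (Fin s) ℝ) (H δ : ℝ) :
    (Fin s → ℤ) × (Fin s → ℤ) →+ (Fin s ⊕ Fin s → ℝ) where
  toFun p := Sum.elim (fun l => (p.1 l : ℝ) / H) fun j => (latticeMap A p.1 j - p.2 j) / δ
  map_zero' := by ext i; cases i <;> simp
  map_add' p q := by
    ext i
    cases i with
    | inl l => simp [add_div]
    | inr j =>
      simp only [Prod.fst_add, Prod.snd_add, map_add, Pi.add_apply, Sum.elim_inr, Int.cast_add]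
      ring

theorem cubePreimage_approxMap {s : ℕ} (A : Matrix (Fin s) (Fin s) ℝ) {H δ : ℝ} (hH : 0 < H)
    (hδ : 0 < δ) (t : ℝ) :
    cubePreimage (approxMap A H δ) t = approxPairs A (t * H) (t * δ) := by
  ext p
  have h1 : ∀ l, |approxMap A H δ p (Sum.inl l)| ≤ t ↔ |(p.1 l : ℝ)| ≤ t * H := fun l => by
    change |(p.1 l : ℝ) / H| ≤ t ↔ _
    rw [abs_div, abs_of_pos hH, div_le_iff₀ hH]
  have h2 : ∀ j, |approxMap A H δ p (Sum.inr j)| ≤ t ↔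
      |latticeMap A p.1 j - p.2 j| ≤ t * δ := fun j => by
    change |(latticeMap A p.1 j - p.2 j) / δ| ≤ t ↔ _
    rw [abs_div, abs_of_pos hδ, div_le_iff₀ hδ]
  simp only [cubePreimage, approxPairs, Set.mem_ofPred_eq, Sum.forall, h1, h2]

theorem ncard_approxPairs_two_pow_mul_le {s : ℕ} (A : Matrix (Fin s) (Fin s) ℝ) {H δ : ℝ}
    (hH : 0 < H) (hδ : 0 < δ) (n : ℕ) :
    (approxPairs A (2 ^ n * H) (2 ^ n * δ)).ncard ≤ (25 ^ s) ^ n * (approxPairs A H δ).ncard := by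
  induction n with
  | zero => simp
  | succ n ih =>
    have hfin : ∀ t, (cubePreimage (approxMap A H δ) t).Finite := fun t => by
      rw [cubePreimage_approxMap A hH hδ]; exact finite_approxPairs _ _ _
    have h := ncard_cubePreimage_two_mul_le (approxMap A H δ) hfin (t := 2 ^ n) (by positivity)
    rw [cubePreimage_approxMap A hH hδ, cubePreimage_approxMap A hH hδ, Fintype.card_sum,
      Fintype.card_fin, ← two_mul, pow_mul, show 5 ^ 2 = 25 by norm_num, ← pow_succ'] at h
    refine h.trans ?_
    rw [pow_succ', mul_assoc]
    gcongr

theorem ncard_approxPairs_mul_le {s : ℕ} (A : Matrix (Fin s) (Fin s) ℝ) {H δ b z : ℝ}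
    (hH : 0 < H) (hδ : 0 < δ) (hb : 0 < b) (hb1 : 1 ≤ 4 * b) (hz : 0 < z) (hz1 : z ≤ 1) :
    (approxPairs A H δ).ncard * (approxPairs A (b * H) (b * δ)).ncard ≤
      25 ^ s * ((approxPairs A (z * H) (z * δ)).ncard *
        (approxPairs A (6 * b / z * H) (6 * b / z * δ)).ncard) := by
  have hfin : ∀ t, (cubePreimage (approxMap A H δ) t).Finite := fun t => by
    rw [cubePreimage_approxMap A hH hδ]; exact finite_approxPairs _ _ _
  have h := ncard_cubePreimage_mul_le (approxMap A H δ) hfin one_pos hb hb1 hz hz1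
  simpa only [cubePreimage_approxMap A hH hδ, Fintype.card_sum, Fintype.card_fin, ← two_mul,
    pow_mul, show 5 ^ 2 = 25 by norm_num, one_mul] using h

/-- For `δ < 1/2` the vector `m` of a pair `(h, m)` is determined by `h`. -/
theorem ncard_approxPairs_le_ncard_abs_le {s : ℕ} (A : Matrix (Fin s) (Fin s) ℝ) (H : ℝ) {δ : ℝ}
    (hδ : δ < 1 / 2) :
    (approxPairs A H δ).ncard ≤
      Set.ncard {h : Fin s → ℤ | (∀ l, |(h l : ℝ)| ≤ H) ∧ ∀ j, NearInt δ (latticeMap A h j)} := by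
  refine Set.ncard_le_ncard_of_injOn Prod.fst ?_ ?_
    ((finite_intVec_abs_le H).subset fun k hk => hk.1)
  · rintro ⟨h, m⟩ ⟨hh, hm⟩
    exact ⟨hh, fun j => ⟨m j, hm j⟩⟩
  · rintro ⟨h, m⟩ ⟨_, hm⟩ ⟨h', m'⟩ ⟨_, hm'⟩ heq
    simp only at heq hm hm'
    subst heq
    have : m = m' := by
      ext j
      have h1 := abs_le.1 (hm j)
      have h2 := abs_le.1 (hm' j)
      have h3 : |((m j - m' j : ℤ) : ℝ)| < 1 := by
        rw [abs_lt]; push_cast; constructor <;> linarith [h1.1, h1.2, h2.1, h2.2]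
      have h4 : |m j - m' j| < 1 := by exact_mod_cast h3
      rw [Int.abs_lt_one_iff] at h4
      omega
    rw [this]

theorem ncard_approxPairs_le_ncard_nearInt {s : ℕ} (A : Matrix (Fin s) (Fin s) ℝ) (T : ℕ) {δ : ℝ}
    (hδ : δ < 1 / 2) :
    (approxPairs A T δ).ncard ≤
      Set.ncard {h | h ∈ intBox s T ∧ ∀ j, NearInt δ (latticeMap A h j)} := by
  refine (ncard_approxPairs_le_ncard_abs_le A T hδ).trans (le_of_eq ?_)
  congr 1
  ext h
  simp only [Set.mem_ofPred_eq, mem_intBox]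
  norm_cast

theorem ncard_nearInt_le_ncard_approxPairs {s : ℕ} (A : Matrix (Fin s) (Fin s) ℝ) (H δ : ℝ) :
    Set.ncard {h : Fin s → ℤ | (∀ l, |(h l : ℝ)| ≤ H) ∧ ∀ j, NearInt δ (latticeMap A h j)} ≤
      (approxPairs A H δ).ncard := by
  have hsub : {h : Fin s → ℤ | (∀ l, |(h l : ℝ)| ≤ H) ∧ ∀ j, NearInt δ (latticeMap A h j)} ⊆
      Prod.fst '' approxPairs A H δ := by
    rintro h ⟨hh, hm⟩
    choose m hm using hm
    exact ⟨(h, m), ⟨hh, hm⟩, rfl⟩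
  exact (Set.ncard_le_ncard hsub ((finite_approxPairs A H δ).image _)).trans
    (Set.ncard_image_le (finite_approxPairs A H δ))

/-- Duality for the lattice of a symmetric matrix: interchanging the roles of the vectors and of the
linear forms changes the number of lattice points by the ratio of the volumes. -/
theorem exists_ncard_approxPairs_le_dual (s : ℕ) : ∃ C : ℝ, 1 ≤ C ∧
    ∀ A : Matrix (Fin s) (Fin s) ℝ, (∀ i j, A i j = A j i) → ∀ H κ : ℝ, 1 ≤ H → 1 ≤ κ →
      ((approxPairs A H (1 / κ)).ncard : ℝ) ≤
        C * (H / κ) ^ s * (approxPairs A κ (1 / H)).ncard := by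
  set Z : ℝ := ∑' r, decay 1 r with hZ
  have hZ0 : 0 ≤ Z := tsum_nonneg fun r => decay_nonneg _ _
  refine ⟨max 1 (((25 : ℝ) ^ s) ^ 4 * ((96 * Z) ^ s * 4 ^ s)), le_max_left _ _, ?_⟩
  intro A hA H κ hH hκ
  have hT : 0 < ⌈H⌉₊ := Nat.ceil_pos.2 (by linarith)
  have hK : 0 < ⌊κ⌋₊ := Nat.floor_pos.2 hκ
  have hT' : (0 : ℝ) < ⌈H⌉₊ := by exact_mod_cast hT
  have hK' : (0 : ℝ) < ⌊κ⌋₊ := by exact_mod_cast hK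
  have hT1 : H ≤ ⌈H⌉₊ := Nat.le_ceil H
  have hT2 : (⌈H⌉₊ : ℝ) ≤ 2 * H := by linarith [Nat.ceil_lt_add_one (by linarith : 0 ≤ H)]
  have hK1 : (⌊κ⌋₊ : ℝ) ≤ κ := Nat.floor_le (by linarith)
  have hK2 : κ / 2 ≤ ⌊κ⌋₊ := by
    have h1 := Nat.lt_floor_add_one κ
    have : (1 : ℝ) ≤ ⌊κ⌋₊ := by exact_mod_cast hK
    linarith
  -- four doublings pass to the approximation `1 / (16 ⌊κ⌋)` that the integral case requires
  have h1 : (approxPairs A H (1 / κ)).ncard ≤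
      (25 ^ s) ^ 4 * (approxPairs A ⌈H⌉₊ (1 / (16 * ⌊κ⌋₊))).ncard := by
    refine le_trans ?_ (ncard_approxPairs_two_pow_mul_le A hT' (by positivity) 4)
    refine ncard_approxPairs_mono A ?_ ?_
    · linarith
    · rw [show (2 : ℝ) ^ 4 * (1 / (16 * ⌊κ⌋₊)) = 1 / ⌊κ⌋₊ by field_simp; norm_num]
      gcongr
  have h2 := ncard_approxPairs_le_ncard_nearInt A ⌈H⌉₊ (δ := 1 / (16 * ⌊κ⌋₊)) (by
    have : (1 : ℝ) ≤ ⌊κ⌋₊ := by exact_mod_cast hK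
    rw [div_lt_div_iff₀ (by positivity) (by positivity)]
    linarith)
  have h3 := ncard_nearInt_le_dual A hA hT hK
  have h4 : Set.ncard {k | k ∈ intBox s ⌊κ⌋₊ ∧
      ∀ j, NearInt (1 / (2 * ⌈H⌉₊ : ℕ)) (latticeMap A k j)} ≤ (approxPairs A κ (1 / H)).ncard := by
    refine (le_trans (Set.ncard_le_ncard ?_ ?_)
      (ncard_nearInt_le_ncard_approxPairs A ⌊κ⌋₊ (1 / (2 * ⌈H⌉₊ : ℕ)))).trans
      (ncard_approxPairs_mono A hK1 ?_)
    · rintro k ⟨hk, hk'⟩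
      refine ⟨fun l => ?_, hk'⟩
      have := mem_intBox.1 hk l
      exact_mod_cast this
    · exact (finite_intVec_abs_le _).subset fun h hh => hh.1
    · push_cast
      gcongr
      linarith
  have h5 : (⌈H⌉₊ : ℝ) / ⌊κ⌋₊ ≤ 4 * (H / κ) := by
    calc (⌈H⌉₊ : ℝ) / ⌊κ⌋₊ ≤ 2 * H / (κ / 2) := by gcongr
      _ = 4 * (H / κ) := by field_simp; norm_num
  calc ((approxPairs A H (1 / κ)).ncard : ℝ)
      ≤ ((25 : ℝ) ^ s) ^ 4 * (approxPairs A ⌈H⌉₊ (1 / (16 * ⌊κ⌋₊))).ncard := by exact_mod_cast h1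
    _ ≤ ((25 : ℝ) ^ s) ^ 4 *
          ((96 * Z) ^ s * (4 * (H / κ)) ^ s * (approxPairs A κ (1 / H)).ncard) := by
        gcongr
        calc ((approxPairs A ⌈H⌉₊ (1 / (16 * ⌊κ⌋₊))).ncard : ℝ) ≤ _ := by exact_mod_cast h2
          _ ≤ _ := h3
          _ ≤ _ := by
            gcongr
    _ = ((25 : ℝ) ^ s) ^ 4 * ((96 * Z) ^ s * 4 ^ s) * (H / κ) ^ s *
          (approxPairs A κ (1 / H)).ncard := by rw [mul_pow 4]; ring
    _ ≤ _ := by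
        gcongr
        exact le_max_right _ _

/-- Davenport's shrinking lemma. By the approximate log-convexity, the product of the counts at the
scale `1` and at the dual scale `1/(Hδ)` is at most that at the scales `z` and `1/(zHδ)`;
duality expresses both products as squares. -/
theorem exists_ncard_approxPairs_shrink (s : ℕ) : ∃ C : ℝ, 1 ≤ C ∧
    ∀ A : Matrix (Fin s) (Fin s) ℝ, (∀ i j, A i j = A j i) → ∀ H δ z : ℝ, 1 ≤ H → 0 < δ → δ ≤ 1 →
      H * δ ≤ 4 → 0 < z → z ≤ 1 → 1 ≤ z * H →
      ((approxPairs A H δ).ncard : ℝ) * z ^ s ≤ C * (approxPairs A (z * H) (z * δ)).ncard := by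
  obtain ⟨C, hC, hdual⟩ := exists_ncard_approxPairs_le_dual s
  set C₁ : ℝ := 25 ^ s * (25 ^ s) ^ 3 with hC₁
  have hC₁1 : 1 ≤ C₁ := by
    have : (1 : ℝ) ≤ 25 ^ s := one_le_pow₀ (by norm_num)
    rw [hC₁]
    exact one_le_mul_of_one_le_of_one_le this (one_le_pow₀ this)
  refine ⟨C * C₁, one_le_mul_of_one_le_of_one_le hC hC₁1, ?_⟩
  intro A hA H δ z hH hδ hδ1 hHδ hz hz1 hzH
  have hH0 : 0 < H := by linarith
  have hzδ : z * δ ≤ 1 := by nlinarith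
  set N₁ := ((approxPairs A H δ).ncard : ℝ) with hN₁
  set N₂ := ((approxPairs A (1 / δ) (1 / H)).ncard : ℝ) with hN₂
  set N₃ := ((approxPairs A (z * H) (z * δ)).ncard : ℝ) with hN₃
  set N₄ := ((approxPairs A (1 / (z * δ)) (1 / (z * H))).ncard : ℝ) with hN₄
  have h12 : N₁ ≤ C * (H * δ) ^ s * N₂ := by
    have := hdual A hA H (1 / δ) hH (by rwa [one_le_div hδ])
    rwa [one_div_one_div, div_div_eq_mul_div, div_one] at this
  have h43 : N₄ ≤ C * (1 / (z ^ 2 * (H * δ))) ^ s * N₃ := by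
    have := hdual A hA (1 / (z * δ)) (z * H) (by rwa [one_le_div (by positivity)]) hzH
    rwa [one_div_one_div, div_div, show z * δ * (z * H) = z ^ 2 * (H * δ) by ring] at this
  have hconv : N₁ * N₂ ≤ C₁ * (N₃ * N₄) := by
    have h1 := ncard_approxPairs_mul_le A hH0 hδ (b := 1 / (H * δ)) (z := z) (by positivity)
      (by rw [mul_one_div, one_le_div (by positivity)]; exact hHδ) hz hz1
    rw [show 1 / (H * δ) * H = 1 / δ by field_simp,
      show 1 / (H * δ) * δ = 1 / H by field_simp] at h1
    have h2 : (approxPairs A (6 * (1 / (H * δ)) / z * H) (6 * (1 / (H * δ)) / z * δ)).ncard ≤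
        (25 ^ s) ^ 3 * (approxPairs A (1 / (z * δ)) (1 / (z * H))).ncard := by
      refine le_trans (ncard_approxPairs_mono A ?_ ?_)
        (ncard_approxPairs_two_pow_mul_le A (by positivity) (by positivity) 3)
      · rw [show 6 * (1 / (H * δ)) / z * H = 6 * (1 / (z * δ)) by field_simp]
        gcongr; norm_num
      · rw [show 6 * (1 / (H * δ)) / z * δ = 6 * (1 / (z * H)) by field_simp]
        gcongr; norm_num
    have h3 := h1.trans (Nat.mul_le_mul_left _ (Nat.mul_le_mul_left _ h2))
    have h4 : N₁ * N₂ ≤ 25 ^ s * (N₃ * ((25 ^ s) ^ 3 * N₄)) := by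
      rw [hN₁, hN₂, hN₃, hN₄]
      exact_mod_cast h3
    refine h4.trans (le_of_eq ?_)
    rw [hC₁]; ring
  have hN₁0 : 0 ≤ N₁ := Nat.cast_nonneg _
  have hN₃0 : 0 ≤ N₃ := Nat.cast_nonneg _
  have hsq : (N₁ * z ^ s) ^ 2 ≤ (C * C₁ * N₃) ^ 2 := by
    calc (N₁ * z ^ s) ^ 2 = N₁ * N₁ * (z ^ s) ^ 2 := by ring
      _ ≤ N₁ * (C * (H * δ) ^ s * N₂) * (z ^ s) ^ 2 := by gcongr
      _ = C * (H * δ) ^ s * (z ^ s) ^ 2 * (N₁ * N₂) := by ring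
      _ ≤ C * (H * δ) ^ s * (z ^ s) ^ 2 *
            (C₁ * (N₃ * (C * (1 / (z ^ 2 * (H * δ))) ^ s * N₃))) :=
          mul_le_mul_of_nonneg_left (hconv.trans (by gcongr)) (by positivity)
      _ = C ^ 2 * C₁ * N₃ ^ 2 := by
          rw [div_pow, one_pow, mul_pow (z ^ 2), ← pow_mul, ← pow_mul, mul_comm 2 s]
          field_simp
      _ ≤ C ^ 2 * C₁ ^ 2 * N₃ ^ 2 := by
          gcongr
          nlinarith
      _ = _ := by ring
  exact (pow_le_pow_iff_left₀ (by positivity) (by positivity) two_ne_zero).1 hsq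

/-! ### Weyl differencing and polarization -/

theorem sum_piFinset_insertNth {α M : Type*} [AddCommMonoid M] {m : ℕ} (p : Fin (m + 1))
    (R : Finset α) (φ : (Fin (m + 1) → α) → M) :
    ∑ x ∈ Fintype.piFinset (fun _ : Fin (m + 1) => R), φ x =
      ∑ t ∈ Fintype.piFinset (fun _ : Fin m => R), ∑ h ∈ R, φ (p.insertNth h t) := by
  rw [← Finset.sum_product' (f := fun t h => φ (p.insertNth h t))]
  refine Finset.sum_bij' (fun x _ => (p.removeNth x, x p)) (fun y _ => p.insertNth y.2 y.1)
    ?_ ?_ ?_ ?_ ?_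
  · intro x hx
    rw [Fintype.mem_piFinset] at hx
    rw [Finset.mem_product, Fintype.mem_piFinset]
    exact ⟨fun i => hx _, hx _⟩
  · intro y hy
    rw [Finset.mem_product, Fintype.mem_piFinset] at hy
    rw [Fintype.mem_piFinset, Fin.forall_iff_succAbove p]
    simpa using ⟨hy.2, hy.1⟩
  · intro x _; simp
  · intro y _; simp
  · intro x _; simp

/-- The iterated multiplicative difference of a weight: `w` is replaced by `w(· + h_i) w(·)` for
each `i` in turn. -/
def weightDiff {G : Type*} [AddCommGroup G] : (m : ℕ) → (G → ℝ) → (Fin m → G) → G → ℝ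
  | 0, w, _ => w
  | m + 1, w, h => weightDiff m (fun x => w (x + h 0) * w x) (Fin.tail h)

/-- The iterated difference of a function: `f` is replaced by `f(· + h_i) - f(·)` for each `i` in
turn. -/
def phaseDiff {G : Type*} [AddCommGroup G] : (m : ℕ) → (G → ℝ) → (Fin m → G) → G → ℝ
  | 0, f, _ => f
  | m + 1, f, h => phaseDiff m (fun x => f (x + h 0) - f x) (Fin.tail h)

theorem pow_succ_sum_le {ι : Type*} (S : Finset ι) (f : ι → ℝ) (hf : ∀ i ∈ S, 0 ≤ f i) (n : ℕ) :
    (∑ i ∈ S, f i) ^ (n + 1) ≤ (S.card : ℝ) ^ n * ∑ i ∈ S, f i ^ (n + 1) := by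
  rcases S.eq_empty_or_nonempty with rfl | hS
  · simp
  · have h := pow_sum_div_card_le_sum_pow (s := S) hf n
    have : (0 : ℝ) < S.card := by exact_mod_cast hS.card_pos
    rwa [div_le_iff₀ (by positivity), mul_comm] at h

theorem norm_sum_sq_le_sum_diff {G : Type*} [AddCommGroup G] {Q R : Finset G}
    (hQR : ∀ x ∈ Q, ∀ y ∈ Q, x - y ∈ R) (w : G → ℝ) (hw : ∀ x, x ∉ Q → w x = 0) (f : G → ℝ) :
    ‖∑ x ∈ Q, (w x : ℂ) * unitExp (f x)‖ ^ 2 ≤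
      ∑ h ∈ R, ‖∑ x ∈ Q, ((w (x + h) * w x : ℝ) : ℂ) * unitExp (f (x + h) - f x)‖ := by
  classical
  have h1 : ((‖∑ x ∈ Q, (w x : ℂ) * unitExp (f x)‖ ^ 2 : ℝ) : ℂ) =
      ∑ h ∈ R, ∑ y ∈ Q, ((w (y + h) * w y : ℝ) : ℂ) * unitExp (f (y + h) - f y) := by
    rw [Complex.ofReal_pow, ← Complex.mul_conj', map_sum, Finset.sum_mul_sum, Finset.sum_comm,
      Finset.sum_comm (s := R)]
    refine Finset.sum_congr rfl fun y hy => ?_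
    have h2 : ∀ h : G, ((w (y + h) * w y : ℝ) : ℂ) * unitExp (f (y + h) - f y) =
        (fun x => ((w x * w y : ℝ) : ℂ) * unitExp (f x - f y)) (addLeftEmbedding y h) :=
      fun h => rfl
    rw [Finset.sum_congr rfl fun h _ => h2 h, ← Finset.sum_map R (addLeftEmbedding y)
      fun x => ((w x * w y : ℝ) : ℂ) * unitExp (f x - f y)]
    have h3 : Q ⊆ R.map (addLeftEmbedding y) := fun x hx =>
      Finset.mem_map.2 ⟨x - y, hQR x hx y hy, by simp⟩
    rw [← Finset.sum_subset h3 fun x _ hx => by rw [hw x hx]; simp]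
    refine Finset.sum_congr rfl fun x _ => ?_
    rw [map_mul, Complex.conj_ofReal, conj_unitExp, sub_eq_add_neg, unitExp_add]
    push_cast
    ring
  have h2 : ‖∑ x ∈ Q, (w x : ℂ) * unitExp (f x)‖ ^ 2 =
      ‖((‖∑ x ∈ Q, (w x : ℂ) * unitExp (f x)‖ ^ 2 : ℝ) : ℂ)‖ := by
    rw [Complex.norm_real, Real.norm_of_nonneg (by positivity)]
  rw [h2, h1]
  exact norm_sum_le _ _

/-- Weyl differencing with weights, by the Cauchy–Schwarz inequality in each step. -/
theorem norm_sum_pow_le_sum_diff {G : Type*} [AddCommGroup G] {Q R : Finset G}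
    (hQR : ∀ x ∈ Q, ∀ y ∈ Q, x - y ∈ R) (m : ℕ) (w : G → ℝ) (hw : ∀ x, x ∉ Q → w x = 0)
    (f : G → ℝ) :
    ‖∑ x ∈ Q, (w x : ℂ) * unitExp (f x)‖ ^ 2 ^ m ≤
      (R.card : ℝ) ^ (2 ^ m - m - 1) * ∑ h ∈ Fintype.piFinset (fun _ : Fin m => R),
        ‖∑ x ∈ Q, (weightDiff m w h x : ℂ) * unitExp (phaseDiff m f h x)‖ := by
  induction m generalizing w f with
  | zero => simp [weightDiff, phaseDiff]
  | succ m ih =>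
    have hm : m < 2 ^ m := Nat.lt_two_pow_self
    have e : 2 ^ m = (2 ^ m - 1) + 1 := by omega
    calc ‖∑ x ∈ Q, (w x : ℂ) * unitExp (f x)‖ ^ 2 ^ (m + 1)
        = (‖∑ x ∈ Q, (w x : ℂ) * unitExp (f x)‖ ^ 2) ^ 2 ^ m := by rw [pow_succ', pow_mul]
      _ ≤ (∑ h ∈ R,
            ‖∑ x ∈ Q, ((w (x + h) * w x : ℝ) : ℂ) * unitExp (f (x + h) - f x)‖) ^ 2 ^ m := by
          gcongr
          exact norm_sum_sq_le_sum_diff hQR w hw f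
      _ ≤ (R.card : ℝ) ^ (2 ^ m - 1) * ∑ h ∈ R,
            ‖∑ x ∈ Q, ((w (x + h) * w x : ℝ) : ℂ) * unitExp (f (x + h) - f x)‖ ^ 2 ^ m := by
          have := pow_succ_sum_le R (fun h =>
            ‖∑ x ∈ Q, ((w (x + h) * w x : ℝ) : ℂ) * unitExp (f (x + h) - f x)‖)
            (fun _ _ => norm_nonneg _) (2 ^ m - 1)
          rwa [← e] at this
      _ ≤ (R.card : ℝ) ^ (2 ^ m - 1) * ∑ h ∈ R, ((R.card : ℝ) ^ (2 ^ m - m - 1) *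
            ∑ t ∈ Fintype.piFinset (fun _ : Fin m => R),
              ‖∑ x ∈ Q, (weightDiff m (fun x => w (x + h) * w x) t x : ℂ) *
                unitExp (phaseDiff m (fun x => f (x + h) - f x) t x)‖) := by
          refine mul_le_mul_of_nonneg_left (Finset.sum_le_sum fun h _ => ?_)
            (pow_nonneg (Nat.cast_nonneg _) _)
          exact ih (fun x => w (x + h) * w x) (fun x hx => by rw [hw x hx, mul_zero])
            fun x => f (x + h) - f x
      _ = _ := by
          rw [sum_piFinset_insertNth 0, Finset.sum_comm, ← Finset.mul_sum, ← mul_assoc, ← pow_add]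
          have e2 : 2 ^ (m + 1) - (m + 1) - 1 = 2 ^ m - 1 + (2 ^ m - m - 1) := by
            rw [pow_succ]; omega
          rw [e2]
          rfl

theorem weightDiff_prod {s : ℕ} (m : ℕ) (w : Fin s → ℤ → ℝ) (h : Fin m → Fin s → ℤ)
    (x : Fin s → ℤ) :
    weightDiff m (fun y : Fin s → ℤ => ∏ l, w l (y l)) h x =
      ∏ l, weightDiff m (w l) (fun i => h i l) (x l) := by
  induction m generalizing w with
  | zero => rfl
  | succ m ih =>
    rw [weightDiff]
    have := ih (fun l y => w l (y + h 0 l) * w l y) (Fin.tail h)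
    simp only [Finset.prod_mul_distrib] at this
    exact this

theorem TameWeight.weightDiff {a L : ℝ} (ha : 0 ≤ a) (hL : 0 < L) (m : ℕ) {w : ℤ → ℝ}
    (hw : TameWeight a L w) (h : Fin m → ℤ) : TameWeight (2 ^ m * a) L (weightDiff m w h) := by
  induction m generalizing a w with
  | zero => simpa [_root_.weightDiff] using hw
  | succ m ih =>
    have h1 := ih (add_nonneg ha ha) ((hw.comp_add (h 0)).mul ha ha hL hw) (Fin.tail h)
    rwa [← two_mul, ← mul_assoc, ← pow_succ] at h1

theorem weightDiff_eq_zero {G : Type*} [AddCommGroup G] (m : ℕ) {w : G → ℝ} (h : Fin m → G) {x : G}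
    (hx : w x = 0) : weightDiff m w h x = 0 := by
  induction m generalizing w with
  | zero => exact hx
  | succ m ih => exact ih (Fin.tail h) (by rw [hx, mul_zero])

theorem phaseDiff_sub {G : Type*} [AddCommGroup G] (m : ℕ) (f g : G → ℝ) (h : Fin m → G) (x : G) :
    phaseDiff m (fun y => f y - g y) h x = phaseDiff m f h x - phaseDiff m g h x := by
  induction m generalizing f g with
  | zero => rfl
  | succ m ih =>
    simp only [phaseDiff]
    rw [← ih]
    congr 1
    ext y
    ring

theorem phaseDiff_sum_mul {G ι : Type*} [AddCommGroup G] (S : Finset ι) (m : ℕ) (α : ι → ℝ)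
    (f : ι → G → ℝ) (h : Fin m → G) (x : G) :
    phaseDiff m (fun y => ∑ i ∈ S, α i * f i y) h x = ∑ i ∈ S, α i * phaseDiff m (f i) h x := by
  induction m generalizing f with
  | zero => rfl
  | succ m ih =>
    simp only [phaseDiff]
    rw [← ih]
    congr 1
    ext y
    rw [← Finset.sum_sub_distrib]
    simp only [mul_sub]

theorem phaseDiff_comp_add {G : Type*} [AddCommGroup G] (m : ℕ) (f : G → ℝ) (h : Fin m → G)
    (x z : G) : phaseDiff m (fun y => f (y + z)) h x = phaseDiff m f h (x + z) := by
  induction m generalizing f with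
  | zero => rfl
  | succ m ih =>
    simp only [phaseDiff]
    rw [← ih]
    congr 1
    ext y
    rw [add_right_comm]

/-- An iterated difference, as a function of its argument, is constant up to a difference of order
one more, taken at `0` with the argument as a further direction. -/
theorem phaseDiff_eq_add {G : Type*} [AddCommGroup G] (m : ℕ) (f : G → ℝ) (h : Fin m → G) (x : G) :
    phaseDiff m f h x = phaseDiff m f h 0 +
      phaseDiff (m + 1) f (Fin.cons x h : Fin (m + 1) → G) 0 := by
  have : phaseDiff (m + 1) f (Fin.cons x h : Fin (m + 1) → G) 0 =
      phaseDiff m (fun y => f (y + x) - f y) h 0 := by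
    simp [phaseDiff]
  rw [this, phaseDiff_sub, phaseDiff_comp_add, zero_add]
  ring

theorem phaseDiff_eq_sum {G : Type*} [AddCommGroup G] (m : ℕ) (f : G → ℝ) (h : Fin m → G) (x : G) :
    phaseDiff m f h x = ∑ b : Fin m → Bool,
      (∏ i, if b i then 1 else -1) * f (x + ∑ i, if b i then h i else 0) := by
  induction m generalizing f with
  | zero => simp [phaseDiff]
  | succ m ih =>
    rw [phaseDiff, ih, ← (Fin.consEquiv fun _ => Bool).sum_comp, Fintype.sum_prod_type,
      Fintype.sum_bool, ← Finset.sum_add_distrib]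
    refine Finset.sum_congr rfl fun b _ => ?_
    simp only [Fin.consEquiv_apply, Fin.prod_univ_succ, Fin.sum_univ_succ, Fin.cons_zero,
      Fin.cons_succ, if_true, Bool.false_eq_true, if_false, zero_add, Fin.tail]
    rw [show x + (h 0 + ∑ i : Fin m, if b i then h i.succ else 0) =
      x + (∑ i : Fin m, if b i then h i.succ else 0) + h 0 by abel]
    ring

/-- The top difference of a product of additive functions is a permanent (Ryser's formula). -/
theorem phaseDiff_prod {G : Type*} [AddCommGroup G] (n : ℕ) (a : Fin n → G →+ ℝ) (h : Fin n → G) :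
    phaseDiff n (fun x => ∏ t, a t x) h 0 = ∑ σ : Equiv.Perm (Fin n), ∏ t, a t (h (σ t)) := by
  classical
  rw [phaseDiff_eq_sum]
  have h1 : ∀ b : Fin n → Bool, ∏ t, a t (0 + ∑ i, if b i then h i else 0) =
      ∑ φ : Fin n → Fin n, ∏ t, ((if b (φ t) then 1 else 0) * a t (h (φ t))) := by
    intro b
    have := Finset.prod_univ_sum (fun _ : Fin n => (Finset.univ : Finset (Fin n)))
      (fun t i => (if b i then 1 else 0) * a t (h i))
    rw [Fintype.piFinset_univ] at this
    rw [← this]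
    refine Finset.prod_congr rfl fun t _ => ?_
    rw [zero_add, map_sum]
    refine Finset.sum_congr rfl fun i _ => ?_
    split_ifs <;> simp
  -- the signed sum over all subsets that contain the range of `φ` vanishes unless `φ` is onto
  have h2 : ∀ φ : Fin n → Fin n, ∑ b : Fin n → Bool, (∏ i, if b i then (1 : ℝ) else -1) *
      ∏ t, (if b (φ t) then (1 : ℝ) else 0) = if Function.Surjective φ then 1 else 0 := by
    intro φ
    have h3 : ∀ b : Fin n → Bool, ∏ t, (if b (φ t) then (1 : ℝ) else 0) =
        ∏ i, if i ∈ Set.range φ then (if b i then (1 : ℝ) else 0) else 1 := by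
      intro b
      by_cases hb : ∀ t, b (φ t) = true
      · rw [Finset.prod_eq_one fun t _ => by rw [if_pos (hb t)], Finset.prod_eq_one]
        intro i _
        split_ifs with hi hbi
        · rfl
        · obtain ⟨t, rfl⟩ := hi
          exact absurd (hb t) hbi
        · rfl
      · push Not at hb
        obtain ⟨t, ht⟩ := hb
        rw [Finset.prod_eq_zero (Finset.mem_univ t) (if_neg ht),
          Finset.prod_eq_zero (Finset.mem_univ (φ t))]
        rw [if_pos ⟨t, rfl⟩, if_neg ht]
    simp only [h3, ← Finset.prod_mul_distrib]
    have h4 := Finset.prod_univ_sum (fun _ : Fin n => (Finset.univ : Finset Bool))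
      (fun i c => (if c then (1 : ℝ) else -1) *
        if i ∈ Set.range φ then (if c then (1 : ℝ) else 0) else 1)
    rw [Fintype.piFinset_univ] at h4
    rw [← h4]
    simp only [Fintype.sum_bool, if_true, Bool.false_eq_true, if_false]
    split_ifs with hφ
    · refine Finset.prod_eq_one fun i _ => ?_
      have hi : i ∈ Set.range φ := hφ i
      rw [if_pos hi, if_pos hi]
      norm_num
    · rw [Function.Surjective] at hφ
      push Not at hφ
      obtain ⟨i, hi⟩ := hφ
      refine Finset.prod_eq_zero (Finset.mem_univ i) ?_
      have : i ∉ Set.range φ := fun ⟨t, ht⟩ => hi t ht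
      rw [if_neg this, if_neg this]
      norm_num
  simp only [h1, Finset.mul_sum, Finset.prod_mul_distrib]
  rw [Finset.sum_comm]
  simp only [← mul_assoc, ← Finset.sum_mul, h2, ite_mul, one_mul, zero_mul]
  rw [← Finset.sum_filter]
  symm
  refine Finset.sum_bij (fun σ _ => (σ : Fin n → Fin n)) ?_ ?_ ?_ ?_
  · intro σ _
    simpa using σ.surjective
  · intro σ _ τ _ hστ
    exact DFunLike.coe_injective hστ
  · intro φ hφ
    rw [Finset.mem_filter] at hφ
    exact ⟨Equiv.ofBijective φ (Finite.surjective_iff_bijective.1 hφ.2), Finset.mem_univ _, rfl⟩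
  · intro σ _
    rfl

theorem eval_eq_sum_symCoeff {s n : ℕ} (F : MvPolynomial (Fin s) ℤ) (hF : F.IsHomogeneous n)
    (x : Fin s → ℤ) :
    ((MvPolynomial.eval x F : ℤ) : ℝ) =
      ∑ J : Fin n → Fin s, (symCoeff F J : ℝ) * ∏ t, (x (J t) : ℝ) := by
  have h := congrArg (MvPolynomial.eval fun l => (x l : ℚ)) (eq_sum_symCoeff F hF)
  rw [MvPolynomial.eval_map, map_sum] at h
  simp only [map_mul, MvPolynomial.eval_C, map_prod, MvPolynomial.eval_X] at h
  have h1 : MvPolynomial.eval₂ (Int.castRingHom ℚ) (fun l => (x l : ℚ)) F =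
      ((MvPolynomial.eval x F : ℤ) : ℚ) := by
    rw [MvPolynomial.eval, MvPolynomial.coe_eval₂Hom]
    exact (MvPolynomial.hom_eval₂ F (RingHom.id ℤ) (Int.castRingHom ℚ) x).symm
  rw [h1] at h
  have := congrArg (fun q : ℚ => (q : ℝ)) h
  push_cast at this
  exact this

/-- The difference of order `m` of a form of degree `m + 1` is affine, with the polar forms as its
linear coefficients. -/
theorem phaseDiff_form {s m : ℕ} (F : MvPolynomial (Fin s) ℤ) (hF : F.IsHomogeneous (m + 1))
    (h : Fin m → Fin s → ℤ) (x : Fin s → ℤ) :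
    phaseDiff m (fun y : Fin s → ℤ => ((MvPolynomial.eval y F : ℤ) : ℝ)) h x =
      phaseDiff m (fun y : Fin s → ℤ => ((MvPolynomial.eval y F : ℤ) : ℝ)) h 0 +
        ∑ j, (x j : ℝ) * (polarForm (m + 1) F j h : ℝ) := by
  rw [phaseDiff_eq_add]
  congr 1
  simp only [eval_eq_sum_symCoeff F hF]
  let ev : Fin s → (Fin s → ℤ) →+ ℝ := fun j =>
    (Int.castAddHom ℝ).comp (Pi.evalAddMonoidHom (fun _ : Fin s => ℤ) j)
  have hev : ∀ j (y : Fin s → ℤ), ev j y = (y j : ℝ) := fun _ _ => rfl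
  rw [phaseDiff_sum_mul Finset.univ (m + 1) (fun J : Fin (m + 1) → Fin s => (symCoeff F J : ℝ))
    (fun J (y : Fin s → ℤ) => ∏ t, (y (J t) : ℝ))]
  have h1 : ∀ (J : Fin (m + 1) → Fin s) (H : Fin (m + 1) → Fin s → ℤ),
      phaseDiff (m + 1) (fun y : Fin s → ℤ => ∏ t, (y (J t) : ℝ)) H 0 =
        ∑ σ : Equiv.Perm (Fin (m + 1)), ∏ t, (H (σ t) (J t) : ℝ) := fun J H => by
    simpa only [hev] using phaseDiff_prod (m + 1) (fun t => ev (J t)) H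
  simp only [h1, Finset.mul_sum]
  rw [Finset.sum_comm]
  -- the coefficients are symmetric, so all permutations contribute equally
  have h2 : ∀ σ : Equiv.Perm (Fin (m + 1)), ∑ J : Fin (m + 1) → Fin s, (symCoeff F J : ℝ) *
      ∏ t, ((Fin.cons x h : Fin (m + 1) → Fin s → ℤ) (σ t) (J t) : ℝ) =
      ∑ J : Fin (m + 1) → Fin s, (symCoeff F J : ℝ) *
        ∏ t, ((Fin.cons x h : Fin (m + 1) → Fin s → ℤ) t (J t) : ℝ) := by
    intro σ
    rw [← (Equiv.arrowCongr σ (Equiv.refl (Fin s))).symm.sum_comp]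
    refine Finset.sum_congr rfl fun J _ => ?_
    have e : (Equiv.arrowCongr σ (Equiv.refl (Fin s))).symm J = J ∘ σ := by
      ext t; simp
    rw [e, symCoeff_comp_perm]
    congr 1
    exact Equiv.prod_comp σ fun t => ((Fin.cons x h : Fin (m + 1) → Fin s → ℤ) t (J t) : ℝ)
  rw [Finset.sum_congr rfl fun σ _ => h2 σ, Finset.sum_const, Finset.card_univ, Fintype.card_perm,
    Fintype.card_fin, nsmul_eq_mul, ← (Fin.consEquiv fun _ => Fin s).sum_comp,
    Fintype.sum_prod_type, Finset.mul_sum]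
  refine Finset.sum_congr rfl fun j _ => ?_
  simp only [Fin.consEquiv_apply, Fin.prod_univ_succ, Fin.cons_zero, Fin.cons_succ, polarForm]
  push_cast
  simp only [Finset.mul_sum]
  refine Finset.sum_congr rfl fun J _ => ?_
  have e : ∀ u v w p : ℝ, u * (v * (w * p)) = w * (u * (v * p)) := fun u v w p => by ring
  exact e _ _ _ _

/-! ### Shrinking all vectors of a system of multilinear forms -/

theorem ncard_eq_sum_insertNth {α : Type*} {n : ℕ} (p : Fin (n + 1)) (S : Set (Fin (n + 1) → α))
    (hS : S.Finite) (Y : Finset (Fin n → α)) (hY : ∀ x ∈ S, p.removeNth x ∈ Y) :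
    S.ncard = ∑ y ∈ Y, Set.ncard {h : α | (p.insertNth h y : Fin (n + 1) → α) ∈ S} := by
  classical
  rw [Set.ncard_eq_toFinset_card _ hS, Finset.card_eq_sum_card_fiberwise (f := p.removeNth) (t := Y)
    fun x hx => hY x (by simpa using hx)]
  refine Finset.sum_congr rfl fun y _ => ?_
  have hinj : Function.Injective fun h : α => (p.insertNth h y : Fin (n + 1) → α) := by
    intro h h' e
    simpa using congrFun e p
  rw [← Set.ncard_image_of_injective _ hinj, ← Set.ncard_coe_finset]
  congr 1
  ext x
  simp only [Finset.coe_filter, Set.Finite.mem_toFinset, Set.mem_ofPred_eq, Set.mem_image]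
  constructor
  · rintro ⟨hx, rfl⟩
    exact ⟨x p, by simpa using hx, by simp⟩
  · rintro ⟨h, hh, rfl⟩
    exact ⟨hh, by simp⟩

/-- A system of `s` forms in `n + 1` vectors of `s` variables which is, as a function of each of
the vectors, linear with a symmetric matrix. -/
def IsSymmSystem {s n : ℕ} (Φ : (Fin (n + 1) → Fin s → ℤ) → Fin s → ℝ) : Prop :=
  ∀ (p : Fin (n + 1)) (y : Fin n → Fin s → ℤ), ∃ A : Matrix (Fin s) (Fin s) ℝ,
    (∀ i j, A i j = A j i) ∧
      ∀ h, Φ (p.insertNth h y : Fin (n + 1) → Fin s → ℤ) = latticeMap A h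

/-- The tuples `x` of integer vectors with `|x_t| ≤ H_t` at which all forms of the system `Φ` are
within `δ` of an integer. -/
def nearTuples {s m : ℕ} (Φ : (Fin m → Fin s → ℤ) → Fin s → ℝ) (H : Fin m → ℝ) (δ : ℝ) :
    Set (Fin m → Fin s → ℤ) :=
  {x | (∀ t l, |(x t l : ℝ)| ≤ H t) ∧ ∀ j, NearInt δ (Φ x j)}

theorem finite_tuples_abs_le {s m : ℕ} (H : Fin m → ℝ) :
    {x : Fin m → Fin s → ℤ | ∀ t l, |(x t l : ℝ)| ≤ H t}.Finite := by
  have h : {x : Fin m → Fin s → ℤ | ∀ t l, |(x t l : ℝ)| ≤ H t} =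
      Set.univ.pi fun t => {y : Fin s → ℤ | ∀ l, |(y l : ℝ)| ≤ H t} := by
    ext x; simp
  rw [h]
  exact Set.Finite.pi fun t => finite_intVec_abs_le (H t)

theorem finite_nearTuples {s m : ℕ} (Φ : (Fin m → Fin s → ℤ) → Fin s → ℝ) (H : Fin m → ℝ) (δ : ℝ) :
    (nearTuples Φ H δ).Finite :=
  (finite_tuples_abs_le H).subset fun _ hx => hx.1

theorem ncard_nearTuples_eq_sum {s n : ℕ} (Φ : (Fin (n + 1) → Fin s → ℤ) → Fin s → ℝ)
    (H : Fin (n + 1) → ℝ) (δ : ℝ) (p : Fin (n + 1)) :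
    (nearTuples Φ H δ).ncard =
      ∑ y ∈ (finite_tuples_abs_le (s := s) fun t => H (p.succAbove t)).toFinset,
        Set.ncard {h : Fin s → ℤ | (∀ l, |(h l : ℝ)| ≤ H p) ∧
          ∀ j, NearInt δ (Φ (p.insertNth h y : Fin (n + 1) → Fin s → ℤ) j)} := by
  rw [ncard_eq_sum_insertNth p _ (finite_nearTuples Φ H δ)
    (finite_tuples_abs_le (s := s) fun t => H (p.succAbove t)).toFinset]
  · refine Finset.sum_congr rfl fun y hy => ?_
    rw [Set.Finite.mem_toFinset] at hy
    congr 1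
    ext h
    simp only [nearTuples, Set.mem_ofPred_eq, Fin.forall_iff_succAbove p, Fin.insertNth_apply_same,
      Fin.insertNth_apply_succAbove]
    constructor
    · rintro ⟨⟨h1, _⟩, h2⟩
      exact ⟨h1, h2⟩
    · rintro ⟨h1, h2⟩
      exact ⟨⟨h1, hy⟩, h2⟩
  · intro x hx
    rw [Set.Finite.mem_toFinset]
    exact fun t l => hx.1 _ l

/-- Davenport's shrinking lemma applied to the vector at position `p`, with the others fixed. -/
theorem exists_ncard_nearTuples_shrink_one (s n : ℕ) : ∃ C : ℝ, 1 ≤ C ∧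
    ∀ Φ : (Fin (n + 1) → Fin s → ℤ) → Fin s → ℝ, IsSymmSystem Φ →
      ∀ (H : Fin (n + 1) → ℝ) (p : Fin (n + 1)) (δ z : ℝ), 1 ≤ H p → 0 < δ → δ < 1 / 2 →
        H p * δ ≤ 4 → 0 < z → z ≤ 1 → 1 ≤ z * H p →
        ((nearTuples Φ H δ).ncard : ℝ) * z ^ s ≤
          C * (nearTuples Φ (Function.update H p (z * H p)) (z * δ)).ncard := by
  obtain ⟨C, hC, hshrink⟩ := exists_ncard_approxPairs_shrink s
  refine ⟨C, hC, ?_⟩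
  intro Φ hΦ H p δ z hH hδ hδ1 hHδ hz hz1 hzH
  rw [ncard_nearTuples_eq_sum Φ H δ p, ncard_nearTuples_eq_sum Φ _ (z * δ) p]
  simp only [Function.update_self, Function.update_of_ne (Fin.succAbove_ne p _)]
  push_cast
  rw [Finset.sum_mul, Finset.mul_sum]
  refine Finset.sum_le_sum fun y _ => ?_
  obtain ⟨A, hA, hAΦ⟩ := hΦ p y
  simp only [hAΦ]
  have h1 := ncard_nearInt_le_ncard_approxPairs A (H p) δ
  have h2 := ncard_approxPairs_le_ncard_abs_le A (z * H p) (δ := z * δ) (by nlinarith)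
  have h3 := hshrink A hA (H p) δ z hH hδ (by linarith) hHδ hz hz1 hzH
  calc _ ≤ ((approxPairs A (H p) δ).ncard : ℝ) * z ^ s := by gcongr
    _ ≤ C * (approxPairs A (z * H p) (z * δ)).ncard := h3
    _ ≤ _ := by gcongr

/-- All vectors are shrunk in turn; each step also sharpens the approximation. -/
theorem exists_ncard_nearTuples_shrink (s n : ℕ) : ∃ C : ℝ, 1 ≤ C ∧
    ∀ Φ : (Fin (n + 1) → Fin s → ℤ) → Fin s → ℝ, IsSymmSystem Φ →
      ∀ (K δ z : ℝ), 1 ≤ K → 0 < δ → δ < 1 / 2 → K * δ ≤ 4 → 0 < z → z ≤ 1 → 1 ≤ z * K →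
        ((nearTuples Φ (fun _ => K) δ).ncard : ℝ) * (z ^ s) ^ (n + 1) ≤
          C * (nearTuples Φ (fun _ => z * K) (z ^ (n + 1) * δ)).ncard := by
  obtain ⟨C, hC, hstep⟩ := exists_ncard_nearTuples_shrink_one s n
  refine ⟨C ^ (n + 1), one_le_pow₀ hC, ?_⟩
  intro Φ hΦ K δ z hK hδ hδ1 hKδ hz hz1 hzK
  have main : ∀ i : ℕ, i ≤ n + 1 →
      ((nearTuples Φ (fun _ => K) δ).ncard : ℝ) * (z ^ s) ^ i ≤
        C ^ i * (nearTuples Φ (fun t => if t.val < i then z * K else K) (z ^ i * δ)).ncard := by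
    intro i
    induction i with
    | zero => simp
    | succ i ih =>
      intro hi
      have hzi : z ^ i ≤ 1 := pow_le_one₀ hz.le hz1
      have hzi0 : 0 < z ^ i := by positivity
      let p : Fin (n + 1) := ⟨i, by omega⟩
      set Hi : Fin (n + 1) → ℝ := fun t => if t.val < i then z * K else K with hHi
      have hp : Hi p = K := by simp [Hi, p]
      have hziδ : z ^ i * δ ≤ δ := mul_le_of_le_one_left hδ.le hzi
      have h := hstep Φ hΦ Hi p (z ^ i * δ) z
        (by rw [hp]; exact hK) (by positivity) (by linarith)
        (by rw [hp]; exact (mul_le_mul_of_nonneg_left hziδ (by linarith)).trans hKδ) hz hz1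
        (by rw [hp]; exact hzK)
      have hup : Function.update Hi p (z * Hi p) =
          fun t => if t.val < i + 1 then z * K else K := by
        rw [hp]
        ext t
        by_cases ht : t = p
        · subst ht
          simp [p]
        · rw [Function.update_of_ne ht]
          have : t.val ≠ i := fun h => ht (Fin.ext h)
          have e : t.val < i + 1 ↔ t.val < i := by omega
          simp only [hHi, e]
      rw [hup, ← mul_assoc, ← pow_succ'] at h
      calc ((nearTuples Φ (fun _ => K) δ).ncard : ℝ) * (z ^ s) ^ (i + 1)
          = ((nearTuples Φ (fun _ => K) δ).ncard : ℝ) * (z ^ s) ^ i * z ^ s := by ring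
        _ ≤ C ^ i * (nearTuples Φ Hi (z ^ i * δ)).ncard * z ^ s := by
            exact mul_le_mul_of_nonneg_right (ih (by omega)) (by positivity)
        _ ≤ C ^ i * (C * (nearTuples Φ (fun t => if t.val < i + 1 then z * K else K)
              (z ^ (i + 1) * δ)).ncard) := by
            rw [mul_assoc]
            gcongr
        _ = _ := by ring
  have h := main (n + 1) le_rfl
  have e : (fun t : Fin (n + 1) => if t.val < n + 1 then z * K else K) = fun _ => z * K := by
    ext t; simp [t.isLt]
  rwa [e] at h

/-- The matrix of the polar forms of `F`, regarded as linear forms in the vector at position `p`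
with the remaining vectors `y` fixed. -/
noncomputable def polarMatrix {s n : ℕ} (F : MvPolynomial (Fin s) ℤ) (p : Fin (n + 1))
    (y : Fin n → Fin s → ℤ) (j l : Fin s) : ℝ :=
  ((n + 2).factorial : ℝ) * ∑ J : Fin n → Fin s,
    (symCoeff F (Fin.cons j (p.insertNth l J : Fin (n + 1) → Fin s) : Fin (n + 2) → Fin s) : ℝ) *
      ∏ t, (y t (J t) : ℝ)

/-- The symmetry of the coefficients under the transposition of the positions `0` and `p + 1`. -/
theorem polarMatrix_comm {s n : ℕ} (F : MvPolynomial (Fin s) ℤ) (p : Fin (n + 1))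
    (y : Fin n → Fin s → ℤ) (j l : Fin s) : polarMatrix F p y j l = polarMatrix F p y l j := by
  rw [polarMatrix, polarMatrix]
  congr 1
  refine Finset.sum_congr rfl fun J _ => ?_
  congr 2
  rw [← symCoeff_comp_perm F _ (Equiv.swap 0 p.succ)]
  congr 1
  ext t
  rcases Fin.eq_zero_or_eq_succ t with rfl | ⟨t, rfl⟩
  · simp
  · rcases Fin.eq_self_or_eq_succAbove p t with rfl | ⟨i, rfl⟩
    · simp
    · have h : Equiv.swap 0 p.succ (p.succAbove i).succ = (p.succAbove i).succ :=
        Equiv.swap_apply_of_ne_of_ne (Fin.succ_ne_zero _)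
          fun h => Fin.succAbove_ne p i (Fin.succ_injective _ h)
      simp [h]

theorem polarForm_insertNth {s n : ℕ} (F : MvPolynomial (Fin s) ℤ) (p : Fin (n + 1))
    (y : Fin n → Fin s → ℤ) (h : Fin s → ℤ) (j : Fin s) :
    (polarForm (n + 2) F j (p.insertNth h y : Fin (n + 1) → Fin s → ℤ) : ℝ) =
      ∑ l, polarMatrix F p y j l * h l := by
  have e : (polarForm (n + 2) F j (p.insertNth h y : Fin (n + 1) → Fin s → ℤ) : ℝ) =
      ((n + 2).factorial : ℝ) * ∑ J : Fin (n + 1) → Fin s,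
        (symCoeff F (Fin.cons j J : Fin (n + 2) → Fin s) : ℝ) *
          ∏ t, ((p.insertNth h y : Fin (n + 1) → Fin s → ℤ) t (J t) : ℝ) := by
    rw [polarForm]
    push_cast
    rfl
  rw [e, ← (Fin.insertNthEquiv (fun _ => Fin s) p).sum_comp, Fintype.sum_prod_type, Finset.mul_sum]
  refine Finset.sum_congr rfl fun l _ => ?_
  rw [polarMatrix, mul_assoc, Finset.sum_mul]
  congr 1
  refine Finset.sum_congr rfl fun J _ => ?_
  rw [Fin.prod_univ_succAbove _ p]
  simp only [Fin.insertNthEquiv_apply, Fin.insertNth_apply_same, Fin.insertNth_apply_succAbove]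
  have e' : ∀ u v w : ℝ, u * (v * w) = u * w * v := fun u v w => by ring
  exact e' _ _ _

theorem isSymmSystem_pencilForm {s r n : ℕ} (F : Fin r → MvPolynomial (Fin s) ℤ) (α : Fin r → ℝ) :
    IsSymmSystem fun (x : Fin (n + 1) → Fin s → ℤ) j => pencilForm (n + 2) F α j x := by
  intro p y
  refine ⟨Matrix.of fun j l => ∑ i, α i * polarMatrix (F i) p y j l, fun i j => ?_, fun h => ?_⟩
  · simp only [Matrix.of_apply, polarMatrix_comm _ p y i j]
  · ext j
    change pencilForm (n + 2) F α j (p.insertNth h y : Fin (n + 1) → Fin s → ℤ) =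
      ∑ l, (∑ i, α i * polarMatrix (F i) p y j l) * h l
    simp only [pencilForm, polarForm_insertNth, Finset.mul_sum, Finset.sum_mul]
    rw [Finset.sum_comm]
    simp only [mul_assoc]

/-! ### Weyl's inequality for smoothed sums -/

theorem card_intBox (s K : ℕ) : (intBox s K).card = (2 * K + 1) ^ s := by
  have : ((K : ℤ) + 1 + K).toNat = 2 * K + 1 := by omega
  simp [intBox, this]

theorem sub_mem_intBox {s K K' : ℕ} {x y : Fin s → ℤ} (hx : x ∈ intBox s K)
    (hy : y ∈ intBox s K') : x - y ∈ intBox s (K + K') := by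
  rw [mem_intBox] at *
  intro l
  push_cast
  exact (abs_sub _ _).trans (add_le_add (hx l) (hy l))

/-- Weyl's inequality for a smoothed exponential sum. The number `T / L`, the ratio of the size
of the box to the scale of the smoothing, enters only to a small power. -/
theorem norm_weighted_sum_pow_le {s r n : ℕ} (F : Fin r → MvPolynomial (Fin s) ℤ)
    (hF : ∀ i, (F i).IsHomogeneous (n + 2)) (α : Fin r → ℝ) {T : ℕ} (hT : 0 < T) {L η : ℝ}
    (hL : 0 < L) (hLT : L ≤ T) (hη : 0 < η) (hη1 : η ≤ 1) (w : Fin s → ℤ → ℝ)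
    (hw : ∀ l, TameWeight 1 L (w l)) (hsupp : ∀ l x, x ∉ Finset.Icc (-(T : ℤ)) T → w l x = 0) :
    ‖∑ x ∈ intBox s T, ((∏ l, w l (x l) : ℝ) : ℂ) *
        unitExp (∑ i, α i * ((MvPolynomial.eval x (F i) : ℤ) : ℝ))‖ ^ 2 ^ (n + 1) ≤
      ((4 * T + 1 : ℝ) ^ s) ^ (2 ^ (n + 1) - (n + 1) - 1) *
        ((3 * (2 ^ (n + 1)) ^ 2 * T * (T / L) ^ η) ^ s * ((2 * ∑' r, decay η r) ^ s *
          (nearTuples (fun (x : Fin (n + 1) → Fin s → ℤ) j => pencilForm (n + 2) F α j x)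
            (fun _ => 4 * T) (1 / T)).ncard)) := by
  classical
  set Φ := fun (x : Fin (n + 1) → Fin s → ℤ) j => pencilForm (n + 2) F α j x with hΦ
  set b : ℝ := 3 * (2 ^ (n + 1)) ^ 2 * T * (T / L) ^ η with hb
  have hb0 : 0 ≤ b := by positivity
  have h1 := norm_sum_pow_le_sum_diff (Q := intBox s T) (R := intBox s (T + T))
    (fun x hx y hy => sub_mem_intBox hx hy) (n + 1) (fun x => ∏ l, w l (x l)) (by
      intro x hx
      rw [intBox, Fintype.mem_piFinset] at hx
      push Not at hx
      obtain ⟨l, hl⟩ := hx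
      exact Finset.prod_eq_zero (Finset.mem_univ l) (hsupp l _ hl))
    (fun x => ∑ i, α i * ((MvPolynomial.eval x (F i) : ℤ) : ℝ))
  refine h1.trans ?_
  have hcard : ((intBox s (T + T)).card : ℝ) = (4 * T + 1 : ℝ) ^ s := by
    rw [card_intBox]; push_cast; ring
  rw [hcard]
  refine mul_le_mul_of_nonneg_left ?_ (by positivity)
  -- the differenced sum is a product of one-dimensional smoothed sums
  have h2 : ∀ h : Fin (n + 1) → Fin s → ℤ,
      ‖∑ x ∈ intBox s T, (weightDiff (n + 1) (fun x => ∏ l, w l (x l)) h x : ℂ) *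
        unitExp (phaseDiff (n + 1)
          (fun x => ∑ i, α i * ((MvPolynomial.eval x (F i) : ℤ) : ℝ)) h x)‖ ≤
        b ^ s * ∏ j, decay η (cellDist T (cellIndex T (Φ h j))) := by
    intro h
    have e1 : ∀ x : Fin s → ℤ, phaseDiff (n + 1)
        (fun x => ∑ i, α i * ((MvPolynomial.eval x (F i) : ℤ) : ℝ)) h x =
        (∑ i, α i * phaseDiff (n + 1)
          (fun y : Fin s → ℤ => ((MvPolynomial.eval y (F i) : ℤ) : ℝ)) h 0) +
          ∑ l, (x l : ℝ) * Φ h l := by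
      intro x
      rw [phaseDiff_sum_mul Finset.univ (n + 1) α
        (fun i (y : Fin s → ℤ) => ((MvPolynomial.eval y (F i) : ℤ) : ℝ))]
      simp only [phaseDiff_form (F _) (hF _) h x, mul_add, Finset.sum_add_distrib]
      congr 1
      simp only [hΦ, pencilForm, Finset.mul_sum]
      rw [Finset.sum_comm]
      refine Finset.sum_congr rfl fun l _ => Finset.sum_congr rfl fun i _ => ?_
      have e' : ∀ u v w : ℝ, u * (v * w) = v * (u * w) := fun u v w => by ring
      exact e' _ _ _
    have e2 : ∑ x ∈ intBox s T, (weightDiff (n + 1) (fun x => ∏ l, w l (x l)) h x : ℂ) *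
        unitExp (phaseDiff (n + 1)
          (fun x => ∑ i, α i * ((MvPolynomial.eval x (F i) : ℤ) : ℝ)) h x) =
        unitExp (∑ i, α i * phaseDiff (n + 1)
          (fun y : Fin s → ℤ => ((MvPolynomial.eval y (F i) : ℤ) : ℝ)) h 0) *
        ∏ l, ∑ x ∈ Finset.Icc (-(T : ℤ)) T,
          (weightDiff (n + 1) (w l) (fun i => h i l) x : ℂ) * unitExp (x * Φ h l) := by
      rw [← sum_piFinset_prod_mul_unitExp, Finset.mul_sum]
      refine Finset.sum_congr rfl fun x _ => ?_
      rw [e1, unitExp_add, weightDiff_prod]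
      ring
    rw [e2, norm_mul, norm_unitExp, one_mul, norm_prod]
    have e3 : b ^ s * ∏ j, decay η (cellDist T (cellIndex T (Φ h j))) =
        ∏ j, (b * decay η (cellDist T (cellIndex T (Φ h j)))) := by
      rw [Finset.prod_mul_distrib]; simp
    rw [e3]
    refine Finset.prod_le_prod (fun _ _ => norm_nonneg _) fun l _ => ?_
    have htame := (hw l).weightDiff zero_le_one hL (n + 1) fun i => h i l
    rw [mul_one] at htame
    exact htame.norm_sum_unitExp_le (one_le_pow₀ one_le_two) hT hL hLT hη hη1
      (fun x hx => weightDiff_eq_zero _ _ (hsupp l x hx)) _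
  refine (Finset.sum_le_sum fun h _ => h2 h).trans ?_
  rw [← Finset.mul_sum]
  refine mul_le_mul_of_nonneg_left ?_ (by positivity)
  rw [sum_piFinset_insertNth 0, ncard_nearTuples_eq_sum Φ _ _ 0]
  push_cast
  rw [Finset.mul_sum]
  refine (Finset.sum_le_sum fun y _ => ?_).trans
    (Finset.sum_le_sum_of_subset_of_nonneg (fun y hy => ?_) fun y _ _ => by
      have : 0 ≤ ∑' r, decay η r := tsum_nonneg fun r => decay_nonneg _ _
      positivity)
  · obtain ⟨A, -, hA⟩ := isSymmSystem_pencilForm F α 0 y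
    have h3 := sum_prod_decay_le (latticeMap A) 0 (intBox s (T + T)) (intBox s (T + T + (T + T)))
      (fun x hx y hy => sub_mem_intBox hx hy) hT hη
    simp only [Pi.zero_apply, add_zero, ← hA] at h3
    refine h3.trans (le_of_eq ?_)
    congr 3
    ext h
    simp only [Set.mem_ofPred_eq, mem_intBox]
    refine and_congr_left fun _ => forall_congr' fun l => ?_
    rw [show (4 : ℝ) * T = ((T + T + (T + T) : ℕ) : ℝ) by push_cast; ring]
    norm_cast
  · rw [Fintype.mem_piFinset] at hy
    rw [Set.Finite.mem_toFinset]
    intro t l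
    have h4 := mem_intBox.1 (hy t) l
    have h5 : |(y t l : ℝ)| ≤ ((T + T : ℕ) : ℝ) := by exact_mod_cast h4
    push_cast at h5
    linarith [Nat.cast_nonneg (α := ℝ) T]

/-! ### Rational approximation by Cramer's rule -/

theorem exists_det_ne_zero_or_exists_orthogonal {r : ℕ} (V : Set (Fin r → ℤ)) :
    (∃ M : Matrix (Fin r) (Fin r) ℤ, (∀ k, M k ∈ V) ∧ M.det ≠ 0) ∨
      ∃ a : Fin r → ℤ, a ≠ 0 ∧ ∀ v ∈ V, ∑ i, a i * v i = 0 := by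
  classical
  let cast : (Fin r → ℤ) → (Fin r → ℚ) := fun v i => v i
  by_cases hW : Submodule.span ℚ (cast '' V) = ⊤
  · left
    obtain ⟨b, hbV, hbspan, hbli⟩ := exists_linearIndependent ℚ (cast '' V)
    rw [hW] at hbspan
    let B : Module.Basis b ℚ (Fin r → ℚ) := Module.Basis.mk hbli (by simp [hbspan])
    have hfin : Finite b := Module.Finite.finite_basis B
    have := Fintype.ofFinite b
    have hcard : Fintype.card b = r := by
      rw [← Module.finrank_eq_card_basis B]; simp
    let e : Fin r ≃ b := (Fintype.equivFinOfCardEq hcard).symm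
    have hM : ∀ k, ∃ v ∈ V, cast v = (e k : Fin r → ℚ) := fun k => hbV (e k).2
    choose M hMV hMe using hM
    refine ⟨Matrix.of M, hMV, ?_⟩
    have hli : LinearIndependent ℚ fun k => cast (M k) := by
      have heq : (fun k => cast (M k)) = Subtype.val ∘ e := funext hMe
      rw [heq]
      exact hbli.comp e e.injective
    have hunit : IsUnit ((Matrix.of M).map (Int.castRingHom ℚ)) := by
      rw [← Matrix.linearIndependent_rows_iff_isUnit]
      exact hli
    rw [Matrix.isUnit_iff_isUnit_det, ← RingHom.mapMatrix_apply, ← RingHom.map_det] at hunit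
    intro h0
    rw [h0] at hunit
    simp at hunit
  · right
    obtain ⟨f, hf0, hf⟩ := Submodule.exists_le_ker_of_lt_top _ (lt_top_iff_ne_top.2 hW)
    let c : Fin r → ℚ := fun i => f (Pi.single i 1)
    have hfc : ∀ x, f x = ∑ i, c i * x i := by
      intro x
      rw [LinearMap.pi_apply_eq_sum_univ f x]
      refine Finset.sum_congr rfl fun i _ => ?_
      rw [smul_eq_mul, mul_comm]
      congr 2
      ext j
      simp [Pi.single_apply, eq_comm]
    -- a linear functional over `ℚ` that vanishes on `V`, multiplied by a common denominator
    let N : ℤ := ∏ i, ((c i).den : ℤ)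
    have hN : N ≠ 0 := Finset.prod_ne_zero_iff.2 fun i _ => by exact_mod_cast (c i).den_nz
    have hint : ∀ i, ∃ z : ℤ, (z : ℚ) = N * c i := by
      intro i
      obtain ⟨u, hu⟩ : ((c i).den : ℤ) ∣ N := Finset.dvd_prod_of_mem _ (Finset.mem_univ i)
      refine ⟨u * (c i).num, ?_⟩
      rw [hu]
      push_cast
      have := Rat.den_mul_eq_num (c i)
      rw [← this]
      ring
    choose a ha using hint
    refine ⟨a, fun h0 => hf0 ?_, fun v hv => ?_⟩
    · ext i
      have h1 := ha i
      rw [h0] at h1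
      have h2 : c i = 0 := by simpa [hN] using h1.symm
      simpa [c] using h2
    · have h1 : f (cast v) = 0 := hf (Submodule.subset_span ⟨v, hv, rfl⟩)
      rw [hfc] at h1
      have h2 : ((∑ i, a i * v i : ℤ) : ℚ) = N * ∑ i, c i * cast v i := by
        push_cast
        rw [Finset.mul_sum]
        refine Finset.sum_congr rfl fun i _ => ?_
        rw [ha i, mul_assoc]
      rw [h1, mul_zero] at h2
      exact_mod_cast h2

/-- A common factor of the numerators and the denominator can be removed without loss. -/
theorem exists_coprime_of_approx {r : ℕ} (α : Fin r → ℝ) (a : Fin r → ℤ) (q : ℤ) (hq : 1 ≤ q)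
    {ξ : ℝ} (h : ∀ i, |(q : ℝ) * α i - a i| ≤ ξ) :
    ∃ (a' : Fin r → ℤ) (q' : ℤ), Int.gcd (Finset.univ.gcd a') q' = 1 ∧
      (∀ i, |(q' : ℝ) * α i - a' i| ≤ ξ) ∧ 1 ≤ q' ∧ q' ≤ q := by
  set g : ℕ := Int.gcd (Finset.univ.gcd a) q with hg
  have hg0 : 0 < g := Int.gcd_pos_of_ne_zero_right _ (by omega)
  have hgq : (g : ℤ) ∣ q := Int.gcd_dvd_right _ _
  have hga : ∀ i, (g : ℤ) ∣ a i := fun i =>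
    (Int.gcd_dvd_left _ _).trans (Finset.gcd_dvd (Finset.mem_univ i))
  obtain ⟨q', hq'⟩ := hgq
  choose a' ha' using hga
  have hgz : (0 : ℤ) < g := by exact_mod_cast hg0
  have hq'0 : 1 ≤ q' := by
    by_contra hlt
    have : q' ≤ 0 := by omega
    nlinarith
  refine ⟨a', q', ?_, fun i => ?_, hq'0, by nlinarith⟩
  · have h1 : Finset.univ.gcd a = g * Finset.univ.gcd a' := by
      have : a = fun i => (g : ℤ) * a' i := funext ha'
      rw [this, Finset.gcd_mul_left, Int.normalize_coe_nat]
    have h2 : g = g * Int.gcd (Finset.univ.gcd a') q' := by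
      conv_lhs => rw [hg, h1, hq', Int.gcd_mul_left, Int.natAbs_natCast]
    exact (Nat.eq_of_mul_eq_mul_left hg0 (by rw [mul_one]; exact h2)).symm
  · have h1 := h i
    rw [hq', ha' i] at h1
    push_cast at h1
    rw [mul_assoc, ← mul_sub, abs_mul] at h1
    have h2 : (1 : ℝ) ≤ |(g : ℝ)| := by
      rw [Nat.abs_cast]; exact_mod_cast hg0
    nlinarith [abs_nonneg ((q' : ℝ) * α i - a' i)]

/-- Cramer's rule for a system of `r` linear forms with small integer coefficients whose values
at `α` are all near integers. -/
theorem exists_approx_of_det_ne_zero {ρ : ℕ} (M : Matrix (Fin (ρ + 1)) (Fin (ρ + 1)) ℤ)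
    (hM : M.det ≠ 0) {β δ : ℝ} (hβ : ∀ k i, |(M k i : ℝ)| ≤ β)
    (α : Fin (ρ + 1) → ℝ) (hα : ∀ k, NearInt δ (∑ i, α i * M k i)) :
    ∃ (a : Fin (ρ + 1) → ℤ) (q : ℤ), Int.gcd (Finset.univ.gcd a) q = 1 ∧
      (∀ i, |(q : ℝ) * α i - a i| ≤ (ρ + 1 : ℝ) * (ρ.factorial * β ^ ρ * δ)) ∧
      1 ≤ q ∧ (q : ℝ) ≤ (ρ + 1).factorial * β ^ (ρ + 1) := by
  have hβ0 : 0 ≤ β := (abs_nonneg _).trans (hβ 0 0)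
  choose n hn using hα
  have hdet : ((|M.det| : ℤ) : ℝ) ≤ (ρ + 1).factorial * β ^ (ρ + 1) := by
    have h := Matrix.det_le (A := M.map (Int.castRingHom ℝ)) (abv := AbsoluteValue.abs) (x := β)
      fun i j => hβ i j
    rw [← RingHom.mapMatrix_apply, ← RingHom.map_det, Fintype.card_fin, nsmul_eq_mul] at h
    rw [Int.cast_abs]
    exact h
  have hadj : ∀ i k, |(M.adjugate i k : ℝ)| ≤ ρ.factorial * β ^ ρ := by
    intro i k
    rw [Matrix.adjugate_fin_succ_eq_det_submatrix]
    have h := Matrix.det_le (A := (M.submatrix k.succAbove i.succAbove).map (Int.castRingHom ℝ))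
      (abv := AbsoluteValue.abs) (x := β) fun i j => hβ _ _
    rw [← RingHom.mapMatrix_apply, ← RingHom.map_det, Fintype.card_fin, nsmul_eq_mul] at h
    rw [Int.cast_mul, Int.cast_pow, Int.cast_neg, Int.cast_one, abs_mul, abs_pow, abs_neg, abs_one,
      one_pow, one_mul]
    exact h
  have key : ∀ i, (M.det : ℝ) * α i - ((∑ k, M.adjugate i k * n k : ℤ) : ℝ) =
      ∑ k, (M.adjugate i k : ℝ) * (∑ j, α j * M k j - n k) := by
    intro i
    have h1 : ∀ j, ∑ k, (M.adjugate i k : ℝ) * M k j = if i = j then (M.det : ℝ) else 0 := by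
      intro j
      have := congrFun (congrFun (Matrix.adjugate_mul M) i) j
      rw [Matrix.mul_apply, Matrix.smul_apply, Matrix.one_apply] at this
      have h2 := congrArg (fun z : ℤ => (z : ℝ)) this
      push_cast at h2
      rw [h2]
      split_ifs <;> simp
    simp only [mul_sub, Finset.sum_sub_distrib, Finset.mul_sum]
    have h3 : ∀ j, ∑ k, (M.adjugate i k : ℝ) * (α j * M k j) =
        α j * if i = j then (M.det : ℝ) else 0 := by
      intro j
      rw [← h1, Finset.mul_sum]
      exact Finset.sum_congr rfl fun k _ => by ring
    rw [Finset.sum_comm, Int.cast_sum]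
    simp only [Int.cast_mul, h3, mul_ite, mul_zero, Finset.sum_ite_eq, Finset.mem_univ, if_true]
    rw [mul_comm]
  have happrox : ∀ i, |(M.det : ℝ) * α i - ((∑ k, M.adjugate i k * n k : ℤ) : ℝ)| ≤
      (ρ + 1 : ℝ) * (ρ.factorial * β ^ ρ * δ) := by
    intro i
    rw [key]
    refine (Finset.abs_sum_le_sum_abs _ _).trans ?_
    calc ∑ k, |(M.adjugate i k : ℝ) * (∑ j, α j * M k j - n k)|
        ≤ ∑ _k : Fin (ρ + 1), (ρ.factorial * β ^ ρ * δ) := by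
          refine Finset.sum_le_sum fun k _ => ?_
          rw [abs_mul]
          exact mul_le_mul (hadj i k) (hn k) (abs_nonneg _) (by positivity)
      _ = _ := by simp
  have hone : 1 ≤ |M.det| := Int.one_le_abs hM
  have hsign : ∃ (a : Fin (ρ + 1) → ℤ), ∀ i, |((|M.det| : ℤ) : ℝ) * α i - a i| ≤
      (ρ + 1 : ℝ) * (ρ.factorial * β ^ ρ * δ) := by
    rcases abs_choice M.det with h | h
    · refine ⟨fun i => ∑ k, M.adjugate i k * n k, fun i => ?_⟩
      rw [h]
      exact happrox i
    · refine ⟨fun i => -∑ k, M.adjugate i k * n k, fun i => ?_⟩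
      rw [h, ← abs_neg]
      refine le_trans (le_of_eq ?_) (happrox i)
      congr 1
      push_cast
      ring
  obtain ⟨a, ha⟩ := hsign
  obtain ⟨a', q', h1, h2, h3, h4⟩ := exists_coprime_of_approx α a _ hone ha
  exact ⟨a', q', h1, h2, h3, le_trans (by exact_mod_cast h4) hdet⟩

theorem factorial_mul_symCoeff_eq_intCast {s n : ℕ} (F : MvPolynomial (Fin s) ℤ)
    (J : Fin n → Fin s) : ∃ z : ℤ, (n.factorial : ℚ) * symCoeff F J = z := by
  refine ⟨F.coeff (∑ t, Finsupp.single (J t) 1) *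
    ∏ l : Fin s, (((∑ t, Finsupp.single (J t) 1 : Fin s →₀ ℕ) l).factorial : ℤ), ?_⟩
  have : (n.factorial : ℚ) ≠ 0 := by positivity
  rw [symCoeff, mul_div_cancel₀ _ this]
  push_cast
  rfl

theorem exists_polarForm_eq_intCast {s m : ℕ} (F : MvPolynomial (Fin s) ℤ) (j : Fin s)
    (x : Fin m → Fin s → ℤ) : ∃ z : ℤ, (polarForm (m + 1) F j x : ℝ) = z := by
  choose z hz using fun J : Fin m → Fin s =>
    factorial_mul_symCoeff_eq_intCast F (Fin.cons j J : Fin (m + 1) → Fin s)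
  refine ⟨∑ J : Fin m → Fin s, z J * ∏ t, x t (J t), ?_⟩
  have h : polarForm (m + 1) F j x = ((∑ J : Fin m → Fin s, z J * ∏ t, x t (J t) : ℤ) : ℚ) := by
    push_cast
    simp only [← hz, polarForm, Finset.mul_sum, mul_assoc]
    rfl
  rw [h]
  push_cast
  rfl

/-- If `m = 0` or `s = 0`, the hypothesis leaves `X` unrestricted; the bound then still holds. -/
theorem exists_abs_polarForm_le {s r : ℕ} (m : ℕ) (F : Fin r → MvPolynomial (Fin s) ℤ) :
    ∃ C : ℝ, 1 ≤ C ∧ ∀ (i : Fin r) (j : Fin s) (x : Fin m → Fin s → ℤ) (X : ℝ),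
      (∀ t l, |(x t l : ℝ)| ≤ X) → |(polarForm (m + 1) (F i) j x : ℝ)| ≤ C * X ^ m := by
  let c : Fin r → Fin s → ℝ := fun i j => ((m + 1).factorial : ℝ) * ∑ J : Fin m → Fin s,
    |(symCoeff (F i) (Fin.cons j J : Fin (m + 1) → Fin s) : ℝ)|
  have hc : ∀ i j, 0 ≤ c i j := fun i j => by positivity
  refine ⟨1 + ∑ i, ∑ j, c i j, by
    have : 0 ≤ ∑ i, ∑ j, c i j := Finset.sum_nonneg fun i _ => Finset.sum_nonneg fun j _ => hc i j
    linarith, ?_⟩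
  intro i j x X hX
  have h0 : |(polarForm (m + 1) (F i) j x : ℝ)| ≤ c i j * X ^ m := by
    have e : (polarForm (m + 1) (F i) j x : ℝ) = ((m + 1).factorial : ℝ) *
        ∑ J : Fin m → Fin s, (symCoeff (F i) (Fin.cons j J : Fin (m + 1) → Fin s) : ℝ) *
          ∏ t, (x t (J t) : ℝ) := by
      rw [polarForm]
      push_cast
      rfl
    rw [e, abs_mul, Nat.abs_cast, mul_assoc, Finset.sum_mul]
    gcongr
    refine (Finset.abs_sum_le_sum_abs _ _).trans (Finset.sum_le_sum fun J _ => ?_)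
    rw [abs_mul, Finset.abs_prod]
    gcongr
    calc ∏ t, |(x t (J t) : ℝ)| ≤ ∏ _t : Fin m, X :=
          Finset.prod_le_prod (fun _ _ => abs_nonneg _) fun t _ => hX t _
      _ = X ^ m := by simp
  have h1 : c i j ≤ 1 + ∑ i, ∑ j, c i j := by
    have a1 : c i j ≤ ∑ j, c i j := Finset.single_le_sum (fun j _ => hc i j) (Finset.mem_univ j)
    have a2 : ∑ j, c i j ≤ ∑ i, ∑ j, c i j :=
      Finset.single_le_sum (f := fun i => ∑ j, c i j)
        (fun i _ => Finset.sum_nonneg fun j _ => hc i j) (Finset.mem_univ i)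
    linarith
  rcases Nat.eq_zero_or_pos m with rfl | hm
  · simp only [pow_zero, mul_one] at *
    linarith
  · have hX0 : 0 ≤ X ^ m := by
      rcases Nat.eq_zero_or_pos s with rfl | hs
      · exact j.elim0
      · exact pow_nonneg ((abs_nonneg _).trans (hX ⟨0, hm⟩ ⟨0, hs⟩)) _
    exact h0.trans (by gcongr)

/-! ### Boxes and their smoothing -/

theorem abs_prod_sub_prod_le_sum {ι : Type*} (S : Finset ι) (f g : ι → ℝ)
    (hf : ∀ i, 0 ≤ f i) (hf1 : ∀ i, f i ≤ 1) (hg : ∀ i, 0 ≤ g i) (hg1 : ∀ i, g i ≤ 1) :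
    |∏ i ∈ S, f i - ∏ i ∈ S, g i| ≤ ∑ i ∈ S, |f i - g i| := by
  classical
  induction S using Finset.induction_on with
  | empty => simp
  | insert a S ha ih =>
    rw [Finset.prod_insert ha, Finset.prod_insert ha, Finset.sum_insert ha,
      show f a * ∏ i ∈ S, f i - g a * ∏ i ∈ S, g i =
        (f a - g a) * ∏ i ∈ S, f i + g a * (∏ i ∈ S, f i - ∏ i ∈ S, g i) by ring]
    refine (abs_add_le _ _).trans (add_le_add ?_ ?_)
    · rw [abs_mul, abs_of_nonneg (Finset.prod_nonneg fun i _ => hf i)]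
      exact mul_le_of_le_one_right (abs_nonneg _)
        (Finset.prod_le_one (fun i _ => hf i) fun i _ => hf1 i)
    · rw [abs_mul, abs_of_nonneg (hg a)]
      exact (mul_le_of_le_one_left (abs_nonneg _) (hg1 a)).trans ih

/-- The integers in a set of real numbers that is order-connected and bounded form an interval; if
there are none, this is recorded by the empty interval `[1, 0]`. -/
theorem exists_int_interval {I : Set ℝ} (hI : I.OrdConnected) {R : ℝ} (hR : 0 ≤ R)
    (hIR : ∀ y ∈ I, |y| ≤ R) : ∃ p q : ℤ, (∀ x : ℤ, (x : ℝ) ∈ I ↔ p ≤ x ∧ x ≤ q) ∧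
      -R ≤ p ∧ (q : ℝ) ≤ R := by
  by_cases hne : ∃ x : ℤ, (x : ℝ) ∈ I
  · have hb : ∀ x : ℤ, (x : ℝ) ∈ I → -⌈R⌉ ≤ x ∧ x ≤ ⌈R⌉ := by
      intro x hx
      have h1 := (hIR x hx).trans (Int.le_ceil R)
      have h2 : |x| ≤ ⌈R⌉ := by exact_mod_cast h1
      exact abs_le.1 h2
    obtain ⟨p, hp, hp'⟩ := Int.exists_least_of_bdd (P := fun x : ℤ => (x : ℝ) ∈ I)
      ⟨_, fun x hx => (hb x hx).1⟩ hne
    obtain ⟨q, hq, hq'⟩ := Int.exists_greatest_of_bdd (P := fun x : ℤ => (x : ℝ) ∈ I)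
      ⟨_, fun x hx => (hb x hx).2⟩ hne
    refine ⟨p, q, fun x => ⟨fun hx => ⟨hp' x hx, hq' x hx⟩, fun hx => hI.out hp hq ?_⟩,
      (abs_le.1 (hIR p hp)).1, (abs_le.1 (hIR q hq)).2⟩
    exact ⟨by exact_mod_cast hx.1, by exact_mod_cast hx.2⟩
  · refine ⟨1, 0, fun x => ⟨fun hx => absurd ⟨x, hx⟩ hne, fun hx => by omega⟩, ?_, ?_⟩
    · push_cast; linarith
    · push_cast; exact hR

theorem exists_latticePoints_eq {s : ℕ} {B : Set (Fin s → ℝ)} (hB : IsBox B) :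
    ∃ A : ℝ, 1 ≤ A ∧ ∀ P : ℝ, 1 ≤ P → ∃ p q : Fin s → ℤ,
      (∀ l, -(A * P) ≤ p l ∧ (q l : ℝ) ≤ A * P) ∧
      ∀ x, x ∈ latticePoints B P ↔ ∀ l, p l ≤ x l ∧ x l ≤ q l := by
  obtain ⟨I, hI, rfl⟩ := hB
  have hb : ∀ l, ∃ R : ℝ, ∀ y ∈ I l, |y| ≤ R := fun l => by
    obtain ⟨R, hR⟩ := (hI l).2.exists_norm_le
    exact ⟨R, fun y hy => by simpa using hR y hy⟩
  choose R hR using hb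
  have hA : ∀ l, R l ≤ 1 + ∑ l, |R l| := fun l => by
    have := Finset.single_le_sum (f := fun l => |R l|) (fun i _ => abs_nonneg _) (Finset.mem_univ l)
    linarith [le_abs_self (R l)]
  have hA1 : 1 ≤ 1 + ∑ l, |R l| := by
    have : 0 ≤ ∑ l, |R l| := Finset.sum_nonneg fun _ _ => abs_nonneg _
    linarith
  refine ⟨1 + ∑ l, |R l|, hA1, fun P hP => ?_⟩
  have hP0 : 0 < P := by linarith
  have hint : ∀ l, ∃ p q : ℤ, (∀ x : ℤ, (x : ℝ) ∈ (fun b => b / P) ⁻¹' I l ↔ p ≤ x ∧ x ≤ q) ∧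
      -((1 + ∑ l, |R l|) * P) ≤ p ∧ (q : ℝ) ≤ (1 + ∑ l, |R l|) * P := by
    intro l
    refine exists_int_interval ?_ (by positivity) ?_
    · exact (hI l).1.preimage_mono fun x y hxy =>
        div_le_div_of_nonneg_right hxy hP0.le
    · intro y hy
      have h1 := (hR l _ hy).trans (hA l)
      rwa [abs_div, abs_of_pos hP0, div_le_iff₀ hP0] at h1
  choose p q hpq hp hq using hint
  refine ⟨p, q, fun l => ⟨hp l, hq l⟩, fun x => ?_⟩
  constructor
  · rintro ⟨b, hb, hx⟩ l
    rw [← hpq, Set.mem_preimage, hx l, mul_div_cancel_left₀ _ hP0.ne']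
    exact hb l (Set.mem_univ l)
  · intro h
    refine ⟨fun l => x l / P, fun l _ => (hpq l (x l)).2 (h l), fun l => ?_⟩
    field_simp

theorem expSum_eq_sum_intervalInd {s r : ℕ} (F : Fin r → MvPolynomial (Fin s) ℤ)
    (α : Fin r → ℝ) {B : Set (Fin s → ℝ)} {P : ℝ} {p q : Fin s → ℤ} {T : ℕ}
    (hpT : ∀ l, -(T : ℤ) ≤ p l) (hqT : ∀ l, q l ≤ T)
    (h : ∀ x, x ∈ latticePoints B P ↔ ∀ l, p l ≤ x l ∧ x l ≤ q l) :
    expSum F B P α = ∑ x ∈ intBox s T, ((∏ l, intervalInd (p l) (q l) (x l) : ℝ) : ℂ) *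
      unitExp (∑ i, α i * ((MvPolynomial.eval x (F i) : ℤ) : ℝ)) := by
  classical
  have hset : latticePoints B P =
      ((intBox s T).filter fun x => ∀ l, p l ≤ x l ∧ x l ≤ q l : Finset (Fin s → ℤ)) := by
    ext x
    rw [h, Finset.mem_coe, Finset.mem_filter, mem_intBox]
    refine ⟨fun hx => ⟨fun l => ?_, hx⟩, fun hx => hx.2⟩
    rw [abs_le]
    exact ⟨(hpT l).trans (hx l).1, (hx l).2.trans (hqT l)⟩
  rw [expSum, hset, finsum_mem_coe_finset, Finset.sum_filter]
  refine Finset.sum_congr rfl fun x _ => ?_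
  split_ifs with hx
  · rw [Finset.prod_eq_one fun l _ => by rw [intervalInd, if_pos (hx l)], Complex.ofReal_one,
      one_mul]
    rfl
  · push Not at hx
    obtain ⟨l, hl⟩ := hx
    rw [Finset.prod_eq_zero (Finset.mem_univ l), Complex.ofReal_zero, zero_mul]
    rw [intervalInd, if_neg]
    intro h'
    exact absurd (hl h'.1) (not_lt.2 h'.2)

theorem norm_sum_intervalInd_sub_sum_trapezoid_le {s : ℕ} (p q : Fin s → ℤ) (T : ℕ) {L : ℕ}
    (hL : 0 < L) (f : (Fin s → ℤ) → ℝ) :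
    ‖∑ x ∈ intBox s T, ((∏ l, intervalInd (p l) (q l) (x l) : ℝ) : ℂ) * unitExp (f x) -
      ∑ x ∈ intBox s T, ((∏ l, trapezoid (p l) (q l) L (x l) : ℝ) : ℂ) * unitExp (f x)‖ ≤
      s * ((2 * T + 1 : ℝ) ^ (s - 1) * (2 * (L - 1 : ℕ))) := by
  rw [← Finset.sum_sub_distrib]
  calc _ ≤ ∑ x ∈ intBox s T, ∑ l,
        |intervalInd (p l) (q l) (x l) - trapezoid (p l) (q l) L (x l)| := by
        refine norm_sum_le_of_le _ fun x _ => ?_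
        rw [← sub_mul, norm_mul, norm_unitExp, mul_one, ← Complex.ofReal_sub, Complex.norm_real,
          Real.norm_eq_abs]
        exact abs_prod_sub_prod_le_sum _ _ _ (fun _ => intervalInd_nonneg _ _ _)
          (fun _ => intervalInd_le_one _ _ _) (fun _ => trapezoid_nonneg _ _ _ _)
          fun _ => trapezoid_le_one _ _ _ _
    _ = ∑ l, ∑ x ∈ intBox s T,
        |intervalInd (p l) (q l) (x l) - trapezoid (p l) (q l) L (x l)| := Finset.sum_comm
    _ ≤ ∑ _l : Fin s, ((2 * T + 1 : ℝ) ^ (s - 1) * (2 * (L - 1 : ℕ))) := by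
        refine Finset.sum_le_sum fun l _ => ?_
        have hc : ((T : ℤ) + 1 - -(T : ℤ)).toNat = 2 * T + 1 := by omega
        have h1 := Fintype.sum_piFinset_apply
          (fun y => |intervalInd (p l) (q l) y - trapezoid (p l) (q l) L y|)
          (Finset.Icc (-(T : ℤ)) T) l
        rw [Int.card_Icc, hc, Fintype.card_fin, nsmul_eq_mul] at h1
        rw [intBox, h1]
        push_cast
        gcongr
        exact sum_abs_intervalInd_sub_trapezoid_le _ _ hL _
    _ = _ := by simp

/-- An exponential sum that exceeds `P^{s-k}` stays large when its box is smoothed on a scale `L` of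
about `P^{1-k}`; the ratio of the size `T` of the box to this scale is only `P^k`. -/
theorem exists_le_norm_sum_trapezoid {s r : ℕ} (F : Fin r → MvPolynomial (Fin s) ℤ)
    {B : Set (Fin s → ℝ)} (hB : IsBox B) :
    ∃ A D : ℝ, 1 ≤ A ∧ 1 ≤ D ∧ ∀ (α : Fin r → ℝ) (k P : ℝ), 0 < k → 1 ≤ P →
      P ^ ((s : ℝ) - k) < ‖expSum F B P α‖ →
      ∃ (T L : ℕ) (p q : Fin s → ℤ), 3 ≤ T ∧ P ≤ T ∧ (T : ℝ) ≤ A * P ∧ 0 < L ∧ (L : ℝ) ≤ T ∧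
        (T : ℝ) / L ≤ D * P ^ k ∧ (∀ l, -(T : ℤ) ≤ p l) ∧ (∀ l, q l + L ≤ T) ∧
        P ^ ((s : ℝ) - k) / 2 ≤
          ‖∑ x ∈ intBox s T, ((∏ l, trapezoid (p l) (q l) L (x l) : ℝ) : ℂ) *
            unitExp (∑ i, α i * ((MvPolynomial.eval x (F i) : ℤ) : ℝ))‖ := by
  obtain ⟨A₀, hA₀, hbox⟩ := exists_latticePoints_eq hB
  set A : ℝ := A₀ + 4 with hA
  set E₀ : ℝ := 2 * s * (3 * A) ^ s with hE₀
  have hE₀0 : 0 ≤ E₀ := by positivity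
  refine ⟨A, 2 * A * (2 * E₀ + 2), by linarith, by nlinarith, ?_⟩
  intro α k P hk hP hS
  have hP0 : 0 < P := by linarith
  obtain ⟨p, q, hpq, hlat⟩ := hbox P hP
  set T : ℕ := ⌈(A₀ + 1) * P⌉₊ + 2 with hT
  have hT1 : (A₀ + 1) * P + 2 ≤ T := by
    rw [hT]; push_cast; linarith [Nat.le_ceil ((A₀ + 1) * P)]
  have hT2 : (T : ℝ) ≤ A * P := by
    have := Nat.ceil_lt_add_one (show 0 ≤ (A₀ + 1) * P by positivity)
    rw [hT, hA]; push_cast; nlinarith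
  have hTR : (3 : ℝ) ≤ T := by nlinarith
  have hT3 : 3 ≤ T := by exact_mod_cast hTR
  have hPT : P ≤ T := by nlinarith
  -- the smoothing error is at most `E₀ δ P ^ s`, hence at most half of `P ^ (s - k)`
  set δ : ℝ := P ^ (-k) / (2 * E₀ + 2) with hδ
  have hPk : P ^ (-k) ≤ 1 := Real.rpow_le_one_of_one_le_of_nonpos hP (by linarith)
  have hPk0 : 0 < P ^ (-k) := Real.rpow_pos_of_pos hP0 _
  have hδ0 : 0 < δ := by positivity
  have hδ1 : δ ≤ 1 := by
    rw [hδ, div_le_one (by positivity)]; linarith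
  -- for `L = 1` the trapezoid is the indicator function itself, and there is no error
  set L : ℕ := max 1 ⌊δ * P⌋₊ with hL
  have hL0 : 0 < L := lt_of_lt_of_le one_pos (le_max_left _ _)
  have hL0' : (0 : ℝ) < L := by exact_mod_cast hL0
  have hfl : (⌊δ * P⌋₊ : ℝ) ≤ δ * P := Nat.floor_le (by positivity)
  have hLP : (L : ℝ) ≤ P := by
    rw [hL, Nat.cast_max, Nat.cast_one]
    exact max_le hP (hfl.trans (by nlinarith))
  have hL1 : ((L - 1 : ℕ) : ℝ) ≤ δ * P := by
    refine le_trans ?_ hfl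
    exact_mod_cast (show L - 1 ≤ ⌊δ * P⌋₊ by omega)
  have hL2 : δ * P / 2 ≤ L := by
    have h1 : (1 : ℝ) ≤ L := by exact_mod_cast hL0
    have h2 : (⌊δ * P⌋₊ : ℝ) ≤ L := by exact_mod_cast le_max_right _ _
    linarith [Nat.lt_floor_add_one (δ * P)]
  have hpT : ∀ l, -(T : ℤ) ≤ p l := fun l => by
    have h1 := (hpq l).1
    have h2 : -(T : ℝ) ≤ p l := by nlinarith
    exact_mod_cast h2
  have hqT : ∀ l, q l + L ≤ T := fun l => by
    have h1 := (hpq l).2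
    have h2 : (q l : ℝ) + L ≤ T := by nlinarith
    exact_mod_cast h2
  refine ⟨T, L, p, q, hT3, hPT, hT2, hL0, hLP.trans hPT, ?_, hpT, hqT, ?_⟩
  · rw [div_le_iff₀ hL0']
    have h2 : 2 * A * (2 * E₀ + 2) * P ^ k * (δ * P / 2) = A * P := by
      have h3 : P ^ k * P ^ (-k) = 1 := by rw [← Real.rpow_add hP0]; simp
      calc 2 * A * (2 * E₀ + 2) * P ^ k * (δ * P / 2) = (P ^ k * P ^ (-k)) * (A * P) := by
            rw [hδ]; field_simp
        _ = A * P := by rw [h3, one_mul]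
    have h4 : 0 ≤ 2 * A * (2 * E₀ + 2) * P ^ k := by positivity
    exact hT2.trans (h2.symm.le.trans (mul_le_mul_of_nonneg_left hL2 h4))
  have h1 := norm_sum_intervalInd_sub_sum_trapezoid_le p q T hL0
    fun x => ∑ i, α i * ((MvPolynomial.eval x (F i) : ℤ) : ℝ)
  rw [← expSum_eq_sum_intervalInd F α hpT (fun l => by have := hqT l; omega) hlat] at h1
  have h2 : (s : ℝ) * ((2 * T + 1 : ℝ) ^ (s - 1) * (2 * (L - 1 : ℕ))) ≤
      P ^ ((s : ℝ) - k) / 2 := by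
    rcases Nat.eq_zero_or_pos s with rfl | hs
    · rw [Nat.cast_zero, zero_mul]; positivity
    · have hPs : P ^ (s - 1) * P = P ^ s := by rw [← pow_succ]; congr 1; omega
      calc (s : ℝ) * ((2 * T + 1 : ℝ) ^ (s - 1) * (2 * (L - 1 : ℕ)))
          ≤ s * ((3 * A * P) ^ (s - 1) * (2 * (δ * P))) := by
            gcongr
            linarith
        _ = 2 * s * (3 * A) ^ (s - 1) * δ * (P ^ (s - 1) * P) := by rw [mul_pow (3 * A)]; ring
        _ ≤ 2 * s * (3 * A) ^ s * δ * P ^ s := by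
            rw [hPs]
            gcongr
            · linarith
            · omega
        _ = E₀ / (2 * E₀ + 2) * (P ^ s * P ^ (-k)) := by rw [hδ, ← hE₀]; ring
        _ ≤ 1 / 2 * (P ^ s * P ^ (-k)) := by
            refine mul_le_mul_of_nonneg_right ?_ (by positivity)
            rw [div_le_div_iff₀ (by positivity) (by positivity)]
            linarith
        _ = P ^ ((s : ℝ) - k) / 2 := by
            rw [sub_eq_add_neg, Real.rpow_add hP0, Real.rpow_natCast]; ring
  have h3 := (norm_sub_norm_le _ _).trans (h1.trans h2)
  linarith

theorem rpow_sub_pow_eq {P : ℝ} (hP : 0 < P) (k η : ℝ) {s m e M : ℕ} (h : e + 1 + m = M) :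
    (P ^ ((s : ℝ) - k)) ^ M =
      P ^ ((s : ℝ) * m - M * k - k * η * s) * ((P ^ s) ^ e * (P ^ s * (P ^ (k * η)) ^ s)) := by
  rw [← pow_mul, ← Real.rpow_natCast (P ^ ((s : ℝ) - k)), ← Real.rpow_natCast P (s * e),
    ← Real.rpow_natCast P s, ← Real.rpow_natCast (P ^ (k * η)), ← Real.rpow_mul hP.le,
    ← Real.rpow_mul hP.le, ← Real.rpow_add hP, ← Real.rpow_add hP, ← Real.rpow_add hP, ← h]
  congr 1
  push_cast
  ring

/-- If the exponential sum exceeds `P^{s-k}`, then the polar forms have many simultaneous near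
integer values. -/
theorem exists_le_ncard_nearTuples {s r n : ℕ} (F : Fin r → MvPolynomial (Fin s) ℤ)
    (hF : ∀ i, (F i).IsHomogeneous (n + 2)) {B : Set (Fin s → ℝ)} (hB : IsBox B) {η : ℝ}
    (hη : 0 < η) (hη1 : η ≤ 1) :
    ∃ A c : ℝ, 1 ≤ A ∧ 0 < c ∧ ∀ (α : Fin r → ℝ) (k P : ℝ), 0 < k → 1 ≤ P →
      P ^ ((s : ℝ) - k) < ‖expSum F B P α‖ → ∃ T : ℕ, 3 ≤ T ∧ P ≤ T ∧ (T : ℝ) ≤ A * P ∧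
        c * P ^ ((s : ℝ) * (n + 1 : ℕ) - (2 ^ (n + 1) : ℕ) * k - k * η * s) ≤
          (nearTuples (fun (x : Fin (n + 1) → Fin s → ℤ) j => pencilForm (n + 2) F α j x)
            (fun _ => 4 * T) (1 / T)).ncard := by
  obtain ⟨A, D₀, hA, hD₀, hsmooth⟩ := exists_le_norm_sum_trapezoid F hB
  set Z : ℝ := ∑' r, decay η r with hZ
  have hZ1 : 0 < Z := by
    have h0 : decay η 0 = 1 := by simp [decay]
    have := (summable_decay hη).sum_le_tsum (Finset.range 1) fun r _ => decay_nonneg η r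
    rw [Finset.sum_range_one, h0] at this
    linarith
  have hM : n + 1 < 2 ^ (n + 1) := Nat.lt_two_pow_self
  obtain ⟨M, hMdef⟩ : ∃ M, M = 2 ^ (n + 1) := ⟨_, rfl⟩
  obtain ⟨e, he⟩ : ∃ e, e = M - (n + 1) - 1 := ⟨_, rfl⟩
  have heM : e + 1 + (n + 1) = M := by omega
  have hM0 : 0 < M := by omega
  set b₀ : ℝ := 3 * (M : ℝ) ^ 2 with hb₀
  set K₁ : ℝ := ((5 * A) ^ s) ^ e * ((b₀ * A * D₀) ^ s * (2 * Z) ^ s) with hK₁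
  have hK₁0 : 0 < K₁ := by positivity
  refine ⟨A, (K₁ * 2 ^ M)⁻¹, hA, by positivity, ?_⟩
  intro α k P hk hP hS
  have hP0 : 0 < P := by linarith
  obtain ⟨T, L, p, q, hT3, hPT, hT2, hL0, hLT, hTL, hpT, hqT, hlarge⟩ := hsmooth α k P hk hP hS
  have hT1 : (1 : ℝ) ≤ T := by exact_mod_cast (by omega : 1 ≤ T)
  have hL0' : (0 : ℝ) < L := by exact_mod_cast hL0
  have hweyl := norm_weighted_sum_pow_le F hF α (T := T) (by omega) hL0' hLT hη hη1
    (fun l => trapezoid (p l) (q l) L) (fun l => tameWeight_trapezoid _ _ hL0) (by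
      intro l x hx
      rw [Finset.mem_Icc] at hx
      have h1 := hpT l
      have h2 := hqT l
      exact trapezoid_eq_zero (by omega))
  have hMR : (2 : ℝ) ^ (n + 1) = M := by rw [hMdef]; push_cast; rfl
  rw [hMR, ← hMdef, ← he, ← hb₀, ← hZ] at hweyl
  rw [← hMdef]
  refine ⟨T, hT3, hPT, hT2, ?_⟩
  set N : ℝ := ((nearTuples (fun (x : Fin (n + 1) → Fin s → ℤ) j =>
    pencilForm (n + 2) F α j x) (fun _ => 4 * (T : ℝ)) (1 / (T : ℝ))).ncard : ℝ) with hN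
  have hN0 : 0 ≤ N := Nat.cast_nonneg _
  have hD : ((T : ℝ) / L) ^ η ≤ D₀ * P ^ (k * η) := by
    calc ((T : ℝ) / L) ^ η ≤ (D₀ * P ^ k) ^ η := by gcongr
      _ = D₀ ^ η * P ^ (k * η) := by
          rw [Real.mul_rpow (by positivity) (by positivity), ← Real.rpow_mul hP0.le]
      _ ≤ D₀ ^ (1 : ℝ) * P ^ (k * η) := by gcongr
      _ = D₀ * P ^ (k * η) := by rw [Real.rpow_one]
  obtain ⟨G, hG⟩ : ∃ G, G = (P ^ s) ^ e * (P ^ s * (P ^ (k * η)) ^ s) := ⟨_, rfl⟩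
  have hG0 : 0 < G := by rw [hG]; positivity
  have hmain : (P ^ ((s : ℝ) - k) / 2) ^ M ≤ K₁ * G * N := by
    calc (P ^ ((s : ℝ) - k) / 2) ^ M ≤ _ :=
          pow_le_pow_left₀ (by positivity) hlarge M
      _ ≤ _ := hweyl
      _ ≤ ((5 * A * P) ^ s) ^ e * ((b₀ * (A * P) * (D₀ * P ^ (k * η))) ^ s *
            ((2 * Z) ^ s * N)) := by
          gcongr
          linarith
      _ = _ := by
          rw [hK₁, hG, mul_pow (5 * A) P s, mul_pow _ (P ^ s) e,
            show b₀ * (A * P) * (D₀ * P ^ (k * η)) = (b₀ * A * D₀) * (P * P ^ (k * η)) by ring,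
            mul_pow _ (P * P ^ (k * η)) s, mul_pow P _ s]
          ring
  rw [div_pow, rpow_sub_pow_eq hP0 k η heM, ← hG, div_le_iff₀ (by positivity)] at hmain
  rw [inv_mul_le_iff₀ (by positivity)]
  refine le_of_mul_le_mul_right (hmain.trans (le_of_eq ?_)) hG0
  ring

/-! ### The dichotomy -/

theorem exists_cube_subset {s : ℕ} {B : Set (Fin s → ℝ)} (h : (0 : Fin s → ℝ) ∈ interior B) :
    ∃ b : ℝ, 0 < b ∧ b ≤ 1 ∧ ∀ x : Fin s → ℝ, (∀ l, |x l| ≤ b) → x ∈ B := by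
  rw [mem_interior_iff_mem_nhds, Metric.nhds_basis_closedBall.mem_iff] at h
  obtain ⟨b, hb, hbB⟩ := h
  refine ⟨min b 1, lt_min hb one_pos, min_le_right _ _, fun x hx => hbB ?_⟩
  rw [mem_closedBall_zero_iff, pi_norm_le_iff_of_nonneg hb.le]
  exact fun l => (hx l).trans (min_le_left _ _)

theorem mem_latticePoints_of_abs_le {s : ℕ} {B : Set (Fin s → ℝ)} {b H : ℝ} (hH : 0 < H)
    (hB : ∀ x : Fin s → ℝ, (∀ l, |x l| ≤ b) → x ∈ B) {x : Fin s → ℤ}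
    (hx : ∀ l, |(x l : ℝ)| ≤ b * H) : x ∈ latticePoints B H := by
  refine ⟨fun l => x l / H, hB _ fun l => ?_, fun l => ?_⟩
  · rw [abs_div, abs_of_pos hH, div_le_iff₀ hH]
    exact hx l
  · field_simp

theorem ncard_le_zeroCount {s r m : ℕ} (F : Fin r → MvPolynomial (Fin s) ℤ) {B : Set (Fin s → ℝ)}
    (hB : IsBox B) (a : Fin r → ℤ) (H : ℝ) (S : Set (Fin m → Fin s → ℤ))
    (hS : ∀ x ∈ S, (∀ t, x t ∈ latticePoints B H) ∧
      ∀ j, pencilForm (m + 1) F (fun i => (a i : ℝ)) j x = 0) :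
    S.ncard ≤ zeroCount (m + 1) F B a H := by
  refine Set.ncard_le_ncard (t := {x : Fin m → Fin s → ℤ | (∀ t, x t ∈ latticePoints B H) ∧
    ∀ j, pencilForm (m + 1) F (fun i => (a i : ℝ)) j x = 0}) hS ?_
  have h : (Set.univ.pi fun _ : Fin m => latticePoints B H).Finite :=
    Set.Finite.pi fun _ => latticePoints_finite hB H
  exact h.subset fun x hx t _ => hx.1 t

theorem one_le_zeroCount {s r n : ℕ} (F : Fin r → MvPolynomial (Fin s) ℤ) {B : Set (Fin s → ℝ)}
    (hB : IsBox B) (h0 : (0 : Fin s → ℝ) ∈ B) (a : Fin r → ℤ) (H : ℝ) :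
    1 ≤ zeroCount (n + 2) F B a H := by
  rw [← Set.ncard_singleton (0 : Fin (n + 1) → Fin s → ℤ)]
  refine ncard_le_zeroCount F hB a H _ ?_
  rintro x rfl
  refine ⟨fun t => ⟨0, h0, fun l => by simp⟩, fun j => ?_⟩
  have h : ∀ i, polarForm (n + 2) (F i) j (0 : Fin (n + 1) → Fin s → ℤ) = 0 := by
    intro i
    have h1 : ∀ J : Fin (n + 1) → Fin s,
        ∏ t, (((0 : Fin (n + 1) → Fin s → ℤ) t (J t) : ℤ) : ℚ) = 0 := fun J =>
      Finset.prod_eq_zero (Finset.mem_univ 0) (by simp)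
    rw [polarForm]
    refine mul_eq_zero_of_right _ (Finset.sum_eq_zero fun J _ => ?_)
    exact mul_eq_zero_of_right _ (h1 J)
  exact Finset.sum_eq_zero fun i _ => by
    rw [show polarForm (n + 1 + 1) (F i) j (0 : Fin (n + 1) → Fin s → ℤ) = 0 from h i]; simp

/-- Either the values of the polar forms at the points of `S` determine a good rational
approximation to `α`, or they all vanish on one nontrivial integral combination of the forms. -/
theorem exists_approx_or_forall_pencilForm_eq_zero {s ρ m : ℕ}
    (F : Fin (ρ + 1) → MvPolynomial (Fin s) ℤ) (α : Fin (ρ + 1) → ℝ)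
    (S : Set (Fin m → Fin s → ℤ)) {β δ : ℝ}
    (hβ : ∀ x ∈ S, ∀ i j, |(polarForm (m + 1) (F i) j x : ℝ)| ≤ β)
    (hδ : ∀ x ∈ S, ∀ j, NearInt δ (pencilForm (m + 1) F α j x)) :
    (∃ (a : Fin (ρ + 1) → ℤ) (q : ℤ), Int.gcd (Finset.univ.gcd a) q = 1 ∧
      (∀ i, |(q : ℝ) * α i - a i| ≤ (ρ + 1 : ℝ) * (ρ.factorial * β ^ ρ * δ)) ∧
      1 ≤ q ∧ (q : ℝ) ≤ (ρ + 1).factorial * β ^ (ρ + 1)) ∨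
    ∃ a : Fin (ρ + 1) → ℤ, a ≠ 0 ∧
      ∀ x ∈ S, ∀ j, pencilForm (m + 1) F (fun i => (a i : ℝ)) j x = 0 := by
  rcases exists_det_ne_zero_or_exists_orthogonal
    {v : Fin (ρ + 1) → ℤ | ∃ x ∈ S, ∃ j, ∀ i, (polarForm (m + 1) (F i) j x : ℝ) = v i} with
    ⟨M, hM, hdet⟩ | ⟨a, ha, horth⟩
  · left
    refine exists_approx_of_det_ne_zero M hdet (fun k i => ?_) α fun k => ?_
    · obtain ⟨x, hx, j, hv⟩ := hM k
      rw [← hv i]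
      exact hβ x hx i j
    · obtain ⟨x, hx, j, hv⟩ := hM k
      have := hδ x hx j
      simpa only [pencilForm, hv] using this
  · right
    refine ⟨a, ha, fun x hx j => ?_⟩
    choose z hz using fun i => exists_polarForm_eq_intCast (F i) j x
    have h1 := horth z ⟨x, hx, j, hz⟩
    simp only [pencilForm, hz]
    exact_mod_cast h1

theorem rpow_mul_sub_eq {P θ : ℝ} (hP : 0 < P) (hθ : 0 < θ) (m s M k ε : ℝ) :
    (P ^ θ) ^ (m * s - M * k / θ - ε) = P ^ ((θ - 1) * (s * m) + (s * m - M * k - θ * ε)) := by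
  rw [← Real.rpow_mul hP.le]
  congr 1
  field_simp
  ring

/-- The count of near integer values after all vectors have been shrunk to the size `P^θ`. -/
theorem exists_le_ncard_nearTuples_shrunk {s r n : ℕ} (F : Fin r → MvPolynomial (Fin s) ℤ)
    (hF : ∀ i, (F i).IsHomogeneous (n + 2)) {B : Set (Fin s → ℝ)} (hB : IsBox B) {ε b : ℝ}
    (hε : 0 < ε) (hb : 0 < b) (hb1 : b ≤ 1) :
    ∃ c : ℝ, 0 < c ∧ ∀ (α : Fin r → ℝ) (θ k P : ℝ), 0 < θ → θ ≤ 1 → 0 < k → 1 ≤ P →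
      1 ≤ b * P ^ θ → (2 ^ (n + 1) : ℕ) * k ≤ θ * ((n + 1 : ℕ) * s) →
      P ^ ((s : ℝ) - k) < ‖expSum F B P α‖ → ∃ δ : ℝ, 0 < δ ∧
        δ ≤ (P ^ (θ - 1)) ^ (n + 1) * P⁻¹ ∧
        c * (P ^ θ) ^ (((n + 1 : ℕ) : ℝ) * s - (2 ^ (n + 1) : ℕ) * k / θ - ε) ≤
          (nearTuples (fun (x : Fin (n + 1) → Fin s → ℤ) j => pencilForm (n + 2) F α j x)
            (fun _ => b * P ^ θ) δ).ncard := by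
  -- with `k ≤ θ (n + 1) s` this makes the loss `P ^ (k η s)` at most `P ^ (θ ε)`
  set η : ℝ := min 1 (ε / ((n + 1 : ℕ) * s * s + 1)) with hη
  have hden : (0 : ℝ) < (n + 1 : ℕ) * s * s + 1 := by positivity
  have hη0 : 0 < η := lt_min one_pos (by positivity)
  obtain ⟨A, c, hA, hc, hcount⟩ := exists_le_ncard_nearTuples F hF hB hη0 (min_le_left _ _)
  obtain ⟨C, hC, hshrink⟩ := exists_ncard_nearTuples_shrink s n
  refine ⟨c * ((b / (4 * A)) ^ s) ^ (n + 1) / C, by positivity, ?_⟩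
  intro α θ k P hθ hθ1 hk hP hbP hkθ hS
  have hP0 : 0 < P := by linarith
  obtain ⟨T, hT3, hPT, hTA, hN⟩ := hcount α k P hk hP hS
  have hT3' : (3 : ℝ) ≤ T := by exact_mod_cast hT3
  have hT0 : (0 : ℝ) < T := by linarith
  set z : ℝ := b * P ^ θ / (4 * T) with hz
  have hPθ : P ^ θ ≤ P := by
    conv_rhs => rw [← Real.rpow_one P]
    exact Real.rpow_le_rpow_of_exponent_le hP hθ1
  have hPθ0 : 0 < P ^ θ := Real.rpow_pos_of_pos hP0 _
  have hbPθ : b * P ^ θ ≤ P ^ θ := mul_le_of_le_one_left hPθ0.le hb1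
  have hz0 : 0 < z := by positivity
  have hz1 : z ≤ 1 := by
    rw [hz, div_le_one (by positivity)]; linarith
  have hzT : z * (4 * T) = b * P ^ θ := by rw [hz]; field_simp
  have hsub : P ^ (θ - 1) = P ^ θ / P := Real.rpow_sub_one hP0.ne' θ
  have hzup : z ≤ P ^ (θ - 1) := by
    rw [hz, hsub]
    gcongr
    linarith
  have hzlow : b / (4 * A) * P ^ (θ - 1) ≤ z := by
    rw [hz, hsub]
    calc b / (4 * A) * (P ^ θ / P) = b * P ^ θ / (4 * (A * P)) := by field_simp
      _ ≤ _ := by gcongr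
  have h1 := hshrink _ (isSymmSystem_pencilForm F α) (4 * T) (1 / T) z (by linarith)
    (by positivity) (by rw [div_lt_div_iff₀ hT0 two_pos]; linarith)
    (by rw [mul_one_div, mul_div_assoc, div_self hT0.ne']; norm_num) hz0 hz1
    (by rw [hzT]; exact hbP)
  rw [hzT] at h1
  refine ⟨z ^ (n + 1) * (1 / T), by positivity, ?_, ?_⟩
  · rw [← one_div]
    gcongr
  have hηε : k * η * s ≤ θ * ε := by
    have h2 : η * ((n + 1 : ℕ) * s * s + 1) ≤ ε := by
      rw [← le_div_iff₀ hden]; exact min_le_right _ _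
    have h3 : k ≤ θ * ((n + 1 : ℕ) * s) := by
      refine le_trans ?_ hkθ
      have : (1 : ℝ) ≤ (2 ^ (n + 1) : ℕ) := by exact_mod_cast Nat.one_le_two_pow
      nlinarith
    calc k * η * s ≤ θ * ((n + 1 : ℕ) * s) * η * s := by gcongr
      _ = θ * (η * ((n + 1 : ℕ) * s * s)) := by ring
      _ ≤ θ * ε := by gcongr; linarith
  rw [div_mul_eq_mul_div, div_le_iff₀ (by linarith), mul_comm _ C]
  refine le_trans ?_ h1
  have hfac : (P ^ (θ - 1)) ^ (s * (n + 1)) = P ^ ((θ - 1) * ((s : ℝ) * (n + 1 : ℕ))) := by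
    rw [← Real.rpow_natCast, ← Real.rpow_mul hP0.le]
    push_cast
    rfl
  calc c * ((b / (4 * A)) ^ s) ^ (n + 1) *
        (P ^ θ) ^ (((n + 1 : ℕ) : ℝ) * s - (2 ^ (n + 1) : ℕ) * k / θ - ε)
      = (c * P ^ ((s : ℝ) * (n + 1 : ℕ) - (2 ^ (n + 1) : ℕ) * k - θ * ε)) *
          ((b / (4 * A) * P ^ (θ - 1)) ^ s) ^ (n + 1) := by
        rw [rpow_mul_sub_eq hP0 hθ, Real.rpow_add hP0, ← hfac, mul_pow, mul_pow,
          ← pow_mul (P ^ (θ - 1))]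
        ring
    _ ≤ (c * P ^ ((s : ℝ) * (n + 1 : ℕ) - (2 ^ (n + 1) : ℕ) * k - k * η * s)) *
          (z ^ s) ^ (n + 1) := by gcongr
    _ ≤ _ := by gcongr

theorem mainTheorem6 {s r d : ℕ} (hd : 2 ≤ d)
    (F : Fin r → MvPolynomial (Fin s) ℤ) (hF : ∀ i, (F i).IsHomogeneous d)
    (B : Set (Fin s → ℝ)) (hB : IsBox B)
    (B' : Set (Fin s → ℝ)) (hB' : IsBox B') (h0 : (0 : Fin s → ℝ) ∈ interior B')
    (ε : ℝ) (hε : 0 < ε) :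
    ∃ C c : ℝ, 0 < C ∧ 0 < c ∧
      ∀ (θ k P : ℝ) (α : Fin r → ℝ), 0 < θ → θ ≤ 1 → 0 < k → 1 ≤ P →
        (‖expSum F B P α‖ ≤ C * P ^ ((s : ℝ) - k)) ∨
        (∃ (a : Fin r → ℤ) (q : ℤ),
          Int.gcd (Finset.univ.gcd a) q = 1 ∧
          (∀ i, |(q : ℝ) * α i - (a i : ℝ)| ≤
            C * P ^ (-(d : ℝ) + (r : ℝ) * ((d : ℝ) - 1) * θ)) ∧
          1 ≤ q ∧ (q : ℝ) ≤ C * P ^ ((r : ℝ) * ((d : ℝ) - 1) * θ)) ∨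
        (∃ a : Fin r → ℤ, a ≠ 0 ∧
          c * (P ^ θ) ^ (((d : ℝ) - 1) * (s : ℝ) - (2 : ℝ) ^ (d - 1) * k / θ - ε) ≤
            (zeroCount d F B' a (P ^ θ) : ℝ)) := by
  obtain ⟨n, rfl⟩ : ∃ n, d = n + 2 := ⟨d - 2, by omega⟩
  rcases r with _ | ρ
  -- without forms the rational approximation is vacuous
  · refine ⟨1, 1, one_pos, one_pos, fun θ k P α _ _ _ _ => Or.inr (Or.inl ⟨0, 1, ?_⟩)⟩
    simp
  obtain ⟨b, hb, hb1, hbB⟩ := exists_cube_subset h0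
  obtain ⟨c₁, hc₁, hcount⟩ := exists_le_ncard_nearTuples_shrunk F hF hB hε hb hb1
  obtain ⟨CF, hCF, hpolar⟩ := exists_abs_polarForm_le (n + 1) F
  set C : ℝ := (ρ + 1).factorial * CF ^ (ρ + 1) with hC
  have hC1 : 1 ≤ C := one_le_mul_of_one_le_of_one_le
    (by exact_mod_cast Nat.one_le_iff_ne_zero.2 (Nat.factorial_ne_zero _)) (one_le_pow₀ hCF)
  set c : ℝ := min c₁ (b ^ ((n + 1) * s)) with hc
  have hc0 : 0 < c := lt_min hc₁ (by positivity)
  refine ⟨C, c, by linarith, hc0, ?_⟩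
  intro θ k P α hθ hθ1 hk hP
  have hP0 : 0 < P := by linarith
  have hX1 : 1 ≤ P ^ θ := Real.one_le_rpow hP hθ.le
  have hX0 : 0 < P ^ θ := by linarith
  have hd1 : ((n + 2 : ℕ) : ℝ) - 1 = (n + 1 : ℕ) := by push_cast; ring
  have hM : (2 : ℝ) ^ (n + 2 - 1) = (2 ^ (n + 1) : ℕ) := by push_cast; rfl
  rw [hd1, hM]
  set E : ℝ := ((n + 1 : ℕ) : ℝ) * s - (2 ^ (n + 1) : ℕ) * k / θ - ε with hE
  by_cases hS : ‖expSum F B P α‖ ≤ C * P ^ ((s : ℝ) - k)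
  · exact Or.inl hS
  right
  have hone : (1 : Fin (ρ + 1) → ℤ) ≠ 0 := one_ne_zero
  have h0B : (0 : Fin s → ℝ) ∈ B' := interior_subset h0
  -- if the exponent or the size `P ^ θ` is small, then the tuple `0` suffices
  have htriv : c * (P ^ θ) ^ E ≤ 1 → ∃ a : Fin (ρ + 1) → ℤ, a ≠ 0 ∧
      c * (P ^ θ) ^ E ≤ (zeroCount (n + 2) F B' a (P ^ θ) : ℝ) := fun h =>
    ⟨1, hone, h.trans (by exact_mod_cast one_le_zeroCount F hB' h0B 1 (P ^ θ))⟩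
  have hMk : 0 ≤ ((2 ^ (n + 1) : ℕ) : ℝ) * k / θ := by positivity
  have hc1 : c ≤ 1 := (min_le_right _ _).trans (pow_le_one₀ hb.le hb1)
  by_cases hkθ : ((2 ^ (n + 1) : ℕ) : ℝ) * k ≤ θ * ((n + 1 : ℕ) * s)
  swap
  · refine Or.inr (htriv ?_)
    have hE0 : E ≤ 0 := by
      have : ((n + 1 : ℕ) : ℝ) * s ≤ (2 ^ (n + 1) : ℕ) * k / θ := by
        rw [le_div_iff₀ hθ]; linarith
      linarith
    exact mul_le_one₀ hc1 (by positivity) (Real.rpow_le_one_of_one_le_of_nonpos hX1 hE0)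
  by_cases hbP : 1 ≤ b * P ^ θ
  swap
  · refine Or.inr (htriv ?_)
    push Not at hbP
    have hE1 : E ≤ ((n + 1) * s : ℕ) := by
      rw [Nat.cast_mul]
      linarith
    calc c * (P ^ θ) ^ E ≤ b ^ ((n + 1) * s) * (P ^ θ) ^ (((n + 1) * s : ℕ) : ℝ) := by
          gcongr
          exact min_le_right _ _
      _ = (b * P ^ θ) ^ ((n + 1) * s) := by rw [Real.rpow_natCast, mul_pow]
      _ ≤ 1 := pow_le_one₀ (by positivity) hbP.le
  have hS' : P ^ ((s : ℝ) - k) < ‖expSum F B P α‖ := by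
    push Not at hS
    refine lt_of_le_of_lt ?_ hS
    exact le_mul_of_one_le_left (by positivity) hC1
  obtain ⟨δ, hδ0, hδ, hN⟩ := hcount α θ k P hθ hθ1 hk hP hbP hkθ hS'
  have hbX : b * P ^ θ ≤ P ^ θ := mul_le_of_le_one_left hX0.le hb1
  rcases exists_approx_or_forall_pencilForm_eq_zero F α
    (nearTuples (fun (x : Fin (n + 1) → Fin s → ℤ) j => pencilForm (n + 2) F α j x)
      (fun _ => b * P ^ θ) δ) (β := CF * (P ^ θ) ^ (n + 1)) (δ := δ)
    (fun x hx i j => hpolar i j x (P ^ θ) fun t l => (hx.1 t l).trans hbX)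
    (fun x hx j => hx.2 j) with ⟨a, q, hgcd, happ, hq1, hq⟩ | ⟨a, ha, hzero⟩
  · refine Or.inl ⟨a, q, hgcd, fun i => (happ i).trans ?_, hq1, hq.trans ?_⟩
    · calc (ρ + 1 : ℝ) * (ρ.factorial * (CF * (P ^ θ) ^ (n + 1)) ^ ρ * δ)
          ≤ (ρ + 1 : ℝ) * (ρ.factorial * (CF * (P ^ θ) ^ (n + 1)) ^ ρ *
              ((P ^ (θ - 1)) ^ (n + 1) * P⁻¹)) := by gcongr
        _ = (ρ + 1).factorial * CF ^ ρ *
              (((P ^ θ) ^ (n + 1)) ^ ρ * ((P ^ (θ - 1)) ^ (n + 1) * P⁻¹)) := by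
            rw [Nat.factorial_succ, mul_pow CF]; push_cast; ring
        _ = (ρ + 1).factorial * CF ^ ρ *
              P ^ (-((n + 2 : ℕ) : ℝ) + ((ρ + 1 : ℕ) : ℝ) * (n + 1 : ℕ) * θ) := by
            congr 1
            rw [← pow_mul, ← Real.rpow_natCast, ← Real.rpow_natCast (P ^ (θ - 1)),
              ← Real.rpow_mul hP0.le, ← Real.rpow_mul hP0.le, ← Real.rpow_neg_one P,
              ← Real.rpow_add hP0, ← Real.rpow_add hP0]
            congr 1
            push_cast
            ring
        _ ≤ C * P ^ (-((n + 2 : ℕ) : ℝ) + ((ρ + 1 : ℕ) : ℝ) * (n + 1 : ℕ) * θ) := by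
            rw [hC]
            gcongr
            omega
    · refine le_of_eq ?_
      rw [hC, mul_pow CF, ← mul_assoc, ← pow_mul, ← Real.rpow_natCast (P ^ θ),
        ← Real.rpow_mul hP0.le]
      congr 2
      push_cast
      ring
  · refine Or.inr ⟨a, ha, le_trans ?_ (hN.trans ?_)⟩
    · rw [← hE]
      gcongr
      exact min_le_left _ _
    · have := ncard_le_zeroCount F hB' a (P ^ θ) _ fun x hx =>
        ⟨fun t => mem_latticePoints_of_abs_le hX0 hbB (hx.1 t), hzero x hx⟩
      exact_mod_cast this
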